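/- Let $m_1>0$, let $B(0,\frac{m_1}{2})\subset\mathbb R^3$ be the open ball, and let $k\ge 5$. Write $(\rho,z,\varphi)$ for cylindrical coordinates, $x=(x^1,x^2,x^3)$ for Cartesian coordinates and $r=|x|$ on $\mathbb R^3$; $f=o_l(r^s)$ means that all derivatives of $f$ of order $j\le l$ are $o(r^{s-j})$ as $r\to\infty$. Let $U_S,\alpha_S,\bar B_S,\bar A_S$ be smooth ($C^\infty$ up to the boundary), $\varphi$-independent functions on $M=\mathbb R^3\setminus B(0,\frac{m_1}{2})$ with $\alpha_S=0$ where $\rho=0$, $$U_S=o_{k-3}(r^{-1/2}),\quad \alpha_S=o_{k-4}(r^{-1/2}),\quad \bar B_S=o_{k-3}(r^{-5/2}),\quad \bar A_S=o_{k-3}(r^{-3/2}),$$ and let $M$ carry the axisymmetric, asymptotically flat metric $$g=e^{-2U_S+2\alpha_S}(d\rho^2+dz^2)+\rho^2e^{-2U_S}\,(d\varphi+\rho\,\bar B_S\,d\rho+\bar A_S\,dz)^2 ,$$ whose Cartesian components are assumed to satisfy $\partial_l g_{ij}\in L^2(\{r>R\})$ for some $R>\frac{m_1}{2}$. Assume that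 the scalar curvature satisfies $R_g\ge 0$ on $M$, that $\partial M=\partial B(0,\frac{m_1}{2})$ is a minimal surface in $(M,g)$, and that $$U_S-\tfrac12\alpha_S\equiv C_H\ge -2\log 2\quad\text{on }\partial B(0,\tfrac{m_1}{2})$$ for a constant $C_H$. For functions $\Phi,\Psi$ put $$\begin{aligned}J_{\Phi,\Psi}(U_S,\alpha_S)={}&\frac1{4\pi}\int_{\mathbb R^3\setminus B(0,\frac{m_1}{2})}\Big\{\frac12\Phi\,\Big|\nabla U_S+\frac1\Phi\nabla(\Phi-\Psi)\Big|^2-\frac1{2\Phi}|\nabla(\Phi-\Psi)|^2\Big\}\,d^3x\\&+\frac1{4\pi}\int_{\partial B(0,\frac{m_1}{2})}\Big\{\frac2{m_1}\Phi+\frac12\alpha_S\Big(\partial_r\Phi+\frac2{m_1}\Phi\Big)-U_S\,\partial_r\Psi\Big\}\,d\sigma\\&-\sqrt{\frac1{16\pi}\int_{\partial B(0,\frac{m_1}{2})}e^{\alpha_S-2U_S}\,d\sigma}\;,\end{aligned}$$ where $\nabla$, $|\cdot|$, $d^3x$, $d\sigma$ are those of the flat metric. Then, with $\Phi_*=1-\frac{m_1^2}{4r^2}$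 and $\Psi_*=-\frac{m_1}{r}$, $$J_{\Phi_*,\Psi_*}(U_S,\alpha_S)\ge 0 .$$ Moreover, equality holds if and only if $g$ is the metric of a Schwarzschild slice, i.e. if and only if, for some $\mu>0$, there is a diffeomorphism, commuting with the rotations about the $z$-axis, from $M$ onto $\mathbb R^3\setminus B(0,\frac{\mu}{2})$ which pulls the metric $\big(1+\frac{\mu}{2r}\big)^4\big((dx^1)^2+(dx^2)^2+(dx^3)^2\big)$ back to $g$. -/

import Mathlib

open scoped ContDiff

noncomputable section

namespace Axisym

/-- Euclidean three-space with Cartesian coordinates `x = x 0`, `y = x 1`, `z = x 2`. -/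
abbrev E3 : Type := EuclideanSpace ℝ (Fin 3)

/-- The closed exterior region `ℝ³ \ B(0, R)`, where `B(0, R)` is the open ball. -/
def exterior (R : ℝ) : Set E3 := {x | R ≤ ‖x‖}

/-- The interior of the exterior region. -/
def openExterior (R : ℝ) : Set E3 := {x | R < ‖x‖}

/-- The cylindrical radius `ρ`. -/
def rho (x : E3) : ℝ := Real.sqrt (x 0 ^ 2 + x 1 ^ 2)

/-- Rotation by the angle `t` about the `z`-axis. -/
def rot (t : ℝ) (x : E3) : E3 :=
  !₂[Real.cos t * x 0 - Real.sin t * x 1, Real.sin t * x 0 + Real.cos t * x 1, x 2]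

/-- `f = o_l(r^s)`: every derivative of order `j ≤ l` is `o(r^(s - j))` as `r → ∞`. -/
def IsLittleOrder (l : ℕ) (s : ℝ) (f : E3 → ℝ) : Prop :=
  ∀ j : ℕ, j ≤ l →
    (fun x : E3 => iteratedFDeriv ℝ j f x) =o[Bornology.cobounded E3]
      (fun x : E3 => ‖x‖ ^ (s - (j : ℝ)))

/-! ### The metric -/

/-- The covector `dρ` at a point `x` off the axis. -/
def dRho (x v : E3) : ℝ := (x 0 * v 0 + x 1 * v 1) / rho x

/-- The covector `dφ` at a point `x` off the axis. -/
def dPhi (x v : E3) : ℝ := (x 0 * v 1 - x 1 * v 0) / rho x ^ 2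

/-- The covector `dφ + ρ B dρ + A dz` at a point `x` off the axis. -/
def connForm (B A : E3 → ℝ) (x v : E3) : ℝ :=
  dPhi x v + rho x * B x * dRho x v + A x * v 2

/-- The axisymmetric metric
`e^(-2U+2α) (dρ² + dz²) + ρ² e^(-2U) (dφ + ρ B dρ + A dz)²`.
The formula is meaningful off the axis `ρ = 0`, and is only used there; for functions that are
smooth and axisymmetric, with `α = 0` on the axis, the metric extends smoothly to the axis. -/
def metric (U α B A : E3 → ℝ) (x v w : E3) : ℝ :=
  Real.exp (-2 * U x + 2 * α x) * (dRho x v * dRho x w + v 2 * w 2)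
    + rho x ^ 2 * Real.exp (-2 * U x) * (connForm B A x v * connForm B A x w)

/-- Cylindrical coordinates `q = (ρ, z, φ)`. -/
def cyl (q : Fin 3 → ℝ) : E3 := !₂[q 0 * Real.cos (q 2), q 0 * Real.sin (q 2), q 1]

/-- The coordinate vector fields `∂_ρ, ∂_z, ∂_φ` at `cyl q`. -/
def cylFrame (q : Fin 3 → ℝ) : Fin 3 → E3 :=
  ![!₂[Real.cos (q 2), Real.sin (q 2), 0],
    !₂[0, 0, 1],
    !₂[-(q 0 * Real.sin (q 2)), q 0 * Real.cos (q 2), 0]]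

/-- Components in the cylindrical chart `(ρ, z, φ)` of a field of bilinear forms. -/
def cylComponents (g : E3 → E3 → E3 → ℝ) (q : Fin 3 → ℝ) : Matrix (Fin 3) (Fin 3) ℝ :=
  Matrix.of fun i j => g (cyl q) (cylFrame q i) (cylFrame q j)

/-! ### Curvature of a metric given by its components in a chart -/

/-- The `i`-th coordinate derivative. -/
def pd (i : Fin 3) (f : (Fin 3 → ℝ) → ℝ) (q : Fin 3 → ℝ) : ℝ :=
  fderiv ℝ f q (Pi.single i 1)

/-- The `i`-th coordinate derivative in a chart domain `S` which may have a boundary. -/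
def pdWithin (S : Set (Fin 3 → ℝ)) (i : Fin 3) (f : (Fin 3 → ℝ) → ℝ) (q : Fin 3 → ℝ) : ℝ :=
  fderivWithin ℝ f S q (Pi.single i 1)

/-- The Christoffel symbol `Γ^k_{ij}`. -/
def christoffel (G : (Fin 3 → ℝ) → Matrix (Fin 3) (Fin 3) ℝ) (k i j : Fin 3)
    (q : Fin 3 → ℝ) : ℝ :=
  (1 / 2) * ∑ l, (G q)⁻¹ k l *
    (pd i (fun p => G p j l) q + pd j (fun p => G p i l) q - pd l (fun p => G p i j) q)

/-- The Ricci tensor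
`R_{ij} = ∂_k Γ^k_{ij} - ∂_j Γ^k_{ki} + Γ^k_{kl} Γ^l_{ij} - Γ^k_{jl} Γ^l_{ki}`. -/
def ricci (G : (Fin 3 → ℝ) → Matrix (Fin 3) (Fin 3) ℝ) (i j : Fin 3) (q : Fin 3 → ℝ) : ℝ :=
  ∑ k, (pd k (christoffel G k i j) q - pd j (christoffel G k k i) q
    + ∑ l, (christoffel G k k l q * christoffel G l i j q
      - christoffel G k j l q * christoffel G l k i q))

/-- The scalar curvature `g^{ij} R_{ij}`. -/
def scalarCurvature (G : (Fin 3 → ℝ) → Matrix (Fin 3) (Fin 3) ℝ) (q : Fin 3 → ℝ) : ℝ :=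
  ∑ i, ∑ j, (G q)⁻¹ i j * ricci G i j q

/-- The unit normal `grad f / |grad f|` to the level sets of `f`, in the chart domain `S`. -/
def unitNormal (G : (Fin 3 → ℝ) → Matrix (Fin 3) (Fin 3) ℝ) (S : Set (Fin 3 → ℝ))
    (f : (Fin 3 → ℝ) → ℝ) (i : Fin 3) (q : Fin 3 → ℝ) : ℝ :=
  (∑ j, (G q)⁻¹ i j * pdWithin S j f q) /
    Real.sqrt (∑ k, ∑ l, (G q)⁻¹ k l * pdWithin S k f q * pdWithin S l f q)

/-- The mean curvature of the level set of `f` through `q` with respect to the unit normal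
`ν = grad f / |grad f|`, as the divergence `(det g)^(-1/2) ∂_i ((det g)^(1/2) ν^i)`. -/
def meanCurvature (G : (Fin 3 → ℝ) → Matrix (Fin 3) (Fin 3) ℝ) (S : Set (Fin 3 → ℝ))
    (f : (Fin 3 → ℝ) → ℝ) (q : Fin 3 → ℝ) : ℝ :=
  (∑ i, pdWithin S i (fun p => Real.sqrt (G p).det * unitNormal G S f i p) q) /
    Real.sqrt (G q).det

/-- The spherical radius `r = (ρ² + z²)^(1/2)` in the cylindrical chart. -/
def cylRadius (q : Fin 3 → ℝ) : ℝ := Real.sqrt (q 0 ^ 2 + q 1 ^ 2)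

/-- The part of the cylindrical chart, off the axis, that covers `exterior R`. -/
def cylDomain (R : ℝ) : Set (Fin 3 → ℝ) := {q | 0 < q 0 ∧ R ≤ cylRadius q}

/-- Nonnegative scalar curvature on `exterior R`. It is expressed at the interior points off the
axis, a dense set, in the cylindrical chart. -/
def NonnegScalarCurvature (R : ℝ) (g : E3 → E3 → E3 → ℝ) : Prop :=
  ∀ q : Fin 3 → ℝ, 0 < q 0 → R < cylRadius q → 0 ≤ scalarCurvature (cylComponents g) q

/-- The boundary sphere of `exterior R` is a minimal surface: its mean curvature vanishes (at all
points except the two poles, which follow by continuity). -/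
def MinimalBoundary (R : ℝ) (g : E3 → E3 → E3 → ℝ) : Prop :=
  ∀ q : Fin 3 → ℝ, 0 < q 0 → cylRadius q = R →
    meanCurvature (cylComponents g) (cylDomain R) cylRadius q = 0

/-! ### Axisymmetric asymptotically flat data in pseudo-spherical coordinates -/

/-- A function on `exterior R` that is smooth up to the boundary and does not depend on the
angle `φ`. -/
structure SmoothAxisymmetric (R : ℝ) (f : E3 → ℝ) : Prop where
  smooth : ContDiffOn ℝ ∞ f (exterior R)
  axisymmetric : ∀ t : ℝ, ∀ x ∈ exterior R, f (rot t x) = f x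

/-- The functions `U, α, B, A` describe an axisymmetric, asymptotically flat metric on
`ℝ³ \ B(0, m₁/2)` in pseudo-spherical coordinates. -/
structure IsAxisymmetricData (m₁ : ℝ) (k : ℕ) (U α B A : E3 → ℝ) : Prop where
  smooth_U : SmoothAxisymmetric (m₁ / 2) U
  smooth_α : SmoothAxisymmetric (m₁ / 2) α
  smooth_B : SmoothAxisymmetric (m₁ / 2) B
  smooth_A : SmoothAxisymmetric (m₁ / 2) A
  /-- Regularity of the metric on the axis. -/
  α_axis : ∀ x ∈ exterior (m₁ / 2), rho x = 0 → α x = 0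
  decay_U : IsLittleOrder (k - 3) (-1 / 2) U
  decay_α : IsLittleOrder (k - 4) (-1 / 2) α
  decay_B : IsLittleOrder (k - 3) (-5 / 2) B
  decay_A : IsLittleOrder (k - 3) (-3 / 2) A
  /-- The derivatives of the Cartesian components `g_{ij}` are square integrable in the
  asymptotic region. -/
  deriv_memLp : ∃ R : ℝ, m₁ / 2 < R ∧ ∀ i j l : Fin 3,
    MeasureTheory.MemLp
      (fun x : E3 => fderiv ℝ
        (fun y : E3 => metric U α B A y (EuclideanSpace.single i 1) (EuclideanSpace.single j 1)) x
        (EuclideanSpace.single l 1))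
      2 (MeasureTheory.volume.restrict (openExterior R))

/-! ### The functional -/

/-- The integral over the round sphere `∂B(0, R)` with respect to its Euclidean area `dσ`. -/
def sphereIntegral (R : ℝ) (f : E3 → ℝ) : ℝ :=
  R ^ 2 * ∫ u : Metric.sphere (0 : E3) 1, f (R • (u : E3))
    ∂((MeasureTheory.volume : MeasureTheory.Measure E3).toSphere)

/-- The radial derivative `∂_r f` at a point `x ≠ 0`, taken from the side of larger radii. -/
def radialDeriv (f : E3 → ℝ) (x : E3) : ℝ :=
  derivWithin (fun t : ℝ => f (t • (‖x‖⁻¹ • x))) (Set.Ici ‖x‖) ‖x‖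

/-- The functional `J_{Φ,Ψ}(U, α)`. -/
def J (m₁ : ℝ) (Φ Ψ U α : E3 → ℝ) : ℝ :=
  1 / (4 * Real.pi) * (∫ x in openExterior (m₁ / 2),
      (1 / 2 * Φ x * ‖gradient U x + (1 / Φ x) • gradient (fun y => Φ y - Ψ y) x‖ ^ 2
        - 1 / (2 * Φ x) * ‖gradient (fun y => Φ y - Ψ y) x‖ ^ 2))
    + 1 / (4 * Real.pi) * sphereIntegral (m₁ / 2) (fun x =>
        2 / m₁ * Φ x + 1 / 2 * α x * (radialDeriv Φ x + 2 / m₁ * Φ x) - U x * radialDeriv Ψ x)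
    - Real.sqrt (1 / (16 * Real.pi) *
        sphereIntegral (m₁ / 2) (fun x => Real.exp (α x - 2 * U x)))

/-- `Φ_* = 1 - m₁² / (4 r²)`. -/
def PhiStar (m₁ : ℝ) (x : E3) : ℝ := 1 - m₁ ^ 2 / (4 * ‖x‖ ^ 2)

/-- `Ψ_* = - m₁ / r`. -/
def PsiStar (m₁ : ℝ) (x : E3) : ℝ := -(m₁ / ‖x‖)

/-! ### Schwarzschild slices -/

/-- The Schwarzschild slice `(1 + μ / (2 r))⁴ (dx² + dy² + dz²)`, on `ℝ³ \ B(0, μ/2)`. -/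
def schwarzschild (μ : ℝ) (x v w : E3) : ℝ :=
  (1 + μ / (2 * ‖x‖)) ^ 4 * inner ℝ v w

/-- The axisymmetric metric `g` on `exterior R` is that of a Schwarzschild slice: for some mass
`μ > 0` there is a diffeomorphism (of manifolds with boundary) onto `exterior (μ/2)`, compatible
with the rotations about the axis, which pulls the Schwarzschild metric back to `g`. The
equality of metrics is expressed at the interior points off the axis, a dense set. -/
def IsSchwarzschildSlice (R : ℝ) (g : E3 → E3 → E3 → ℝ) : Prop :=
  ∃ μ : ℝ, 0 < μ ∧ ∃ F F' : E3 → E3,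
    ContDiffOn ℝ ∞ F (exterior R) ∧ ContDiffOn ℝ ∞ F' (exterior (μ / 2)) ∧
    Set.MapsTo F (exterior R) (exterior (μ / 2)) ∧
    Set.MapsTo F' (exterior (μ / 2)) (exterior R) ∧
    Set.InvOn F' F (exterior R) (exterior (μ / 2)) ∧
    (∀ t : ℝ, ∀ x ∈ exterior R, F (rot t x) = rot t (F x)) ∧
    ∀ x ∈ openExterior R, rho x ≠ 0 → ∀ v w : E3,
      schwarzschild μ (F x) (fderiv ℝ F x v) (fderiv ℝ F x w) = g x v w

end Axisym

end

/-!
Put `R = m₁ / 2` and use, in the half-planes `φ = const`, the coordinates `t = log (r / R) ≥ 0` and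
`θ ∈ [0, π]`, which are conformal to `(ρ, z)`. The potential of the Schwarzschild slice of mass `m₁`
is `U = -2 log (1 + e^(-t))`; the proof works with the deviation `V` of `U` from it and with the
constant `c = C_H + 2 log 2 ≥ 0`, which is the value of `V - α / 2` on the boundary.

**The functional.** Completing the square in the integrand of `J` (`integrand_eq`) and evaluating the
boundary terms gives (`IsAxisymmetricData.J_eq`)
`J = 1 / (4π) ∫ ½ Φ_* |∇V|² + m₁ (1 - c - e^(-c))`.
The energy is finite because `∂g ∈ L²` controls `∇U` at infinity
(`IsAxisymmetricData.memLp_gradient`).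

**The inequality.** The Kaluza–Klein formula for the scalar curvature
(`CircleData.scalarCurvature_eq`) turns `R_g ≥ 0` into a differential inequality for `V` and `α` in
the strip, without a zeroth-order term (`IsAxisymmetricData.strip_equation`, `bulk_deviation`), and
minimality of the boundary into `V_t - α_t / 2 = 0` at `t = 0` (`IsAxisymmetricData.dT_of_minimal`).
Averaging over `θ` produces a flux that is `c` at `t = 0` and `0` at infinity and whose derivative is
bounded below by the average of `tanh (t / 2) V_t`. Completing the square against the energy gives
`1 / (4π) ∫ ½ Φ_* |∇V|² ≥ m₁ c²` (`energy_bound`, `IsAxisymmetricData.energy_ge`), and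
`c² ≥ 2 (c - 1 + e^(-c))` for `c ≥ 0` gives `J ≥ 0`.

**Equality implies Schwarzschild.** If `J = 0`, then `c = 0` and `V = 0`
(`IsAxisymmetricData.eq_of_J_eq_zero`). The flux is then monotone and zero at both ends, so that the
curvature inequality is an equality (`bulk_eq_zero`): the connection form `ρ B dρ + A dz` is closed
and `α` is harmonic in `(t, θ)`. Since `α` is bounded and vanishes on the boundary and on the axis,
it vanishes, because `∫ α² dθ` is convex in `t` (`harmonic_eq_zero`). The closed connection form has
a primitive `λ`, smooth up to the boundary (`primitive`), and the map that rotates `x` by the angle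
`λ x` is the isometry onto the Schwarzschild slice of mass `m₁`
(`IsAxisymmetricData.isSchwarzschildSlice`).

**Schwarzschild implies equality.** Let `F` be an isometry onto the slice of mass `μ` that commutes
with the rotations. It maps the boundary to the boundary and preserves the lengths of the orbits, and
the map of half-planes that it induces is conformal (`IsSliceMap.norm_boundary`, `IsSliceMap.orbit`,
`IsSliceMap.meridian`). Hence `log |F|` is harmonic in `(t, θ)` (`laplacian_log_of_conformal`), and
the convexity argument applied to `t - log (|F| / (μ / 2))` shows that `|F| = (μ / m₁) r`
(`IsSliceMap.norm_eq`). A conformal map with this modulus is homogeneous of degree one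
(`IsSliceMap.euler`); comparing lengths of orbits, `V` and `α` are constant along the rays, and they
decay, so `V = α = 0` and `J = 0` (`IsSliceMap.J_eq_zero`).
-/

noncomputable section

namespace Axisym

open Set Filter Topology

/-! ### Scalar curvature of a circle-invariant metric -/

section PartialDerivatives
variable {f g : (Fin 3 → ℝ) → ℝ} {q : Fin 3 → ℝ} {i : Fin 3}

theorem pd_add (hf : DifferentiableAt ℝ f q) (hg : DifferentiableAt ℝ g q) :
    pd i (fun p => f p + g p) q = pd i f q + pd i g q := by
  simp [pd, fderiv_fun_add hf hg]

theorem pd_sub (hf : DifferentiableAt ℝ f q) (hg : DifferentiableAt ℝ g q) :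
    pd i (fun p => f p - g p) q = pd i f q - pd i g q := by
  simp [pd, fderiv_fun_sub hf hg]

theorem pd_neg : pd i (fun p => -f p) q = -pd i f q := by
  simp [pd, fderiv_fun_neg]

theorem pd_mul (hf : DifferentiableAt ℝ f q) (hg : DifferentiableAt ℝ g q) :
    pd i (fun p => f p * g p) q = pd i f q * g q + f q * pd i g q := by
  simp [pd, fderiv_fun_mul hf hg]; ring

theorem pd_const_mul (c : ℝ) (hf : DifferentiableAt ℝ f q) :
    pd i (fun p => c * f p) q = c * pd i f q := by
  simp [pd, fderiv_const_mul hf]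

theorem pd_const (c : ℝ) : pd i (fun _ => c) q = 0 := by simp [pd]

theorem pd_exp (hf : DifferentiableAt ℝ f q) :
    pd i (fun p => Real.exp (f p)) q = Real.exp (f q) * pd i f q := by
  simp [pd, fderiv_exp hf]

theorem pd_congr (h : f =ᶠ[𝓝 q] g) : pd i f q = pd i g q := by
  simp [pd, h.fderiv_eq]

theorem contDiffOn_pd {O : Set (Fin 3 → ℝ)} (hO : IsOpen O) (hf : ContDiffOn ℝ ∞ f O) (i : Fin 3) :
    ContDiffOn ℝ ∞ (pd i f) O := by
  have := hf.fderiv_of_isOpen hO (m := ∞) (by simp)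
  exact this.clm_apply contDiffOn_const

theorem pd_comm (hf : ContDiffAt ℝ ∞ f q) (i j : Fin 3) :
    pd i (pd j f) q = pd j (pd i f) q := by
  have h2 : IsSymmSndFDerivAt ℝ f q := hf.isSymmSndFDerivAt (by simp only [minSmoothness_of_isRCLikeNormedField]; exact WithTop.coe_le_coe.2 le_top)
  have hd : DifferentiableAt ℝ (fderiv ℝ f) q :=
    (hf.fderiv_right (m := ∞) (by simp)).differentiableAt (by simp)
  have key : ∀ k l, pd k (pd l f) q = fderiv ℝ (fderiv ℝ f) q (Pi.single k 1) (Pi.single l 1) := by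
    intro k l
    rw [pd]
    have : pd l f = fun p => (fderiv ℝ f p) (Pi.single l 1) := rfl
    rw [this, fderiv_clm_apply hd (differentiableAt_const _)]
    simp
  rw [key, key]; exact h2.eq _ _

end PartialDerivatives

/-- The matrix of `e^(2s) (dρ² + dz²) + e^(2n) (dφ + a dρ + b dz)²` in the frame
`∂_ρ, ∂_z, ∂_φ`. -/
def circleMatrix (s n a b : ℝ) : Matrix (Fin 3) (Fin 3) ℝ :=
  !![Real.exp (2 * s) + Real.exp (2 * n) * (a * a), Real.exp (2 * n) * (a * b),
      Real.exp (2 * n) * a;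
    Real.exp (2 * n) * (a * b), Real.exp (2 * s) + Real.exp (2 * n) * (b * b),
      Real.exp (2 * n) * b;
    Real.exp (2 * n) * a, Real.exp (2 * n) * b, Real.exp (2 * n)]

theorem circleMatrix_inv (s n a b : ℝ) : (circleMatrix s n a b)⁻¹ =
    !![Real.exp (-(2 * s)), 0, -(Real.exp (-(2 * s)) * a);
      0, Real.exp (-(2 * s)), -(Real.exp (-(2 * s)) * b);
      -(Real.exp (-(2 * s)) * a), -(Real.exp (-(2 * s)) * b),
        Real.exp (-(2 * n)) + Real.exp (-(2 * s)) * (a * a + b * b)] := by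
  apply Matrix.inv_eq_left_inv
  have e1 : Real.exp (-(2 * s)) * Real.exp (2 * s) = 1 := by rw [← Real.exp_add]; simp
  have e2 : Real.exp (-(2 * n)) * Real.exp (2 * n) = 1 := by rw [← Real.exp_add]; simp
  ext i j
  fin_cases i <;> fin_cases j <;>
    simp [circleMatrix, Matrix.mul_apply, Fin.sum_univ_three] <;> grind

theorem circleMatrix_det (s n a b : ℝ) :
    (circleMatrix s n a b).det = Real.exp (2 * s) * Real.exp (2 * s) * Real.exp (2 * n) := by
  rw [circleMatrix, Matrix.det_fin_three]
  simp
  ring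

/-- The data of a metric `e^(2s) (dρ² + dz²) + e^(2n) (dφ + a dρ + b dz)²` with `s, n, a, b`
independent of `φ`, on an open set `O` of the cylindrical chart. -/
structure CircleData (O : Set (Fin 3 → ℝ)) (G : (Fin 3 → ℝ) → Matrix (Fin 3) (Fin 3) ℝ)
    (s n a b : (Fin 3 → ℝ) → ℝ) : Prop where
  isOpen : IsOpen O
  s_smooth : ContDiffOn ℝ ∞ s O
  n_smooth : ContDiffOn ℝ ∞ n O
  a_smooth : ContDiffOn ℝ ∞ a O
  b_smooth : ContDiffOn ℝ ∞ b O
  s_phi : ∀ p ∈ O, pd 2 s p = 0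
  n_phi : ∀ p ∈ O, pd 2 n p = 0
  a_phi : ∀ p ∈ O, pd 2 a p = 0
  b_phi : ∀ p ∈ O, pd 2 b p = 0
  eq : ∀ p ∈ O, G p = circleMatrix (s p) (n p) (a p) (b p)

/-- Closed form of the Christoffel symbols `Γ^k_{ij}` of a circle-invariant metric. -/
def circleChristoffel (s n a b : (Fin 3 → ℝ) → ℝ) (k i j : Fin 3) (p : Fin 3 → ℝ) : ℝ :=
  let K := Real.exp (2 * n p - 2 * s p)
  let f := pd 0 b p - pd 1 a p
  let g0 : Matrix (Fin 3) (Fin 3) ℝ :=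
    !![pd 0 s p - K * (pd 0 n p * (a p * a p)),
        pd 1 s p - K * (f * a p * (1 / 2) + pd 0 n p * (a p * b p)),
        -(K * (pd 0 n p * a p));
      pd 1 s p - K * (f * a p * (1 / 2) + pd 0 n p * (a p * b p)),
        -pd 0 s p - K * (f * b p + pd 0 n p * (b p * b p)),
        -(K * (f * (1 / 2) + pd 0 n p * b p));
      -(K * (pd 0 n p * a p)), -(K * (f * (1 / 2) + pd 0 n p * b p)), -(K * pd 0 n p)]
  let g1 : Matrix (Fin 3) (Fin 3) ℝ :=
    !![-pd 1 s p + K * (f * a p - pd 1 n p * (a p * a p)),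
        pd 0 s p + K * (f * b p * (1 / 2) - pd 1 n p * (a p * b p)),
        K * (f * (1 / 2) - pd 1 n p * a p);
      pd 0 s p + K * (f * b p * (1 / 2) - pd 1 n p * (a p * b p)),
        pd 1 s p - K * (pd 1 n p * (b p * b p)),
        -(K * (pd 1 n p * b p));
      K * (f * (1 / 2) - pd 1 n p * a p), -(K * (pd 1 n p * b p)), -(K * pd 1 n p)]
  let v : Matrix (Fin 3) (Fin 3) ℝ :=
    !![2 * (pd 0 n p * a p) + pd 0 a p,
        pd 0 n p * b p + pd 1 n p * a p + (pd 0 b p + pd 1 a p) * (1 / 2), pd 0 n p;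
      pd 0 n p * b p + pd 1 n p * a p + (pd 0 b p + pd 1 a p) * (1 / 2),
        2 * (pd 1 n p * b p) + pd 1 b p, pd 1 n p;
      pd 0 n p, pd 1 n p, 0]
  ![g0 i j, g1 i j, v i j - a p * g0 i j - b p * g1 i j] k

variable {O : Set (Fin 3 → ℝ)} {G : (Fin 3 → ℝ) → Matrix (Fin 3) (Fin 3) ℝ}
  {s n a b : (Fin 3 → ℝ) → ℝ}

theorem CircleData.christoffel_eq (h : CircleData O G s n a b) (k i j : Fin 3)
    {p : Fin 3 → ℝ} (hp : p ∈ O) :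
    christoffel G k i j p = circleChristoffel s n a b k i j p := by
  have ev : ∀ᶠ y in 𝓝 p, y ∈ O := h.isOpen.mem_nhds hp
  have hs : DifferentiableAt ℝ s p := ((h.s_smooth.contDiffAt ev).differentiableAt (by simp))
  have hn : DifferentiableAt ℝ n p := ((h.n_smooth.contDiffAt ev).differentiableAt (by simp))
  have ha : DifferentiableAt ℝ a p := ((h.a_smooth.contDiffAt ev).differentiableAt (by simp))
  have hb : DifferentiableAt ℝ b p := ((h.b_smooth.contDiffAt ev).differentiableAt (by simp))
  have s2 := h.s_phi p hp
  have n2 := h.n_phi p hp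
  have a2 := h.a_phi p hp
  have b2 := h.b_phi p hp
  have dX : ∀ m, pd m (fun y => Real.exp (2 * s y)) p = Real.exp (2 * s p) * (2 * pd m s p) := by
    intro m; rw [pd_exp (by fun_prop), pd_const_mul _ hs]
  have dN : ∀ m, pd m (fun y => Real.exp (2 * n y)) p = Real.exp (2 * n p) * (2 * pd m n p) := by
    intro m; rw [pd_exp (by fun_prop), pd_const_mul _ hn]
  have D : ∀ m, (Matrix.of fun i j => pd m (fun y => G y i j) p) =
      !![2 * pd m s p * Real.exp (2 * s p)
          + Real.exp (2 * n p) * (2 * pd m n p * a p * a p + 2 * a p * pd m a p),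
        Real.exp (2 * n p) * (2 * pd m n p * a p * b p + a p * pd m b p + pd m a p * b p),
        Real.exp (2 * n p) * (2 * pd m n p * a p + pd m a p);
        Real.exp (2 * n p) * (2 * pd m n p * a p * b p + a p * pd m b p + pd m a p * b p),
        2 * pd m s p * Real.exp (2 * s p)
          + Real.exp (2 * n p) * (2 * pd m n p * b p * b p + 2 * b p * pd m b p),
        Real.exp (2 * n p) * (2 * pd m n p * b p + pd m b p);
        Real.exp (2 * n p) * (2 * pd m n p * a p + pd m a p),
        Real.exp (2 * n p) * (2 * pd m n p * b p + pd m b p),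
        Real.exp (2 * n p) * (2 * pd m n p)] := by
    intro m
    ext i j
    have e : (fun y => G y i j) =ᶠ[𝓝 p] fun y => !![Real.exp (2 * s y)
        + Real.exp (2 * n y) * (a y * a y), Real.exp (2 * n y) * (a y * b y),
        Real.exp (2 * n y) * a y;
      Real.exp (2 * n y) * (a y * b y), Real.exp (2 * s y) + Real.exp (2 * n y) * (b y * b y),
        Real.exp (2 * n y) * b y;
      Real.exp (2 * n y) * a y, Real.exp (2 * n y) * b y, Real.exp (2 * n y)] i j := by
      filter_upwards [ev] with y hy
      rw [h.eq y hy, circleMatrix]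
    rw [Matrix.of_apply, pd_congr e]
    fin_cases i <;> fin_cases j <;>
      simp (disch := fun_prop) only [Fin.mk_zero, Fin.mk_one, Fin.reduceFinMk,
        Fin.isValue, Matrix.of_apply, Matrix.cons_val,
        pd_add, pd_mul, dX, dN] <;> ring
  have D' : ∀ m i j, pd m (fun y => G y i j) p = _ := fun m i j => congrFun₂ (D m) i j
  rw [christoffel, h.eq p hp, circleMatrix_inv]
  have eK : Real.exp (2 * n p - 2 * s p) = Real.exp (2 * n p) * Real.exp (-(2 * s p)) := by
    rw [← Real.exp_add]; ring_nf
  have e1 : Real.exp (-(2 * s p)) * Real.exp (2 * s p) = 1 := by rw [← Real.exp_add]; simp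
  have e2 : Real.exp (-(2 * n p)) * Real.exp (2 * n p) = 1 := by rw [← Real.exp_add]; simp
  simp only [Fin.sum_univ_three, D', circleChristoffel, eK]
  generalize Real.exp (-(2 * s p)) = Y at *
  generalize Real.exp (-(2 * n p)) = Z at *
  generalize Real.exp (2 * s p) = X at *
  generalize Real.exp (2 * n p) = N at *
  clear eK D D' dX dN
  fin_cases k <;> fin_cases i <;> fin_cases j <;>
    simp [s2, n2, a2, b2] <;> grind

set_option maxHeartbeats 2000000 in
/-- The Kaluza–Klein formula for the scalar curvature of a circle-invariant metric: the curvature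
of the quotient surface, the term from the length of the circles, and minus the square of the
curvature `∂_ρ b - ∂_z a` of the connection. -/
theorem CircleData.scalarCurvature_eq (h : CircleData O G s n a b) {q : Fin 3 → ℝ} (hq : q ∈ O) :
    Real.exp (2 * s q) * scalarCurvature G q =
      -2 * (pd 0 (pd 0 s) q + pd 1 (pd 1 s) q)
      - 2 * (pd 0 (pd 0 n) q + pd 1 (pd 1 n) q + pd 0 n q ^ 2 + pd 1 n q ^ 2)
      - 1 / 2 * Real.exp (2 * n q - 2 * s q) * (pd 0 b q - pd 1 a q) ^ 2 := by
  have ev : ∀ᶠ y in 𝓝 q, y ∈ O := h.isOpen.mem_nhds hq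
  have dif : ∀ {f : (Fin 3 → ℝ) → ℝ}, ContDiffOn ℝ ∞ f O → DifferentiableAt ℝ f q :=
    fun hf => (hf.contDiffAt ev).differentiableAt (by simp)
  have hs := dif h.s_smooth
  have hn := dif h.n_smooth
  have ha := dif h.a_smooth
  have hb := dif h.b_smooth
  have hs0 := dif (contDiffOn_pd h.isOpen h.s_smooth 0)
  have hs1 := dif (contDiffOn_pd h.isOpen h.s_smooth 1)
  have hn0 := dif (contDiffOn_pd h.isOpen h.n_smooth 0)
  have hn1 := dif (contDiffOn_pd h.isOpen h.n_smooth 1)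
  have ha0 := dif (contDiffOn_pd h.isOpen h.a_smooth 0)
  have ha1 := dif (contDiffOn_pd h.isOpen h.a_smooth 1)
  have hb0 := dif (contDiffOn_pd h.isOpen h.b_smooth 0)
  have hb1 := dif (contDiffOn_pd h.isOpen h.b_smooth 1)
  have cs : pd 1 (pd 0 s) q = pd 0 (pd 1 s) q := pd_comm (h.s_smooth.contDiffAt ev) _ _
  have cn : pd 1 (pd 0 n) q = pd 0 (pd 1 n) q := pd_comm (h.n_smooth.contDiffAt ev) _ _
  have ca : pd 1 (pd 0 a) q = pd 0 (pd 1 a) q := pd_comm (h.a_smooth.contDiffAt ev) _ _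
  have cb : pd 1 (pd 0 b) q = pd 0 (pd 1 b) q := pd_comm (h.b_smooth.contDiffAt ev) _ _
  have zero2 : ∀ {f : (Fin 3 → ℝ) → ℝ}, ContDiffOn ℝ ∞ f O → (∀ p ∈ O, pd 2 f p = 0) →
      ∀ i, pd 2 (pd i f) q = 0 := by
    intro f hf h2 i
    rw [pd_comm (hf.contDiffAt ev), pd_congr (g := fun _ => 0), pd_const]
    filter_upwards [ev] with y hy using h2 y hy
  have s2 := h.s_phi q hq
  have n2 := h.n_phi q hq
  have a2 := h.a_phi q hq
  have b2 := h.b_phi q hq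
  have s2' := zero2 h.s_smooth h.s_phi
  have n2' := zero2 h.n_smooth h.n_phi
  have a2' := zero2 h.a_smooth h.a_phi
  have b2' := zero2 h.b_smooth h.b_phi
  have dK : ∀ m, pd m (fun y => Real.exp (2 * n y - 2 * s y)) q =
      Real.exp (2 * n q - 2 * s q) * (2 * pd m n q - 2 * pd m s q) := by
    intro m
    rw [pd_exp (by fun_prop), pd_sub (by fun_prop) (by fun_prop), pd_const_mul _ hs,
      pd_const_mul _ hn]
  have dGam : ∀ m k i j, pd m (christoffel G k i j) q =
      pd m (circleChristoffel s n a b k i j) q := by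
    intro m k i j
    apply pd_congr
    filter_upwards [ev] with y hy using h.christoffel_eq k i j hy
  simp only [scalarCurvature, ricci, dGam, fun k i j => h.christoffel_eq k i j hq, h.eq q hq, circleMatrix_inv,
    Fin.sum_univ_three]
  have hK : DifferentiableAt ℝ (fun y => Real.exp (2 * n y - 2 * s y)) q := by fun_prop
  unfold circleChristoffel
  simp (disch := fun_prop) only [Fin.isValue, Matrix.of_apply, Matrix.cons_val,
        pd_add, pd_sub, pd_neg, pd_mul, pd_const, dK, s2, n2, a2, b2, s2', n2', a2', b2', cs, cn,
        cb]
  have e1 : Real.exp (-(2 * s q)) * Real.exp (2 * s q) = 1 := by rw [← Real.exp_add]; simp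
  have e2 : Real.exp (-(2 * n q)) * Real.exp (2 * n q - 2 * s q) = Real.exp (-(2 * s q)) := by
    rw [← Real.exp_add]; ring_nf
  generalize Real.exp (-(2 * s q)) = Y at *
  generalize Real.exp (-(2 * n q)) = Z at *
  generalize Real.exp (2 * s q) = X at *
  have hK0 : Real.exp (2 * n q - 2 * s q) ≠ 0 := (Real.exp_pos _).ne'
  generalize Real.exp (2 * n q - 2 * s q) = K at *
  have hY0 : Y ≠ 0 := left_ne_zero_of_mul_eq_one e1
  obtain rfl : X = 1 / Y := by field_simp; linarith
  obtain rfl : Z = Y / K := by field_simp; linarith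
  field_simp
  ring

/-! ### Calculus on the half-strip -/

/-- The half-plane `t ≥ 0` of pairs `(t, θ)`. -/
def halfStrip : Set (ℝ × ℝ) := {p | 0 ≤ p.1}

/-- The derivative `∂_t` on the half-plane `t ≥ 0`, one-sided at `t = 0`. -/
def dT (h : ℝ × ℝ → ℝ) (p : ℝ × ℝ) : ℝ := fderivWithin ℝ h halfStrip p (1, 0)

/-- The derivative `∂_θ` on the half-plane `t ≥ 0`. -/
def dTh (h : ℝ × ℝ → ℝ) (p : ℝ × ℝ) : ℝ := fderivWithin ℝ h halfStrip p (0, 1)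

theorem halfStrip_mem_nhds {p : ℝ × ℝ} (hp : 0 < p.1) : halfStrip ∈ 𝓝 p := by
  have : {x : ℝ × ℝ | 0 < x.1} ∈ 𝓝 p := (isOpen_lt continuous_const continuous_fst).mem_nhds hp
  exact mem_of_superset this fun x (hx : 0 < x.1) => hx.le

theorem uniqueDiffOn_halfStrip : UniqueDiffOn ℝ halfStrip := by
  apply uniqueDiffOn_convex
  · exact (convex_Ici (0 : ℝ)).is_linear_preimage (f := Prod.fst) ⟨fun _ _ => rfl, fun _ _ => rfl⟩
  · exact ⟨(1, 0), mem_interior_iff_mem_nhds.2 (halfStrip_mem_nhds (by norm_num))⟩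

section
variable {h g : ℝ × ℝ → ℝ} {p : ℝ × ℝ}

theorem contDiffOn_dT (hh : ContDiffOn ℝ ∞ h halfStrip) : ContDiffOn ℝ ∞ (dT h) halfStrip :=
  (hh.fderivWithin uniqueDiffOn_halfStrip (m := ∞) (by simp)).clm_apply contDiffOn_const

theorem contDiffOn_dTh (hh : ContDiffOn ℝ ∞ h halfStrip) : ContDiffOn ℝ ∞ (dTh h) halfStrip :=
  (hh.fderivWithin uniqueDiffOn_halfStrip (m := ∞) (by simp)).clm_apply contDiffOn_const

theorem diffWithin (hh : ContDiffOn ℝ ∞ h halfStrip) (hp : 0 ≤ p.1) :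
    HasFDerivWithinAt h (fderivWithin ℝ h halfStrip p) halfStrip p :=
  ((hh p hp).differentiableWithinAt (by simp)).hasFDerivWithinAt

theorem hasDerivWithinAt_dT (hh : ContDiffOn ℝ ∞ h halfStrip) {t θ : ℝ} (ht : 0 ≤ t) :
    HasDerivWithinAt (fun t => h (t, θ)) (dT h (t, θ)) (Ici 0) t := by
  have h1 : HasDerivWithinAt (fun t : ℝ => (t, θ)) ((1 : ℝ), (0 : ℝ)) (Ici 0) t :=
    ((hasDerivAt_id t).prodMk (hasDerivAt_const t θ)).hasDerivWithinAt
  exact (diffWithin (p := (t, θ)) hh ht).comp_hasDerivWithinAt t h1 fun x hx => hx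

theorem hasDerivAt_dT (hh : ContDiffOn ℝ ∞ h halfStrip) {t θ : ℝ} (ht : 0 < t) :
    HasDerivAt (fun t => h (t, θ)) (dT h (t, θ)) t :=
  (hasDerivWithinAt_dT hh ht.le).hasDerivAt (Ici_mem_nhds ht)

theorem hasDerivAt_dTh (hh : ContDiffOn ℝ ∞ h halfStrip) {t θ : ℝ} (ht : 0 ≤ t) :
    HasDerivAt (fun θ => h (t, θ)) (dTh h (t, θ)) θ := by
  have h1 : HasDerivAt (fun θ : ℝ => (t, θ)) ((0 : ℝ), (1 : ℝ)) θ :=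
    (hasDerivAt_const θ t).prodMk (hasDerivAt_id θ)
  have := (diffWithin (p := (t, θ)) hh ht).comp_hasDerivWithinAt θ h1.hasDerivWithinAt
    (s := univ) (fun x _ => ht)
  exact hasDerivWithinAt_univ.1 this

theorem dT_eq_of_hasDerivAt (hh : ContDiffOn ℝ ∞ h halfStrip) {t θ d : ℝ} (ht : 0 < t)
    (hd : HasDerivAt (fun t => h (t, θ)) d t) : dT h (t, θ) = d :=
  (hasDerivAt_dT hh ht).unique hd

theorem dTh_eq_of_hasDerivAt (hh : ContDiffOn ℝ ∞ h halfStrip) {t θ d : ℝ} (ht : 0 ≤ t)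
    (hd : HasDerivAt (fun θ => h (t, θ)) d θ) : dTh h (t, θ) = d :=
  (hasDerivAt_dTh hh ht).unique hd

theorem continuous_slice (hh : ContinuousOn h halfStrip) {t : ℝ} (ht : 0 ≤ t) :
    Continuous fun θ => h (t, θ) :=
  hh.comp_continuous (by fun_prop) fun _ => ht

theorem continuousOn_integral_slice (hh : ContinuousOn h halfStrip) :
    ContinuousOn (fun t => ∫ θ in (0 : ℝ)..Real.pi, h (t, θ)) (Ici 0) := by
  -- extend the integrand to `t < 0` by its values at `t = 0`
  have hc : Continuous (fun x : ℝ × ℝ => h (max x.1 0, x.2)) :=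
    hh.comp_continuous (by fun_prop) fun x => le_max_right x.1 0
  have := intervalIntegral.continuous_parametric_intervalIntegral_of_continuous' (μ := MeasureTheory.volume)
    (f := fun t θ => h (max t 0, θ)) hc 0 Real.pi
  refine this.continuousOn.congr fun t (ht : 0 ≤ t) => ?_
  simp [max_eq_left ht]

theorem hasDerivAt_integral_slice (hh : ContDiffOn ℝ ∞ h halfStrip) {t : ℝ} (ht : 0 < t) :
    HasDerivAt (fun t => ∫ θ in (0 : ℝ)..Real.pi, h (t, θ))
      (∫ θ in (0 : ℝ)..Real.pi, dT h (t, θ)) t := by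
  have hc := hh.continuousOn
  have hc' := (contDiffOn_dT hh).continuousOn
  obtain ⟨C, hC⟩ : ∃ C, ∀ x ∈ Icc (t / 2) (2 * t) ×ˢ Icc 0 Real.pi, ‖dT h x‖ ≤ C :=
    (isCompact_Icc.prod isCompact_Icc).exists_bound_of_continuousOn
      (hc'.mono fun x hx => show 0 ≤ x.1 by linarith [hx.1.1])
  have hs : Ioo (t / 2) (2 * t) ∈ 𝓝 t := Ioo_mem_nhds (by linarith) (by linarith)
  refine (intervalIntegral.hasDerivAt_integral_of_dominated_loc_of_deriv_le (bound := fun _ => C)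
    (F := fun t θ => h (t, θ)) (F' := fun t θ => dT h (t, θ)) hs ?_ ?_ ?_ ?_ ?_ ?_).2
  · filter_upwards [hs] with x hx
    exact (continuous_slice hc (by linarith [hx.1])).aestronglyMeasurable
  · exact (continuous_slice hc ht.le).intervalIntegrable _ _
  · exact (continuous_slice hc' ht.le).aestronglyMeasurable
  · refine Eventually.of_forall fun θ hθ x hx => hC _ ⟨⟨hx.1.le, hx.2.le⟩, ?_⟩
    rw [uIoc_of_le Real.pi_pos.le] at hθ
    exact ⟨hθ.1.le, hθ.2⟩
  · simp
  · exact Eventually.of_forall fun θ _ x hx => hasDerivAt_dT hh (by linarith [hx.1])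

end

/-- A function that vanishes along an open ray of the half-strip vanishes at its boundary point. -/
theorem eq_zero_of_forall_pos {h : ℝ × ℝ → ℝ} (hh : ContDiffOn ℝ ∞ h halfStrip) {θ : ℝ}
    (h0 : ∀ t > 0, h (t, θ) = 0) : h (0, θ) = 0 := by
  have hcont : ContinuousOn (fun t => h (t, θ)) (Ici 0) := fun t ht =>
    (hasDerivWithinAt_dT hh ht).continuousWithinAt
  have heq : EqOn (fun t => h (t, θ)) (fun _ => 0) (Ioi 0) := fun t ht => h0 t ht
  exact heq.of_subset_closure hcont continuousOn_const Ioi_subset_Ici_self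
    (by rw [closure_Ioi]) (self_mem_Ici : (0 : ℝ) ∈ Ici 0)

/-- A nonnegative function on `[0, ∞)` with nonnegative second derivative, which vanishes at `0`
and is bounded, vanishes. -/
theorem eq_zero_of_convex_of_bounded {E E' E'' : ℝ → ℝ} {M : ℝ} (hc : ContinuousOn E (Ici 0))
    (h1 : ∀ t > 0, HasDerivAt E (E' t) t) (h2 : ∀ t > 0, HasDerivAt E' (E'' t) t)
    (hE'' : ∀ t > 0, 0 ≤ E'' t) (hE : ∀ t, 0 ≤ E t) (h0 : E 0 = 0) (hM : ∀ t > 0, E t ≤ M)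
    {t : ℝ} (ht : 0 ≤ t) : E t = 0 := by
  have hconv : ConvexOn ℝ (Ici 0) E := by
    apply convexOn_of_hasDerivWithinAt2_nonneg (f' := E') (f'' := E'') (convex_Ici 0) hc
    · intro x hx; rw [interior_Ici] at hx ⊢; exact (h1 x hx).hasDerivWithinAt
    · intro x hx; rw [interior_Ici] at hx ⊢; exact (h2 x hx).hasDerivWithinAt
    · intro x hx; rw [interior_Ici] at hx; exact hE'' x hx
  refine le_antisymm ?_ (hE t)
  -- the chord from `0` to a large `T` lies above the graph and has small slope
  have key : ∀ T > t, E t ≤ t / T * M := by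
    intro T hT
    have hT0 : 0 < T := lt_of_le_of_lt ht hT
    have := hconv.2 (show (0 : ℝ) ∈ Ici 0 by simp) (show T ∈ Ici 0 from hT0.le)
      (show (0 : ℝ) ≤ 1 - t / T by
        rw [sub_nonneg, div_le_one hT0]; exact hT.le) (show (0 : ℝ) ≤ t / T by positivity) (by ring)
    simp only [smul_eq_mul, mul_zero, zero_add, h0] at this
    rw [div_mul_cancel₀ _ hT0.ne'] at this
    exact this.trans (mul_le_mul_of_nonneg_left (hM T hT0) (by positivity))
  have lim : Tendsto (fun T : ℝ => t / T * M) atTop (𝓝 (0 * M)) :=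
    (tendsto_const_nhds.div_atTop tendsto_id).mul_const M
  rw [zero_mul] at lim
  exact ge_of_tendsto lim (by filter_upwards [eventually_gt_atTop t] with T hT using key T hT)

/-- A harmonic function on the half-strip that vanishes on `t = 0`, satisfies `u u_θ = 0` on the
sides `θ = 0, π`, and is bounded in `L²(0, π)` uniformly in `t`, vanishes: the integral of `u²`
over `θ` is convex in `t`. -/
theorem harmonic_eq_zero {u : ℝ × ℝ → ℝ} (hu : ContDiffOn ℝ ∞ u halfStrip)
    (harm : ∀ t > 0, ∀ θ ∈ Ioo 0 Real.pi, dT (dT u) (t, θ) + dTh (dTh u) (t, θ) = 0)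
    (side0 : ∀ t > 0, u (t, 0) * dTh u (t, 0) = 0)
    (sidepi : ∀ t > 0, u (t, Real.pi) * dTh u (t, Real.pi) = 0)
    (h0 : ∀ θ ∈ Icc 0 Real.pi, u (0, θ) = 0) {M : ℝ}
    (hM : ∀ t > 0, (∫ θ in (0 : ℝ)..Real.pi, u (t, θ) ^ 2) ≤ M) {t θ : ℝ} (ht : 0 ≤ t)
    (hθ : θ ∈ Icc 0 Real.pi) : u (t, θ) = 0 := by
  have hut := contDiffOn_dT hu
  have huθ := contDiffOn_dTh hu
  have hutt := contDiffOn_dT hut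
  have huθθ := contDiffOn_dTh huθ
  have sm1 : ContDiffOn ℝ ∞ (fun p => u p ^ 2) halfStrip := hu.pow 2
  have d1 : ∀ t > 0, ∀ θ, dT (fun p => u p ^ 2) (t, θ) = 2 * (u (t, θ) * dT u (t, θ)) := by
    intro t ht θ
    apply dT_eq_of_hasDerivAt sm1 ht
    exact ((hasDerivAt_dT hu ht).pow 2).congr_deriv (by push_cast; ring)
  have sm2 : ContDiffOn ℝ ∞ (fun p => 2 * (u p * dT u p)) halfStrip :=
    contDiffOn_const.mul (hu.mul hut)
  have d2 : ∀ t > 0, ∀ θ, dT (fun p => 2 * (u p * dT u p)) (t, θ) =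
      2 * (dT u (t, θ) * dT u (t, θ) + u (t, θ) * dT (dT u) (t, θ)) := by
    intro t ht θ
    apply dT_eq_of_hasDerivAt sm2 ht
    exact ((hasDerivAt_dT hu ht).mul (hasDerivAt_dT hut ht)).const_mul 2
  have E0 : ∀ t ≥ 0, (∫ θ in (0 : ℝ)..Real.pi, u (t, θ) ^ 2) = 0 := by
    intro t ht
    refine eq_zero_of_convex_of_bounded (E := fun t => ∫ θ in (0 : ℝ)..Real.pi, u (t, θ) ^ 2)
      (E' := fun t => ∫ θ in (0 : ℝ)..Real.pi, 2 * (u (t, θ) * dT u (t, θ)))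
      (E'' := fun t => ∫ θ in (0 : ℝ)..Real.pi,
        2 * (dT u (t, θ) * dT u (t, θ) + u (t, θ) * dT (dT u) (t, θ)))
      (continuousOn_integral_slice sm1.continuousOn) ?_ ?_ ?_ ?_ ?_ hM ht
    · intro t ht
      simpa only [d1 t ht] using hasDerivAt_integral_slice sm1 ht
    · intro t ht
      simpa only [d2 t ht] using hasDerivAt_integral_slice sm2 ht
    · intro t ht
      have c1 := continuous_slice hut.continuousOn ht.le
      have c2 := continuous_slice huθ.continuousOn ht.le
      have c3 := continuous_slice huθθ.continuousOn ht.le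
      have c4 := continuous_slice hu.continuousOn ht.le
      have c5 := continuous_slice hutt.continuousOn ht.le
      -- integrate `∂_θ (u u_θ)` over `[0, π]`
      have ibp : ∫ θ in (0 : ℝ)..Real.pi,
          (dTh u (t, θ) * dTh u (t, θ) + u (t, θ) * dTh (dTh u) (t, θ)) = 0 := by
        rw [intervalIntegral.integral_eq_sub_of_hasDerivAt
          (f := fun θ => u (t, θ) * dTh u (t, θ))]
        · rw [side0 t ht, sidepi t ht, sub_zero]
        · intro θ _
          exact (hasDerivAt_dTh hu ht.le).mul (hasDerivAt_dTh huθ ht.le)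
        · exact ((c2.mul c2).add (c4.mul c3)).intervalIntegrable _ _
      have : ∫ θ in (0 : ℝ)..Real.pi,
          2 * (dT u (t, θ) * dT u (t, θ) + u (t, θ) * dT (dT u) (t, θ)) =
          ∫ θ in (0 : ℝ)..Real.pi,
          2 * (dT u (t, θ) * dT u (t, θ) + dTh u (t, θ) * dTh u (t, θ)) := by
        have i1 : IntervalIntegrable (fun θ => 2 * (dT u (t, θ) * dT u (t, θ)
            + u (t, θ) * dT (dT u) (t, θ))) MeasureTheory.volume 0 Real.pi :=
          (continuous_const.mul ((c1.mul c1).add (c4.mul c5))).intervalIntegrable _ _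
        have i2 : IntervalIntegrable (fun θ => 2 * (dT u (t, θ) * dT u (t, θ)
            + dTh u (t, θ) * dTh u (t, θ))) MeasureTheory.volume 0 Real.pi :=
          (continuous_const.mul ((c1.mul c1).add (c2.mul c2))).intervalIntegrable _ _
        have ibp' := congrArg (fun x => (-2 : ℝ) * x) ibp
        simp only [mul_zero] at ibp'
        rw [← intervalIntegral.integral_const_mul] at ibp'
        rw [← sub_eq_zero, ← intervalIntegral.integral_sub i1 i2]
        refine Eq.trans ?_ ibp'
        apply intervalIntegral.integral_congr_ae
        have : ∀ᵐ x : ℝ, x ≠ Real.pi := by simp [MeasureTheory.ae_iff]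
        filter_upwards [this] with θ hne hθ
        rw [uIoc_of_le Real.pi_pos.le] at hθ
        have := harm t ht θ ⟨hθ.1, lt_of_le_of_ne hθ.2 hne⟩
        linear_combination 2 * u (t, θ) * this
      change 0 ≤ ∫ θ in (0 : ℝ)..Real.pi, _
      rw [this]
      apply intervalIntegral.integral_nonneg Real.pi_pos.le
      intro θ _
      have := mul_self_nonneg (dT u (t, θ))
      have := mul_self_nonneg (dTh u (t, θ))
      positivity
    · intro t
      exact intervalIntegral.integral_nonneg Real.pi_pos.le fun θ _ => sq_nonneg _
    · apply intervalIntegral.integral_zero_ae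
      refine Eventually.of_forall fun θ hθ => ?_
      rw [uIoc_of_le Real.pi_pos.le] at hθ
      simp [h0 θ ⟨hθ.1.le, hθ.2⟩]
  by_contra hne
  have := intervalIntegral.integral_pos (f := fun θ => u (t, θ) ^ 2) Real.pi_pos
    ((continuous_slice hu.continuousOn ht).pow 2).continuousOn (fun _ _ => sq_nonneg _)
    ⟨θ, hθ, by positivity⟩
  linarith [E0 t ht]

/-! ### The cylindrical chart and pseudo-spherical coordinates -/

theorem contDiff_cyl : ContDiff ℝ ∞ cyl := by
  refine contDiff_piLp' 2 fun i => ?_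
  fin_cases i <;> simp [cyl] <;> fun_prop

theorem norm_cyl (q : Fin 3 → ℝ) : ‖cyl q‖ = cylRadius q := by
  rw [EuclideanSpace.norm_eq, cylRadius]
  congr 1
  simp [Fin.sum_univ_three, cyl]
  nlinarith [Real.sin_sq_add_cos_sq (q 2)]

/-- The point of the cylindrical chart, in the half-plane `φ = 0`, with spherical radius
`r = R e^t` and polar angle `θ`. -/
def sphPt (R : ℝ) (p : ℝ × ℝ) : Fin 3 → ℝ :=
  ![R * Real.exp p.1 * Real.sin p.2, R * Real.exp p.1 * Real.cos p.2, 0]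

/-- A function on the exterior region, in the coordinates `t = log (r / R)` and `θ` of the
half-plane `φ = 0`. -/
def strip (R : ℝ) (f : E3 → ℝ) (p : ℝ × ℝ) : ℝ := f (cyl (sphPt R p))

theorem contDiff_sphPt (R : ℝ) : ContDiff ℝ ∞ (sphPt R) := by
  rw [contDiff_pi]
  intro i
  fin_cases i <;> simp [sphPt] <;> fun_prop

theorem cylRadius_sphPt {R : ℝ} (hR : 0 < R) (p : ℝ × ℝ) :
    cylRadius (sphPt R p) = R * Real.exp p.1 := by
  rw [cylRadius]
  have : sphPt R p 0 ^ 2 + sphPt R p 1 ^ 2 = (R * Real.exp p.1) ^ 2 := by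
    simp only [sphPt, Matrix.cons_val_zero, Matrix.cons_val_one]
    linear_combination (R * Real.exp p.1) ^ 2 * Real.sin_sq_add_cos_sq p.2
  rw [this, Real.sqrt_sq (by positivity)]

theorem cyl_sphPt_mem {R : ℝ} (hR : 0 < R) {p : ℝ × ℝ} (hp : 0 ≤ p.1) :
    cyl (sphPt R p) ∈ exterior R := by
  have := Real.one_le_exp hp
  change R ≤ ‖cyl (sphPt R p)‖
  rw [norm_cyl, cylRadius_sphPt hR]; nlinarith

theorem cylRadius_sphPt_gt {R : ℝ} (hR : 0 < R) {p : ℝ × ℝ} (hp : 0 < p.1) :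
    R < cylRadius (sphPt R p) := by
  rw [cylRadius_sphPt hR]
  have := Real.one_lt_exp_iff.2 hp
  nlinarith

theorem contDiffOn_strip {F : Type*} [NormedAddCommGroup F] [NormedSpace ℝ F] {R : ℝ} (hR : 0 < R)
    {f : E3 → F} (hf : ContDiffOn ℝ ∞ f (exterior R)) :
    ContDiffOn ℝ ∞ (fun p => f (cyl (sphPt R p))) halfStrip :=
  hf.comp (contDiff_cyl.comp (contDiff_sphPt R)).contDiffOn fun _ hp => cyl_sphPt_mem hR hp

/-- The open part `r > R` of the chart. -/
def openChart (R : ℝ) : Set (Fin 3 → ℝ) := {q | R < cylRadius q}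

theorem continuous_cylRadius : Continuous cylRadius := by unfold cylRadius; fun_prop

theorem isOpen_openChart (R : ℝ) : IsOpen (openChart R) :=
  isOpen_lt continuous_const continuous_cylRadius

theorem contDiffOn_comp_cyl {R : ℝ} {f : E3 → ℝ} (hf : ContDiffOn ℝ ∞ f (exterior R)) :
    ContDiffOn ℝ ∞ (fun q => f (cyl q)) {q | R ≤ cylRadius q} :=
  hf.comp contDiff_cyl.contDiffOn fun q hq => by
    change R ≤ ‖cyl q‖; rw [norm_cyl]; exact hq

theorem rot_cyl (s : ℝ) (q : Fin 3 → ℝ) : rot s (cyl q) = cyl (q + s • Pi.single 2 1) := by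
  ext i
  fin_cases i <;> simp [rot, cyl, Real.cos_add, Real.sin_add] <;> ring

theorem cylRadius_add_single (s : ℝ) (q : Fin 3 → ℝ) :
    cylRadius (q + s • Pi.single 2 1) = cylRadius q := by
  simp [cylRadius]

theorem SmoothAxisymmetric.comp_cyl_add {R : ℝ} {f : E3 → ℝ} (hf : SmoothAxisymmetric R f)
    {q : Fin 3 → ℝ} (hq : R ≤ cylRadius q) (s : ℝ) :
    f (cyl (q + s • Pi.single 2 1)) = f (cyl q) := by
  rw [← rot_cyl]; exact hf.axisymmetric s _ (by change R ≤ ‖cyl q‖; rwa [norm_cyl])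

theorem fderivWithin_eq_zero_of_const {S : Set (Fin 3 → ℝ)} {h : (Fin 3 → ℝ) → ℝ}
    {q v : Fin 3 → ℝ} (hS : ∀ s : ℝ, q + s • v ∈ S) (hc : ∀ s : ℝ, h (q + s • v) = h q) :
    fderivWithin ℝ h S q v = 0 := by
  by_cases hd : DifferentiableWithinAt ℝ h S q
  · have h1 : HasDerivAt (fun s : ℝ => q + s • v) v 0 := by
      simpa using ((hasDerivAt_id (0 : ℝ)).smul_const v).const_add q
    have h2 := HasFDerivWithinAt.comp_hasDerivWithinAt_of_eq (s := univ) (0 : ℝ)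
      hd.hasFDerivWithinAt h1.hasDerivWithinAt (fun s _ => hS s) (by simp)
    have h3 : HasDerivWithinAt (h ∘ fun s : ℝ => q + s • v) 0 univ 0 := by
      have : (h ∘ fun s : ℝ => q + s • v) = fun _ => h q := funext hc
      rw [this]; exact hasDerivWithinAt_const _ _ _
    exact (hasDerivWithinAt_univ.1 h2).unique (hasDerivWithinAt_univ.1 h3)
  -- the derivative has the value `0` where `h` is not differentiable
  · rw [fderivWithin_zero_of_not_differentiableWithinAt hd]; simp

theorem pd_two_eq_zero {R : ℝ} {f : E3 → ℝ} (hf : SmoothAxisymmetric R f) {q : Fin 3 → ℝ}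
    (hq : R ≤ cylRadius q) : pd 2 (fun q => f (cyl q)) q = 0 := by
  rw [pd, ← fderivWithin_univ]
  exact fderivWithin_eq_zero_of_const (fun _ => mem_univ _) fun s => hf.comp_cyl_add hq s

theorem fderiv_apply_eq_pd (g : (Fin 3 → ℝ) → ℝ) (q v : Fin 3 → ℝ) :
    fderiv ℝ g q v = v 0 * pd 0 g q + v 1 * pd 1 g q + v 2 * pd 2 g q := by
  have : v = v 0 • Pi.single 0 1 + v 1 • Pi.single 1 1 + v 2 • Pi.single 2 1 := by
    ext i; fin_cases i <;> simp
  conv_lhs => rw [this]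
  simp only [map_add, map_smul, smul_eq_mul, pd]

section
variable {R : ℝ} {g : (Fin 3 → ℝ) → ℝ}

theorem hasDerivAt_sphPt_t (t θ : ℝ) :
    HasDerivAt (fun t => sphPt R (t, θ)) ![sphPt R (t, θ) 0, sphPt R (t, θ) 1, 0] t := by
  rw [hasDerivAt_pi]
  intro i
  fin_cases i
  · simpa [sphPt] using ((Real.hasDerivAt_exp t).const_mul R).mul_const (Real.sin θ)
  · simpa [sphPt] using ((Real.hasDerivAt_exp t).const_mul R).mul_const (Real.cos θ)
  · exact hasDerivAt_const _ _

theorem hasDerivAt_sphPt_θ (t θ : ℝ) :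
    HasDerivAt (fun θ => sphPt R (t, θ)) ![sphPt R (t, θ) 1, -sphPt R (t, θ) 0, 0] θ := by
  rw [hasDerivAt_pi]
  intro i
  fin_cases i
  · simpa [sphPt] using (Real.hasDerivAt_sin θ).const_mul (R * Real.exp t)
  · simpa [sphPt] using (Real.hasDerivAt_cos θ).const_mul (R * Real.exp t)
  · exact hasDerivAt_const _ _

theorem hasDerivAt_comp_sphPt_t {t θ : ℝ} (hg : DifferentiableAt ℝ g (sphPt R (t, θ))) :
    HasDerivAt (fun t => g (sphPt R (t, θ)))
      (sphPt R (t, θ) 0 * pd 0 g (sphPt R (t, θ)) + sphPt R (t, θ) 1 * pd 1 g (sphPt R (t, θ)))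
      t := by
  have := hg.hasFDerivAt.comp_hasDerivAt t (hasDerivAt_sphPt_t t θ)
  exact this.congr_deriv (by rw [fderiv_apply_eq_pd]; simp)

theorem hasDerivAt_comp_sphPt_θ {t θ : ℝ} (hg : DifferentiableAt ℝ g (sphPt R (t, θ))) :
    HasDerivAt (fun θ => g (sphPt R (t, θ)))
      (sphPt R (t, θ) 1 * pd 0 g (sphPt R (t, θ)) - sphPt R (t, θ) 0 * pd 1 g (sphPt R (t, θ)))
      θ := by
  have := hg.hasFDerivAt.comp_hasDerivAt θ (hasDerivAt_sphPt_θ t θ)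
  exact this.congr_deriv (by rw [fderiv_apply_eq_pd]; simp [sub_eq_add_neg])

variable (hR : 0 < R) (hs : ContDiffOn ℝ ∞ (fun p => g (sphPt R p)) halfStrip)
  (hg : ContDiffOn ℝ ∞ g (openChart R)) {t θ : ℝ} (ht : 0 < t)
include hR hs hg ht

theorem dT_comp_sphPt : dT (fun p => g (sphPt R p)) (t, θ) =
    sphPt R (t, θ) 0 * pd 0 g (sphPt R (t, θ)) + sphPt R (t, θ) 1 * pd 1 g (sphPt R (t, θ)) :=
  dT_eq_of_hasDerivAt hs ht (hasDerivAt_comp_sphPt_t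
    ((hg.contDiffAt ((isOpen_openChart R).mem_nhds (cylRadius_sphPt_gt hR (p := (t, θ)) ht))).differentiableAt
      (by simp)))

theorem dTh_comp_sphPt : dTh (fun p => g (sphPt R p)) (t, θ) =
    sphPt R (t, θ) 1 * pd 0 g (sphPt R (t, θ)) - sphPt R (t, θ) 0 * pd 1 g (sphPt R (t, θ)) :=
  dTh_eq_of_hasDerivAt hs ht.le (hasDerivAt_comp_sphPt_θ
    ((hg.contDiffAt ((isOpen_openChart R).mem_nhds (cylRadius_sphPt_gt hR (p := (t, θ)) ht))).differentiableAt
      (by simp)))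

/-- The coordinates `(t, θ)` are conformal to `(ρ, z)`. -/
theorem laplacian_comp_sphPt :
    dT (dT (fun p => g (sphPt R p))) (t, θ) + dTh (dTh (fun p => g (sphPt R p))) (t, θ) =
    (R * Real.exp t) ^ 2 *
      (pd 0 (pd 0 g) (sphPt R (t, θ)) + pd 1 (pd 1 g) (sphPt R (t, θ))) := by
  have dif : ∀ {f : (Fin 3 → ℝ) → ℝ}, ContDiffOn ℝ ∞ f (openChart R) →
      DifferentiableAt ℝ f (sphPt R (t, θ)) := fun hf =>
    (hf.contDiffAt ((isOpen_openChart R).mem_nhds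
      (cylRadius_sphPt_gt hR (p := (t, θ)) ht))).differentiableAt (by simp)
  have h0 := dif (contDiffOn_pd (isOpen_openChart R) hg 0)
  have h1 := dif (contDiffOn_pd (isOpen_openChart R) hg 1)
  have ex : HasDerivAt (fun t => sphPt R (t, θ) 0) (sphPt R (t, θ) 0) t := by
    simpa using hasDerivAt_pi.1 (hasDerivAt_sphPt_t (R := R) t θ) 0
  have ez : HasDerivAt (fun t => sphPt R (t, θ) 1) (sphPt R (t, θ) 1) t := by
    simpa using hasDerivAt_pi.1 (hasDerivAt_sphPt_t (R := R) t θ) 1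
  have ex' : HasDerivAt (fun θ => sphPt R (t, θ) 0) (sphPt R (t, θ) 1) θ := by
    simpa using hasDerivAt_pi.1 (hasDerivAt_sphPt_θ (R := R) t θ) 0
  have ez' : HasDerivAt (fun θ => sphPt R (t, θ) 1) (-sphPt R (t, θ) 0) θ := by
    simpa using hasDerivAt_pi.1 (hasDerivAt_sphPt_θ (R := R) t θ) 1
  have e1 := (ex.mul (hasDerivAt_comp_sphPt_t h0)).add (ez.mul (hasDerivAt_comp_sphPt_t h1))
  have e2 := (ez'.mul (hasDerivAt_comp_sphPt_θ h0)).sub (ex'.mul (hasDerivAt_comp_sphPt_θ h1))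
  have f1 := dT_eq_of_hasDerivAt (contDiffOn_dT hs) ht (e1.congr_of_eventuallyEq (by
    filter_upwards [eventually_gt_nhds ht] with s hs'
    exact dT_comp_sphPt hR hs hg hs'))
  have f2 := dTh_eq_of_hasDerivAt (contDiffOn_dTh hs) ht.le (e2.congr_of_eventuallyEq (by
    refine Eventually.of_forall fun s => ?_
    exact dTh_comp_sphPt hR hs hg ht))
  have c : pd 1 (pd 0 g) (sphPt R (t, θ)) = pd 0 (pd 1 g) (sphPt R (t, θ)) :=
    pd_comm (hg.contDiffAt ((isOpen_openChart R).mem_nhds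
      (cylRadius_sphPt_gt hR (p := (t, θ)) ht))) _ _
  have hr : (R * Real.exp t) ^ 2 = sphPt R (t, θ) 0 ^ 2 + sphPt R (t, θ) 1 ^ 2 := by
    simp only [sphPt, Matrix.cons_val_zero, Matrix.cons_val_one]
    linear_combination -(R * Real.exp t) ^ 2 * Real.sin_sq_add_cos_sq θ
  rw [f1, f2, c, hr]
  ring

end

/-! ### The metric in the cylindrical chart -/

theorem rho_cyl {q : Fin 3 → ℝ} (hq : 0 < q 0) : rho (cyl q) = q 0 := by
  rw [rho]
  have : cyl q 0 ^ 2 + cyl q 1 ^ 2 = q 0 ^ 2 := by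
    simp only [cyl, PiLp.toLp_apply, Matrix.cons_val_zero, Matrix.cons_val_one]
    linear_combination q 0 ^ 2 * Real.sin_sq_add_cos_sq (q 2)
  rw [this, Real.sqrt_sq hq.le]

/-- The metric is circle invariant in the chart, with `e^s = e^(α - U)` and `e^n = ρ e^(-U)`. -/
theorem cylComponents_metric (U α B A : E3 → ℝ) {q : Fin 3 → ℝ} (hq : 0 < q 0) :
    cylComponents (metric U α B A) q = circleMatrix (α (cyl q) - U (cyl q))
      (Real.log (q 0) - U (cyl q)) (q 0 * B (cyl q)) (A (cyl q)) := by
  have hr := rho_cyl hq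
  have h1 := Real.sin_sq_add_cos_sq (q 2)
  have eN : Real.exp (2 * (Real.log (q 0) - U (cyl q))) =
      q 0 ^ 2 * Real.exp (-2 * U (cyl q)) := by
    rw [show 2 * (Real.log (q 0) - U (cyl q)) = Real.log (q 0) + Real.log (q 0)
      + -2 * U (cyl q) by ring, Real.exp_add, Real.exp_add, Real.exp_log hq]; ring
  have eE : Real.exp (2 * (α (cyl q) - U (cyl q))) =
      Real.exp (-2 * U (cyl q) + 2 * α (cyl q)) := by ring_nf
  have dr : ∀ i, dRho (cyl q) (cylFrame q i) = ![1, 0, 0] i := by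
    intro i
    rw [dRho, hr, div_eq_iff hq.ne']
    fin_cases i <;> simp [cylFrame, cyl] <;> first | ring1 | linear_combination q 0 * h1
  have dp : ∀ i, dPhi (cyl q) (cylFrame q i) = ![0, 0, 1] i := by
    intro i
    rw [dPhi, hr, div_eq_iff (pow_ne_zero 2 hq.ne')]
    fin_cases i <;> simp [cylFrame, cyl] <;> first | ring1 | linear_combination q 0 ^ 2 * h1
  have dz : ∀ i, cylFrame q i 2 = ![0, 1, 0] i := by
    intro i; fin_cases i <;> simp [cylFrame]
  rw [circleMatrix, eN, eE]
  ext i j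
  simp only [cylComponents, Matrix.of_apply, metric, connForm, dr, dp, dz, hr]
  fin_cases i <;> fin_cases j <;> simp <;> first | ring1 | exact Or.inl (by ring)

section
variable {m₁ : ℝ} {k : ℕ} {U α B A : E3 → ℝ}

theorem IsAxisymmetricData.circleData (h : IsAxisymmetricData m₁ k U α B A) :
    CircleData {q | 0 < q 0 ∧ m₁ / 2 < cylRadius q} (cylComponents (metric U α B A))
      (fun q => α (cyl q) - U (cyl q)) (fun q => Real.log (q 0) - U (cyl q))
      (fun q => q 0 * B (cyl q)) (fun q => A (cyl q)) where
  isOpen := (isOpen_lt continuous_const (continuous_apply 0)).inter (isOpen_openChart _)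
  s_smooth := ((contDiffOn_comp_cyl h.smooth_α.smooth).sub
    (contDiffOn_comp_cyl h.smooth_U.smooth)).mono fun q hq => hq.2.le
  n_smooth := by
    refine ContDiffOn.sub ?_ ((contDiffOn_comp_cyl h.smooth_U.smooth).mono fun q hq => hq.2.le)
    exact (contDiff_apply ℝ ℝ (0 : Fin 3)).contDiffOn.log fun q hq => hq.1.ne'
  a_smooth := (contDiff_apply ℝ ℝ (0 : Fin 3)).contDiffOn.mul
    ((contDiffOn_comp_cyl h.smooth_B.smooth).mono fun q hq => hq.2.le)
  b_smooth := (contDiffOn_comp_cyl h.smooth_A.smooth).mono fun q hq => hq.2.le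
  s_phi q hq := by
    rw [pd, ← fderivWithin_univ]
    refine fderivWithin_eq_zero_of_const (fun _ => mem_univ _) fun s => ?_
    rw [h.smooth_U.comp_cyl_add hq.2.le, h.smooth_α.comp_cyl_add hq.2.le]
  n_phi q hq := by
    rw [pd, ← fderivWithin_univ]
    refine fderivWithin_eq_zero_of_const (fun _ => mem_univ _) fun s => ?_
    rw [h.smooth_U.comp_cyl_add hq.2.le]; simp
  a_phi q hq := by
    rw [pd, ← fderivWithin_univ]
    refine fderivWithin_eq_zero_of_const (fun _ => mem_univ _) fun s => ?_
    rw [h.smooth_B.comp_cyl_add hq.2.le]; simp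
  b_phi q hq := pd_two_eq_zero h.smooth_A hq.2.le
  eq p hp := cylComponents_metric U α B A hp.1

/-- The rotation `∂_ρ (g_{φz}/g_{φφ}) - ∂_z (g_{φρ}/g_{φφ})` of the connection form. -/
def twist (B A : E3 → ℝ) (q : Fin 3 → ℝ) : ℝ :=
  pd 0 (fun q => A (cyl q)) q - pd 1 (fun q => q 0 * B (cyl q)) q

/-- The scalar curvature equation in the coordinates `t = log (r / R)`, `θ`. -/
theorem IsAxisymmetricData.strip_equation (h : IsAxisymmetricData m₁ k U α B A) (hm : 0 < m₁)
    {t θ : ℝ} (ht : 0 < t) (hθ : θ ∈ Ioo 0 Real.pi) {u a : ℝ × ℝ → ℝ}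
    (hu : u = strip (m₁ / 2) U) (ha : a = strip (m₁ / 2) α) {q : Fin 3 → ℝ}
    (hq : q = sphPt (m₁ / 2) (t, θ)) :
    Real.sin θ * (dT (dT u) (t, θ) + dTh (dTh u) (t, θ) + dT u (t, θ))
      + Real.cos θ * dTh u (t, θ)
      - 1 / 2 * Real.sin θ * (dT (dT a) (t, θ) + dTh (dTh a) (t, θ))
      - 1 / 2 * Real.sin θ * (dT u (t, θ) ^ 2 + dTh u (t, θ) ^ 2) =
    Real.sin θ * (1 / 4 * (m₁ / 2 * Real.exp t) ^ 2 *
      (Real.exp (2 * (α (cyl q) - U (cyl q))) *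
          scalarCurvature (cylComponents (metric U α B A)) q
        + 1 / 2 * Real.exp (2 * (Real.log (q 0) - U (cyl q)) - 2 * (α (cyl q) - U (cyl q)))
          * twist B A q ^ 2)) := by
  have hR : 0 < m₁ / 2 := by positivity
  have hsin : 0 < Real.sin θ := Real.sin_pos_of_mem_Ioo hθ
  have q0 : q 0 = m₁ / 2 * Real.exp t * Real.sin θ := by simp [hq, sphPt]
  have q1 : q 1 = m₁ / 2 * Real.exp t * Real.cos θ := by simp [hq, sphPt]
  have hq0 : 0 < q 0 := by rw [q0]; positivity
  have hqr : m₁ / 2 < cylRadius q := by rw [hq]; exact cylRadius_sphPt_gt hR (p := (t, θ)) ht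
  have ev : {q | 0 < q 0 ∧ m₁ / 2 < cylRadius q} ∈ 𝓝 q := h.circleData.isOpen.mem_nhds ⟨hq0, hqr⟩
  have ev' : openChart (m₁ / 2) ∈ 𝓝 q := (isOpen_openChart _).mem_nhds hqr
  set Uc : (Fin 3 → ℝ) → ℝ := fun q => U (cyl q) with hUc
  set αc : (Fin 3 → ℝ) → ℝ := fun q => α (cyl q) with hαc
  have gU : ContDiffOn ℝ ∞ Uc (openChart (m₁ / 2)) :=
    (contDiffOn_comp_cyl h.smooth_U.smooth).mono fun q (hq : m₁ / 2 < cylRadius q) => hq.le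
  have gα : ContDiffOn ℝ ∞ αc (openChart (m₁ / 2)) :=
    (contDiffOn_comp_cyl h.smooth_α.smooth).mono fun q (hq : m₁ / 2 < cylRadius q) => hq.le
  have dif : ∀ {f : (Fin 3 → ℝ) → ℝ} {p}, ContDiffOn ℝ ∞ f (openChart (m₁ / 2)) →
      p ∈ openChart (m₁ / 2) → DifferentiableAt ℝ f p := fun hf hp =>
    (hf.contDiffAt ((isOpen_openChart _).mem_nhds hp)).differentiableAt (by simp)
  have su : ContDiffOn ℝ ∞ (fun p => Uc (sphPt (m₁ / 2) p)) halfStrip :=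
    contDiffOn_strip hR h.smooth_U.smooth
  have sα : ContDiffOn ℝ ∞ (fun p => αc (sphPt (m₁ / 2) p)) halfStrip :=
    contDiffOn_strip hR h.smooth_α.smooth
  have sc := h.circleData.scalarCurvature_eq (q := q) ⟨hq0, hqr⟩
  -- the first and second derivatives of `s = α - U` and `n = log ρ - U`
  have ds : ∀ i, ∀ p ∈ openChart (m₁ / 2), pd i (fun q => αc q - Uc q) p = pd i αc p - pd i Uc p :=
    fun i p hp => pd_sub (dif gα hp) (dif gU hp)
  have dds : ∀ i, pd i (pd i (fun q => αc q - Uc q)) q = pd i (pd i αc) q - pd i (pd i Uc) q := by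
    intro i
    rw [pd_congr (g := fun p => pd i αc p - pd i Uc p) (by
      filter_upwards [ev'] with p hp using ds i p hp)]
    exact pd_sub (dif (contDiffOn_pd (isOpen_openChart _) gα i) hqr)
      (dif (contDiffOn_pd (isOpen_openChart _) gU i) hqr)
  have dlog : ∀ i, ∀ p : Fin 3 → ℝ, 0 < p 0 →
      pd i (fun q : Fin 3 → ℝ => Real.log (q 0)) p = if i = 0 then (p 0)⁻¹ else 0 := by
    intro i p hp
    have : HasFDerivAt (fun q : Fin 3 → ℝ => Real.log (q 0))
        ((p 0)⁻¹ • ContinuousLinearMap.proj (R := ℝ) (φ := fun _ => ℝ) (0 : Fin 3)) p :=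
      HasFDerivAt.log (ContinuousLinearMap.proj (R := ℝ) (φ := fun _ => ℝ) (0 : Fin 3)).hasFDerivAt
        hp.ne'
    rw [pd, this.fderiv]
    fin_cases i <;> simp
  have dn : ∀ i, ∀ p : Fin 3 → ℝ, 0 < p 0 ∧ m₁ / 2 < cylRadius p →
      pd i (fun q => Real.log (q 0) - Uc q) p = (if i = 0 then (p 0)⁻¹ else 0) - pd i Uc p := by
    intro i p hp
    have : DifferentiableAt ℝ (fun q : Fin 3 → ℝ => Real.log (q 0)) p :=
      DifferentiableAt.log (by fun_prop) hp.1.ne'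
    rw [pd_sub this (dif gU hp.2), dlog i p hp.1]
  have dinv : pd 0 (fun p : Fin 3 → ℝ => (p 0)⁻¹) q = -(q 0 ^ 2)⁻¹ := by
    have := (ContinuousLinearMap.proj (R := ℝ) (φ := fun _ => ℝ) (0 : Fin 3)).hasFDerivAt (x := q)
    have h2 : HasFDerivAt (fun p : Fin 3 → ℝ => (p 0)⁻¹) _ q :=
      (hasDerivAt_inv hq0.ne').comp_hasFDerivAt q this
    rw [pd, h2.fderiv]
    simp
  have ddn0 : pd 0 (pd 0 (fun q => Real.log (q 0) - Uc q)) q =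
      -(q 0 ^ 2)⁻¹ - pd 0 (pd 0 Uc) q := by
    rw [pd_congr (g := fun p => (p 0)⁻¹ - pd 0 Uc p) (by
      filter_upwards [ev] with p hp
      simpa using dn 0 p hp), pd_sub _ (dif (contDiffOn_pd (isOpen_openChart _) gU 0) hqr), dinv]
    exact DifferentiableAt.inv (by fun_prop) hq0.ne'
  have ddn1 : pd 1 (pd 1 (fun q => Real.log (q 0) - Uc q)) q = - pd 1 (pd 1 Uc) q := by
    rw [pd_congr (g := fun p => - pd 1 Uc p) (by
      filter_upwards [ev] with p hp
      simpa using dn 1 p hp), pd_neg]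
  rw [dds 0, dds 1, ddn0, ddn1, dn 0 q ⟨hq0, hqr⟩, dn 1 q ⟨hq0, hqr⟩] at sc
  have lu := laplacian_comp_sphPt hR su gU (θ := θ) ht
  have la := laplacian_comp_sphPt hR sα gα (θ := θ) ht
  have tu := dT_comp_sphPt hR su gU (θ := θ) ht
  have hu' := dTh_comp_sphPt hR su gU (θ := θ) ht
  rw [← hq] at lu la tu hu'
  have eu : u = fun p => Uc (sphPt (m₁ / 2) p) := hu
  have ea : a = fun p => αc (sphPt (m₁ / 2) p) := ha
  rw [← eu] at lu tu hu'
  rw [← ea] at la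
  rw [lu, la, tu, hu', sc, twist, q0, q1]
  have h1 := Real.sin_sq_add_cos_sq θ
  set r := m₁ / 2 * Real.exp t with hr
  have hr0 : 0 < r := by positivity
  have cc : Real.cos θ ^ 2 = 1 - Real.sin θ ^ 2 := by linarith
  simp only [if_true, one_ne_zero, if_false]
  field_simp
  ring_nf
  simp only [cc]
  ring

end

/-! ### The minimal boundary -/

/-- At each point, the chart domain contains a convex set with nonempty interior: the part of it
beyond the tangent plane of the sphere through the point. -/
theorem uniqueDiffWithinAt_cylDomain {R : ℝ} {q : Fin 3 → ℝ} (hq : q ∈ cylDomain R) :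
    UniqueDiffWithinAt ℝ (cylDomain R) q := by
  obtain ⟨hq0, hqr⟩ := hq
  set K : Set (Fin 3 → ℝ) := {p | 0 < p 0 ∧ q 0 ^ 2 + q 1 ^ 2 ≤ p 0 * q 0 + p 1 * q 1}
  have hK : K ⊆ cylDomain R := by
    intro p ⟨hp0, hp⟩
    refine ⟨hp0, hqr.trans ?_⟩
    apply Real.sqrt_le_sqrt
    nlinarith [sq_nonneg (p 0 - q 0), sq_nonneg (p 1 - q 1)]
  have hconv : Convex ℝ K := by
    refine Convex.inter ?_ ?_
    · exact (convex_Ioi (0 : ℝ)).is_linear_preimage (f := fun p : Fin 3 → ℝ => p 0)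
        ⟨fun _ _ => rfl, fun _ _ => rfl⟩
    · exact (convex_Ici (q 0 ^ 2 + q 1 ^ 2)).is_linear_preimage
        (f := fun p : Fin 3 → ℝ => p 0 * q 0 + p 1 * q 1)
        ⟨fun x y => by simp; ring, fun c x => by simp; ring⟩
  have hint : (interior K).Nonempty := by
    refine ⟨![2 * q 0, 2 * q 1, 0], mem_interior.2
      ⟨{p | 0 < p 0 ∧ q 0 ^ 2 + q 1 ^ 2 < p 0 * q 0 + p 1 * q 1}, fun p hp => ⟨hp.1, hp.2.le⟩, ?_, ?_⟩⟩
    · exact (isOpen_lt continuous_const (continuous_apply 0)).inter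
        (isOpen_lt continuous_const
          (show Continuous fun p : Fin 3 → ℝ => p 0 * q 0 + p 1 * q 1 by fun_prop))
    · constructor
      · simpa using hq0
      · simp; nlinarith [sq_nonneg (q 1)]
  have := uniqueDiffWithinAt_convex hconv hint (x := q) (subset_closure ⟨hq0, by nlinarith⟩)
  exact this.mono hK

section
variable {m₁ : ℝ} {k : ℕ} {U α B A : E3 → ℝ}

theorem hasFDerivAt_cylRadius {q : Fin 3 → ℝ} (hq : 0 < q 0) :
    HasFDerivAt cylRadius ((q 0 / cylRadius q) • ContinuousLinearMap.proj (R := ℝ) (φ := fun _ => ℝ) (0 : Fin 3)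
      + (q 1 / cylRadius q) • ContinuousLinearMap.proj (R := ℝ) (φ := fun _ => ℝ) (1 : Fin 3)) q := by
  have p0 := (ContinuousLinearMap.proj (R := ℝ) (φ := fun _ => ℝ) (0 : Fin 3)).hasFDerivAt (x := q)
  have p1 := (ContinuousLinearMap.proj (R := ℝ) (φ := fun _ => ℝ) (1 : Fin 3)).hasFDerivAt (x := q)
  have hpos : 0 < q 0 ^ 2 + q 1 ^ 2 := by positivity
  have := HasFDerivAt.sqrt ((p0.pow 2).add (p1.pow 2)) hpos.ne'
  refine this.congr_fderiv ?_
  ext v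
  have hr : 0 < cylRadius q := Real.sqrt_pos.2 hpos
  simp [cylRadius] at hr ⊢
  field_simp

/-- If the boundary is minimal, then `U - α / 2` has derivative `1` in `t = log (r / R)` there: the
mean curvature is the logarithmic derivative of `r² e^(α - 2 U)` along the unit normal. -/
theorem IsAxisymmetricData.dT_of_minimal (h : IsAxisymmetricData m₁ k U α B A) (hm : 0 < m₁)
    (hmin : MinimalBoundary (m₁ / 2) (metric U α B A)) {θ : ℝ} (hθ : θ ∈ Ioo 0 Real.pi) :
    dT (strip (m₁ / 2) U) (0, θ) - 1 / 2 * dT (strip (m₁ / 2) α) (0, θ) = 1 := by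
  have hR : 0 < m₁ / 2 := by positivity
  set R := m₁ / 2 with hRdef
  set q := sphPt R (0, θ) with hq
  have q0 : q 0 = R * Real.sin θ := by simp [hq, sphPt]
  have q1 : q 1 = R * Real.cos θ := by simp [hq, sphPt]
  have hsin : 0 < Real.sin θ := Real.sin_pos_of_mem_Ioo hθ
  have hq0 : 0 < q 0 := by rw [q0]; positivity
  have hqr : cylRadius q = R := by rw [hq, cylRadius_sphPt hR]; simp
  have hqS : q ∈ cylDomain R := ⟨hq0, hqr.ge⟩
  have H := hmin q hq0 hqr
  set S := cylDomain R with hS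
  set G := cylComponents (metric U α B A) with hG
  set s : (Fin 3 → ℝ) → ℝ := fun q => α (cyl q) - U (cyl q) with hs
  set w : (Fin 3 → ℝ) → ℝ := fun q => α (cyl q) - 2 * U (cyl q) with hw
  have rpos : ∀ p ∈ S, 0 < cylRadius p := fun p hp => hR.trans_le hp.2
  have rsq : ∀ p, cylRadius p ^ 2 = p 0 ^ 2 + p 1 ^ 2 := fun p => Real.sq_sqrt (by positivity)
  have udiff : ∀ p ∈ S, UniqueDiffWithinAt ℝ S p := fun p hp => uniqueDiffWithinAt_cylDomain hp
  have dr : ∀ p ∈ S, ∀ i, pdWithin S i cylRadius p =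
      ![p 0 / cylRadius p, p 1 / cylRadius p, 0] i := by
    intro p hp i
    rw [pdWithin, (hasFDerivAt_cylRadius hp.1).hasFDerivWithinAt.fderivWithin (udiff p hp)]
    fin_cases i <;> simp
  have edet : ∀ p ∈ S, Real.sqrt (G p).det = p 0 * Real.exp (w p) * Real.exp (s p) := by
    intro p hp
    rw [hG, cylComponents_metric _ _ _ _ hp.1, circleMatrix_det, ← Real.exp_add, ← Real.exp_add,
      Real.sqrt_eq_iff_mul_self_eq (Real.exp_pos _).le (by have := hp.1; positivity)]
    have : p 0 * Real.exp (w p) * Real.exp (s p) =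
        Real.exp (Real.log (p 0) + w p + s p) := by
      rw [Real.exp_add, Real.exp_add, Real.exp_log hp.1]
    rw [this, ← Real.exp_add]
    congr 1
    simp only [hw, hs]; ring
  -- the density `√(det g) ν`
  have eflux : ∀ p ∈ S, ∀ i, Real.sqrt (G p).det * unitNormal G S cylRadius i p =
      p 0 * Real.exp (w p) * ![p 0 / cylRadius p, p 1 / cylRadius p,
        -(p 0 * B (cyl p) * p 0 + A (cyl p) * p 1) / cylRadius p] i := by
    intro p hp i
    have hr := rpos p hp
    have e0 : Real.exp (-(2 * s p)) = Real.exp (-s p) * Real.exp (-s p) := by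
      rw [← Real.exp_add]; ring_nf
    have e2 : Real.exp (s p) * Real.exp (-s p) = 1 := by rw [← Real.exp_add]; simp
    have enorm : Real.sqrt (∑ k, ∑ l, (G p)⁻¹ k l * pdWithin S k cylRadius p *
        pdWithin S l cylRadius p) = Real.exp (-s p) := by
      rw [Real.sqrt_eq_iff_mul_self_eq_of_pos (Real.exp_pos _), ← e0]
      simp only [dr p hp, hG, cylComponents_metric _ _ _ _ hp.1, circleMatrix_inv,
        Fin.sum_univ_three]
      simp
      field_simp
      rw [rsq]
    rw [unitNormal, enorm, edet p hp]
    simp only [dr p hp, hG, cylComponents_metric _ _ _ _ hp.1, circleMatrix_inv,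
        Fin.sum_univ_three]
    have hs' : α (cyl p) - U (cyl p) = s p := rfl
    have e3 := Real.exp_pos (-s p)
    rw [hs', e0]
    fin_cases i <;> simp <;> field_simp <;> grind
  have hsub : S ⊆ {q | R ≤ cylRadius q} := fun p hp => hp.2
  have cU := (contDiffOn_comp_cyl h.smooth_U.smooth).mono hsub
  have cα := (contDiffOn_comp_cyl h.smooth_α.smooth).mono hsub
  have cw : ContDiffOn ℝ ∞ w S := cα.sub (contDiffOn_const.mul cU)
  have dw : HasFDerivWithinAt w (fderivWithin ℝ w S q) S q :=
    ((cw q hqS).differentiableWithinAt (by simp)).hasFDerivWithinAt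
  have p0 := (ContinuousLinearMap.proj (R := ℝ) (φ := fun _ => ℝ) (0 : Fin 3)).hasFDerivWithinAt
    (x := q) (s := S)
  have p1 := (ContinuousLinearMap.proj (R := ℝ) (φ := fun _ => ℝ) (1 : Fin 3)).hasFDerivWithinAt
    (x := q) (s := S)
  have drad := (hasFDerivAt_cylRadius hq0).hasFDerivWithinAt (s := S)
  have hrq : 0 < cylRadius q := rpos q hqS
  have dinv := (hasDerivAt_inv hrq.ne').comp_hasFDerivWithinAt q drad
  have f0 := (p0.mul dw.exp).mul (p0.mul dinv)
  have f1 := (p0.mul dw.exp).mul (p1.mul dinv)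
  have P0 : pdWithin S 0 (fun p => Real.sqrt (G p).det * unitNormal G S cylRadius 0 p) q =
      q 0 * Real.exp (w q) * (q 0 * (-(cylRadius q ^ 2)⁻¹ * (q 0 / cylRadius q))
        + (cylRadius q)⁻¹) + q 0 * (cylRadius q)⁻¹ *
          (q 0 * (Real.exp (w q) * fderivWithin ℝ w S q (Pi.single 0 1)) + Real.exp (w q)) := by
    rw [pdWithin, fderivWithin_congr (f := fun p => p 0 * Real.exp (w p) * (p 0 * (cylRadius p)⁻¹))
      (fun p hp => by rw [eflux p hp]; simp [div_eq_mul_inv])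
      (by rw [eflux q hqS]; simp [div_eq_mul_inv])]
    refine (congrArg (fun L => L (Pi.single 0 1)) (f0.fderivWithin (udiff q hqS))).trans ?_
    simp
    ring
  have P1 : pdWithin S 1 (fun p => Real.sqrt (G p).det * unitNormal G S cylRadius 1 p) q =
      q 0 * Real.exp (w q) * (q 1 * (-(cylRadius q ^ 2)⁻¹ * (q 1 / cylRadius q))
        + (cylRadius q)⁻¹) + q 1 * (cylRadius q)⁻¹ *
          (q 0 * (Real.exp (w q) * fderivWithin ℝ w S q (Pi.single 1 1))) := by
    rw [pdWithin, fderivWithin_congr (f := fun p => p 0 * Real.exp (w p) * (p 1 * (cylRadius p)⁻¹))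
      (fun p hp => by rw [eflux p hp]; simp [div_eq_mul_inv])
      (by rw [eflux q hqS]; simp [div_eq_mul_inv])]
    refine (congrArg (fun L => L (Pi.single 1 1)) (f1.fderivWithin (udiff q hqS))).trans ?_
    simp
    ring
  have P2 : pdWithin S 2 (fun p => Real.sqrt (G p).det * unitNormal G S cylRadius 2 p) q = 0 := by
    have mem : ∀ t : ℝ, q + t • Pi.single 2 1 ∈ S := fun t =>
      ⟨by simpa using hq0, by rw [cylRadius_add_single]; exact hqr.ge⟩
    apply fderivWithin_eq_zero_of_const mem
    intro t
    rw [eflux _ (mem t), eflux q hqS]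
    simp only [hw, h.smooth_U.comp_cyl_add hqr.ge, h.smooth_α.comp_cyl_add hqr.ge,
      h.smooth_B.comp_cyl_add hqr.ge, h.smooth_A.comp_cyl_add hqr.ge, cylRadius_add_single]
    simp
  have Hdiv : (∑ i, pdWithin S i (fun p => Real.sqrt (G p).det * unitNormal G S cylRadius i p) q)
      = 0 := by
    rw [meanCurvature, div_eq_zero_iff] at H
    refine H.resolve_right ?_
    rw [edet q hqS]; positivity
  rw [Fin.sum_univ_three, P0, P1, P2] at Hdiv
  have key : q 0 * fderivWithin ℝ w S q (Pi.single 0 1) + q 1 * fderivWithin ℝ w S q (Pi.single 1 1)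
      = -2 := by
    have hE := Real.exp_pos (w q)
    have h2 := rsq q
    rw [hqr] at Hdiv h2
    field_simp at Hdiv
    have h3 : q 0 * Real.exp (w q) * (R ^ 2 * (q 0 * fderivWithin ℝ w S q (Pi.single 0 1)
        + q 1 * fderivWithin ℝ w S q (Pi.single 1 1) + 2)) = 0 := by
      linear_combination Hdiv - q 0 * Real.exp (w q) * h2
    have h4 := (mul_eq_zero.1 ((mul_eq_zero.1 h3).resolve_left (by positivity))).resolve_left (by positivity)
    linarith
  have hcomp : HasDerivWithinAt (fun t => w (sphPt R (t, θ))) (-2) (Ici 0) 0 := by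
    have := dw.comp_hasDerivWithinAt_of_eq (0 : ℝ)
      (hasDerivAt_sphPt_t (R := R) 0 θ).hasDerivWithinAt (s := Ici 0) (fun t ht => by
        refine ⟨?_, ?_⟩
        · simp only [sphPt, Matrix.cons_val_zero]; positivity
        · have := cyl_sphPt_mem hR (p := (t, θ)) ht
          change R ≤ ‖_‖ at this
          rwa [norm_cyl] at this) hq
    refine this.congr_deriv ?_
    rw [← key, ← hq]
    have : (![q 0, q 1, 0] : Fin 3 → ℝ) = q 0 • Pi.single 0 1 + q 1 • Pi.single 1 1 := by
      ext i; fin_cases i <;> simp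
    rw [this]; simp only [map_add, map_smul, smul_eq_mul]
  have hU := hasDerivWithinAt_dT (contDiffOn_strip hR h.smooth_U.smooth) (t := 0) (θ := θ) le_rfl
  have hα := hasDerivWithinAt_dT (contDiffOn_strip hR h.smooth_α.smooth) (t := 0) (θ := θ) le_rfl
  have := (uniqueDiffOn_Ici (0 : ℝ) 0 (by simp)).eq_deriv _ hcomp (hα.sub (hU.const_mul 2))
  change -2 = dT (strip R α) (0, θ) - 2 * dT (strip R U) (0, θ) at this
  linarith

end

/-! ### The averaged scalar curvature inequality -/

/-- `tanh (t / 2)`, written as a rational function of `e^(-t)`. -/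
def tau (t : ℝ) : ℝ := (1 - Real.exp (-t)) / (1 + Real.exp (-t))

/-- The identity by which the first-order term of `bulk` combines with the weight `e^(-t)` of the
flux. -/
theorem tau_identity (t : ℝ) : 1 - Real.exp (-t) * (1 + tau t) = tau t := by
  have := Real.exp_pos (-t)
  unfold tau; field_simp; ring

theorem contDiff_tau : ContDiff ℝ ∞ tau := by
  unfold tau
  refine ContDiff.div (by fun_prop) (by fun_prop) fun x => ?_
  have := Real.exp_pos (-x); positivity

/-- `sin θ` times the scalar curvature density, for `V = U - U_S` the deviation from the
Schwarzschild potential `U_S`. -/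
def bulk (V a : ℝ × ℝ → ℝ) (p : ℝ × ℝ) : ℝ :=
  Real.sin p.2 * (dT (dT V) p + dTh (dTh V) p + tau p.1 * dT V p) + Real.cos p.2 * dTh V p
    - 1 / 2 * Real.sin p.2 * (dT (dT a) p + dTh (dTh a) p)
    - 1 / 2 * Real.sin p.2 * (dT V p ^ 2 + dTh V p ^ 2)

/-- The average over `θ`, with weight `sin θ / 2`, of `e^(-t) (V_t - a_t / 2 - a / 2) + V`. -/
def flux (V a : ℝ × ℝ → ℝ) (t : ℝ) : ℝ :=
  1 / 2 * ∫ θ in (0 : ℝ)..Real.pi, Real.sin θ *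
    (Real.exp (-t) * (dT V (t, θ) - 1 / 2 * dT a (t, θ) - 1 / 2 * a (t, θ)) + V (t, θ))

/-- Decay like `e^(-t/2)`, uniformly in `θ`. -/
def ExpDecay (f : ℝ × ℝ → ℝ) : Prop :=
  ∃ C T : ℝ, ∀ t ≥ T, ∀ θ, |f (t, θ)| ≤ C * Real.exp (-(1 / 2) * t)

theorem tendsto_of_expDecay {f : ℝ × ℝ → ℝ} (hf : ExpDecay f) (θ : ℝ) :
    Tendsto (fun t => f (t, θ)) atTop (𝓝 0) := by
  obtain ⟨C, T, hC⟩ := hf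
  have hlim : Tendsto (fun s : ℝ => C * Real.exp (-(1 / 2) * s)) atTop (𝓝 0) := by
    have : Tendsto (fun s : ℝ => -(1 / 2 : ℝ) * s) atTop atBot :=
      tendsto_id.const_mul_atTop_of_neg (by norm_num)
    simpa using (Real.tendsto_exp_atBot.comp this).const_mul C
  refine squeeze_zero_norm' ?_ hlim
  filter_upwards [eventually_ge_atTop T] with t ht using hC t ht θ

section
variable {V a : ℝ × ℝ → ℝ} (hV : ContDiffOn ℝ ∞ V halfStrip) (ha : ContDiffOn ℝ ∞ a halfStrip)
include hV ha

theorem contDiffOn_bulk : ContDiffOn ℝ ∞ (bulk V a) halfStrip := by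
  have h1 := contDiffOn_dT hV
  have h2 := contDiffOn_dTh hV
  have h3 := contDiffOn_dT h1
  have h4 := contDiffOn_dTh h2
  have h5 := contDiffOn_dT (contDiffOn_dT ha)
  have h6 := contDiffOn_dTh (contDiffOn_dTh ha)
  have ht : ContDiffOn ℝ ∞ (fun p : ℝ × ℝ => tau p.1) halfStrip :=
    (contDiff_tau.comp contDiff_fst).contDiffOn
  have hs : ContDiffOn ℝ ∞ (fun p : ℝ × ℝ => Real.sin p.2) halfStrip := by fun_prop
  have hc : ContDiffOn ℝ ∞ (fun p : ℝ × ℝ => Real.cos p.2) halfStrip := by fun_prop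
  exact (((hs.mul ((h3.add h4).add (ht.mul h1))).add (hc.mul h2)).sub
    ((contDiffOn_const.mul hs).mul (h5.add h6))).sub
    ((contDiffOn_const.mul hs).mul ((h1.pow 2).add (h2.pow 2)))

theorem contDiffOn_fluxIntegrand : ContDiffOn ℝ ∞ (fun p : ℝ × ℝ => Real.sin p.2 *
    (Real.exp (-p.1) * (dT V p - 1 / 2 * dT a p - 1 / 2 * a p) + V p)) halfStrip := by
  have hs : ContDiffOn ℝ ∞ (fun p : ℝ × ℝ => Real.sin p.2) halfStrip := by fun_prop
  have he : ContDiffOn ℝ ∞ (fun p : ℝ × ℝ => Real.exp (-p.1)) halfStrip := by fun_prop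
  exact hs.mul ((he.mul (((contDiffOn_dT hV).sub (contDiffOn_const.mul (contDiffOn_dT ha))).sub
    (contDiffOn_const.mul ha))).add hV)

/-- The derivative of the flux: integration by parts in `θ` removes the second derivatives. -/
theorem hasDerivAt_flux (a0 : ∀ t ≥ 0, a (t, 0) = 0) (api : ∀ t ≥ 0, a (t, Real.pi) = 0)
    {t : ℝ} (ht : 0 < t) :
    HasDerivAt (flux V a) (1 / 2 * ∫ θ in (0 : ℝ)..Real.pi,
      (Real.sin θ * (tau t * dT V (t, θ)) + Real.exp (-t) * (bulk V a (t, θ)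
        + 1 / 2 * Real.sin θ * (dT V (t, θ) ^ 2 + dTh V (t, θ) ^ 2)))) t := by
  have sm := contDiffOn_fluxIntegrand hV ha
  have h1 := contDiffOn_dT hV
  have h2 := contDiffOn_dTh hV
  have k1 := contDiffOn_dT ha
  have k2 := contDiffOn_dTh ha
  have k4 := contDiffOn_dTh k2
  have main := (hasDerivAt_integral_slice sm ht).const_mul (1 / 2)
  refine main.congr_deriv ?_
  congr 1
  have d : ∀ θ, dT (fun p : ℝ × ℝ => Real.sin p.2 *
      (Real.exp (-p.1) * (dT V p - 1 / 2 * dT a p - 1 / 2 * a p) + V p)) (t, θ) =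
      Real.sin θ * (Real.exp (-t) * (dT (dT V) (t, θ) - 1 / 2 * dT (dT a) (t, θ)
        - dT V (t, θ) + 1 / 2 * a (t, θ)) + dT V (t, θ)) := by
    intro θ
    apply dT_eq_of_hasDerivAt sm ht
    have e := (hasDerivAt_neg t).exp
    refine ((((e.mul (((hasDerivAt_dT h1 ht).sub ((hasDerivAt_dT k1 ht).const_mul (1 / 2))).sub
      ((hasDerivAt_dT ha ht).const_mul (1 / 2)))).add (hasDerivAt_dT hV ht)).const_mul
      (Real.sin θ))).congr_deriv ?_
    simp only [Pi.sub_apply]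
    ring
  simp only [d]
  have cs := continuous_slice (contDiffOn_bulk hV ha).continuousOn ht.le
  have c1 := continuous_slice h1.continuousOn ht.le
  have c2 := continuous_slice h2.continuousOn ht.le
  have c3 := continuous_slice ha.continuousOn ht.le
  have c4 := continuous_slice k2.continuousOn ht.le
  have c5 := continuous_slice (contDiffOn_dTh h2).continuousOn ht.le
  have c6 := continuous_slice k4.continuousOn ht.le
  have c7 := continuous_slice (contDiffOn_dT h1).continuousOn ht.le
  have c8 := continuous_slice (contDiffOn_dT k1).continuousOn ht.le
  -- the total `θ`-derivatives
  have ibp : ∫ θ in (0 : ℝ)..Real.pi, Real.exp (-t) *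
      (1 / 2 * (Real.sin θ * dTh (dTh a) (t, θ) + Real.sin θ * a (t, θ))
        - (Real.cos θ * dTh V (t, θ) + Real.sin θ * dTh (dTh V) (t, θ))) = 0 := by
    rw [intervalIntegral.integral_eq_sub_of_hasDerivAt (f := fun θ => Real.exp (-t) *
      (1 / 2 * (Real.sin θ * dTh a (t, θ) - Real.cos θ * a (t, θ)) - Real.sin θ * dTh V (t, θ)))]
    · simp [a0 t ht.le, api t ht.le]
    · intro θ _
      refine ((((((Real.hasDerivAt_sin θ).mul (hasDerivAt_dTh k2 ht.le)).sub
        ((Real.hasDerivAt_cos θ).mul (hasDerivAt_dTh ha ht.le))).const_mul (1 / 2)).sub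
        ((Real.hasDerivAt_sin θ).mul (hasDerivAt_dTh h2 ht.le))).const_mul
          (Real.exp (-t))).congr_deriv ?_
      ring
    · refine Continuous.intervalIntegrable ?_ _ _
      exact continuous_const.mul ((continuous_const.mul ((Real.continuous_sin.mul c6).add
        (Real.continuous_sin.mul c3))).sub ((Real.continuous_cos.mul c2).add
          (Real.continuous_sin.mul c5)))
  have i1 : IntervalIntegrable (fun θ => Real.sin θ * (Real.exp (-t) * (dT (dT V) (t, θ)
      - 1 / 2 * dT (dT a) (t, θ) - dT V (t, θ) + 1 / 2 * a (t, θ)) + dT V (t, θ)))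
      MeasureTheory.volume 0 Real.pi :=
    (Real.continuous_sin.mul ((continuous_const.mul (((c7.sub (continuous_const.mul c8)).sub c1).add
      (continuous_const.mul c3))).add c1)).intervalIntegrable _ _
  have i2 : IntervalIntegrable (fun θ => Real.sin θ * (tau t * dT V (t, θ)) + Real.exp (-t) *
      (bulk V a (t, θ) + 1 / 2 * Real.sin θ * (dT V (t, θ) ^ 2 + dTh V (t, θ) ^ 2)))
      MeasureTheory.volume 0 Real.pi :=
    ((Real.continuous_sin.mul (continuous_const.mul c1)).add (continuous_const.mul (cs.add
      ((continuous_const.mul Real.continuous_sin).mul ((c1.pow 2).add (c2.pow 2)))))).intervalIntegrable _ _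
  rw [← sub_eq_zero, ← intervalIntegral.integral_sub i1 i2]
  refine Eq.trans ?_ ibp
  apply intervalIntegral.integral_congr
  intro θ _
  have e := tau_identity t
  simp only [bulk]
  linear_combination Real.sin θ * dT V (t, θ) * e

theorem continuousOn_flux : ContinuousOn (flux V a) (Ici 0) :=
  continuousOn_const.mul
    (continuousOn_integral_slice (contDiffOn_fluxIntegrand hV ha).continuousOn)

omit hV ha in
/-- The flux vanishes at infinity. -/
theorem tendsto_flux (dV : ExpDecay V) (dVt : ExpDecay (dT V)) (da : ExpDecay a)
    (dat : ExpDecay (dT a)) : Tendsto (flux V a) atTop (𝓝 0) := by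
  obtain ⟨C1, T1, h1⟩ := dV
  obtain ⟨C2, T2, h2⟩ := dVt
  obtain ⟨C3, T3, h3⟩ := da
  obtain ⟨C4, T4, h4⟩ := dat
  have lim : Tendsto (fun t : ℝ => 1 / 2 * ((C1 + C2 + C3 + C4) * Real.exp (-(1 / 2) * t)
      * |Real.pi - 0|)) atTop (𝓝 (1 / 2 * ((C1 + C2 + C3 + C4) * 0 * |Real.pi - 0|))) := by
    refine (Tendsto.mul_const _ (Tendsto.const_mul _ ?_)).const_mul _
    exact Real.tendsto_exp_atBot.comp (tendsto_id.const_mul_atTop_of_neg (by norm_num))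
  simp only [mul_zero, zero_mul] at lim
  refine squeeze_zero_norm' ?_ lim
  filter_upwards [eventually_ge_atTop T1, eventually_ge_atTop T2, eventually_ge_atTop T3,
    eventually_ge_atTop T4, eventually_ge_atTop 0] with t t1 t2 t3 t4 t0
  rw [flux, norm_mul, Real.norm_of_nonneg (by norm_num : (0 : ℝ) ≤ 1 / 2)]
  gcongr
  apply intervalIntegral.norm_integral_le_of_norm_le_const
  intro θ _
  have b1 := h1 t t1 θ
  have b2 := h2 t t2 θ
  have b3 := h3 t t3 θ
  have b4 := h4 t t4 θ
  have he : Real.exp (-t) ≤ 1 := Real.exp_le_one_iff.2 (by linarith)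
  have he0 := Real.exp_pos (-t)
  rw [Real.norm_eq_abs, abs_mul]
  have hs := Real.abs_sin_le_one θ
  have A : |dT V (t, θ) - 1 / 2 * dT a (t, θ) - 1 / 2 * a (t, θ)| ≤
      |dT V (t, θ)| + |dT a (t, θ)| + |a (t, θ)| := by
    rw [abs_le]
    constructor <;> cases abs_cases (dT V (t, θ)) <;> cases abs_cases (dT a (t, θ)) <;>
      cases abs_cases (a (t, θ)) <;> linarith
  calc _ ≤ 1 * |Real.exp (-t) * (dT V (t, θ) - 1 / 2 * dT a (t, θ) - 1 / 2 * a (t, θ))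
        + V (t, θ)| := by gcongr
    _ ≤ 1 * (|dT V (t, θ)| + |dT a (t, θ)| + |a (t, θ)|) + |V (t, θ)| := by
        rw [one_mul]
        refine (abs_add_le _ _).trans ?_
        rw [abs_mul, abs_of_pos he0]
        gcongr
    _ ≤ _ := by linarith

end

section
variable {V a : ℝ × ℝ → ℝ} {c : ℝ}

/-- The value of the flux at the boundary. -/
theorem flux_zero
    (bd : ∀ θ ∈ Ioo 0 Real.pi, V (0, θ) - 1 / 2 * a (0, θ) = c)
    (bd' : ∀ θ ∈ Ioo 0 Real.pi, dT V (0, θ) - 1 / 2 * dT a (0, θ) = 0) : flux V a 0 = c := by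
  have : ∫ θ in (0 : ℝ)..Real.pi, Real.sin θ * (Real.exp (-0) * (dT V (0, θ)
      - 1 / 2 * dT a (0, θ) - 1 / 2 * a (0, θ)) + V (0, θ)) =
      ∫ θ in (0 : ℝ)..Real.pi, Real.sin θ * c := by
    apply intervalIntegral.integral_congr_ae
    have : ∀ᵐ x : ℝ, x ≠ Real.pi := by simp [MeasureTheory.ae_iff]
    filter_upwards [this] with θ hne hθ
    rw [uIoc_of_le Real.pi_pos.le] at hθ
    have h1 := bd θ ⟨hθ.1, lt_of_le_of_ne hθ.2 hne⟩
    have h2 := bd' θ ⟨hθ.1, lt_of_le_of_ne hθ.2 hne⟩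
    rw [h2, neg_zero, Real.exp_zero, ← h1]; ring
  rw [flux, this, intervalIntegral.integral_mul_const, integral_sin]
  simp; ring

/-- The energy of `V` is at least `2 c²`. The derivative of the flux is at least the average of
`tau V_t`, and `-4 c tau V_t ≤ sinh V_t² + 4 c² tau² / sinh`; integrating over `t`, with the flux equal
to `c` at `t = 0` and to `0` at infinity, gives `4 c² ≤ I + 4 c² ∫ tau² / sinh`, where the last
integral is `1 / 2`. The factor `4 c` is the one that gives the best constant. -/
theorem energy_bound (hV : ContDiffOn ℝ ∞ V halfStrip) (ha : ContDiffOn ℝ ∞ a halfStrip)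
    (a0 : ∀ t ≥ 0, a (t, 0) = 0) (api : ∀ t ≥ 0, a (t, Real.pi) = 0)
    (bd : ∀ θ ∈ Ioo 0 Real.pi, V (0, θ) - 1 / 2 * a (0, θ) = c)
    (bd' : ∀ θ ∈ Ioo 0 Real.pi, dT V (0, θ) - 1 / 2 * dT a (0, θ) = 0)
    (pos : ∀ t > 0, ∀ θ ∈ Ioo 0 Real.pi, 0 ≤ bulk V a (t, θ))
    (dV : ExpDecay V) (dVt : ExpDecay (dT V)) (da : ExpDecay a) (dat : ExpDecay (dT a))
    (hc : 0 ≤ c) {I : ℝ}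
    (hI : ∀ T > 0, (∫ t in (0 : ℝ)..T, 1 / 2 * ∫ θ in (0 : ℝ)..Real.pi,
      Real.sinh t * Real.sin θ * (dT V (t, θ) ^ 2 + dTh V (t, θ) ^ 2)) ≤ I) :
    2 * c ^ 2 ≤ I := by
  have h1 := contDiffOn_dT hV
  have h2 := contDiffOn_dTh hV
  -- `K' = tau² / sinh`, so that `-4 c tau v - 4 c² K' ≤ sinh v²` for all `v`, by completing the
  -- square
  set K : ℝ → ℝ := fun t => -2 * Real.exp (-t) / (1 + Real.exp (-t)) ^ 2 with hK
  set K' : ℝ → ℝ := fun t => 2 * Real.exp (-t) * (1 - Real.exp (-t)) / (1 + Real.exp (-t)) ^ 3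
    with hK'
  have dK : ∀ t, HasDerivAt K (K' t) t := by
    intro t
    have e := (hasDerivAt_neg t).exp
    have hp : 1 + Real.exp (-t) ≠ 0 := by positivity
    have e2 : HasDerivAt (fun t : ℝ => (1 + Real.exp (-t)) ^ 2)
        (2 * (1 + Real.exp (-t)) * (Real.exp (-t) * -1)) t := by
      exact ((e.const_add 1).pow 2).congr_deriv (by simp)
    refine (HasDerivAt.div (e.const_mul (-2)) e2 (by positivity)).congr_deriv ?_
    simp only [hK']
    field_simp
    ring
  have hKlim : Tendsto K atTop (𝓝 0) := by
    have e : Tendsto (fun t : ℝ => Real.exp (-t)) atTop (𝓝 0) :=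
      Real.tendsto_exp_neg_atTop_nhds_zero
    have h : Tendsto K atTop (𝓝 (-2 * 0 / (1 + 0) ^ 2)) :=
      (e.const_mul (-2)).div ((e.const_add 1).pow 2) (by norm_num)
    simpa using h
  set g : ℝ → ℝ := fun t => -4 * c * flux V a t - 4 * c ^ 2 * K t with hg
  have hg0 : g 0 = -2 * c ^ 2 := by
    simp only [hg, hK, flux_zero bd bd']; norm_num; ring
  have hglim : Tendsto g atTop (𝓝 0) := by
    have h : Tendsto g atTop (𝓝 (-4 * c * 0 - 4 * c ^ 2 * 0)) :=
      ((tendsto_flux dV dVt da dat).const_mul (-4 * c)).sub (hKlim.const_mul (4 * c ^ 2))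
    simpa using h
  have smφ : ContDiffOn ℝ ∞ (fun p : ℝ × ℝ => Real.sinh p.1 * Real.sin p.2 *
      (dT V p ^ 2 + dTh V p ^ 2)) halfStrip := by
    have e1 : ContDiffOn ℝ ∞ (fun p : ℝ × ℝ => Real.sinh p.1 * Real.sin p.2) halfStrip := by
      have := Real.contDiff_sinh (n := ∞)
      fun_prop
    exact e1.mul ((h1.pow 2).add (h2.pow 2))
  have key : ∀ T > 0, g T - g 0 ≤ I := by
    intro T hT
    refine le_trans ?_ (hI T hT)
    have hsub : Icc 0 T ⊆ Ici (0 : ℝ) := fun t ht => ht.1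
    refine intervalIntegral.sub_le_integral_of_hasDeriv_right_of_le hT.le
      (g' := fun t => -4 * c * (1 / 2 * ∫ θ in (0 : ℝ)..Real.pi,
        (Real.sin θ * (tau t * dT V (t, θ)) + Real.exp (-t) * (bulk V a (t, θ)
        + 1 / 2 * Real.sin θ * (dT V (t, θ) ^ 2 + dTh V (t, θ) ^ 2)))) - 4 * c ^ 2 * K' t)
      ?_ ?_ ?_ ?_
    · refine ContinuousOn.sub (continuousOn_const.mul ((continuousOn_flux hV ha).mono hsub)) ?_
      exact continuousOn_const.mul fun t _ => (dK t).continuousAt.continuousWithinAt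
    · intro t ht
      exact (((hasDerivAt_flux hV ha a0 api ht.1).const_mul (-4 * c)).sub
        ((dK t).const_mul _)).hasDerivWithinAt
    · refine ContinuousOn.integrableOn_Icc ?_
      exact continuousOn_const.mul ((continuousOn_integral_slice smφ.continuousOn).mono hsub)
    · intro t ht
      have t0 : 0 < t := ht.1
      have cs := continuous_slice (contDiffOn_bulk hV ha).continuousOn t0.le
      have c1 := continuous_slice h1.continuousOn t0.le
      have c2 := continuous_slice h2.continuousOn t0.le
      have hq0 := Real.exp_pos (-t)
      have hq1 : Real.exp (-t) < 1 := by rw [Real.exp_lt_one_iff]; linarith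
      have hsinh : Real.sinh t = (1 - Real.exp (-t) ^ 2) / (2 * Real.exp (-t)) := by
        rw [Real.sinh_eq, Real.exp_neg]; field_simp
      have hpt : ∀ v, -4 * c * (tau t * v) - 4 * c ^ 2 * K' t ≤ Real.sinh t * v ^ 2 := by
        intro v
        rw [hsinh]
        simp only [hK', tau]
        generalize Real.exp (-t) = x at *
        have : (1 - x ^ 2) / (2 * x) * v ^ 2 - (-4 * c * ((1 - x) / (1 + x) * v)
            - 4 * c ^ 2 * (2 * x * (1 - x) / (1 + x) ^ 3)) =
            (1 - x) * (1 + x) / (2 * x) * (v + 4 * c * x / (1 + x) ^ 2) ^ 2 := by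
          field_simp; ring
        have h0 : 0 ≤ (1 - x) * (1 + x) / (2 * x) * (v + 4 * c * x / (1 + x) ^ 2) ^ 2 := by
          have : 0 ≤ 1 - x := by linarith
          positivity
        linarith
      have hK2 : 4 * c ^ 2 * K' t = 1 / 2 * ∫ θ in (0 : ℝ)..Real.pi, Real.sin θ *
          (4 * c ^ 2 * K' t) := by
        rw [intervalIntegral.integral_mul_const, integral_sin]; simp; ring
      have i2 : Continuous (fun θ => Real.sin θ * (tau t * dT V (t, θ)) + Real.exp (-t) *
          (bulk V a (t, θ) + 1 / 2 * Real.sin θ * (dT V (t, θ) ^ 2 + dTh V (t, θ) ^ 2))) :=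
        ((Real.continuous_sin.mul (continuous_const.mul c1)).add (continuous_const.mul (cs.add
          ((continuous_const.mul Real.continuous_sin).mul ((c1.pow 2).add (c2.pow 2))))))
      have i3 : Continuous fun θ => Real.sin θ * (4 * c ^ 2 * K' t) := by fun_prop
      have i4 : Continuous fun θ => Real.sinh t * Real.sin θ *
          (dT V (t, θ) ^ 2 + dTh V (t, θ) ^ 2) :=
        (continuous_const.mul Real.continuous_sin).mul ((c1.pow 2).add (c2.pow 2))
      have i5 : Continuous fun θ => -4 * c * (Real.sin θ * (tau t * dT V (t, θ)) + Real.exp (-t) *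
          (bulk V a (t, θ) + 1 / 2 * Real.sin θ * (dT V (t, θ) ^ 2 + dTh V (t, θ) ^ 2))) :=
        continuous_const.mul i2
      change _ ≤ 1 / 2 * ∫ θ in (0 : ℝ)..Real.pi, _
      rw [hK2, ← mul_assoc, mul_comm (-4 * c) (1 / 2), mul_assoc, ← mul_sub]
      gcongr
      rw [← intervalIntegral.integral_const_mul, ← intervalIntegral.integral_sub
        (i5.intervalIntegrable _ _) (i3.intervalIntegrable _ _)]
      apply intervalIntegral.integral_mono_on_of_le_Ioo Real.pi_pos.le
        ((i5.sub i3).intervalIntegrable _ _) (i4.intervalIntegrable _ _)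
      intro θ hθ
      have hsin := Real.sin_pos_of_mem_Ioo hθ
      have hb := pos t t0 θ hθ
      have h3 := mul_le_mul_of_nonneg_left (hpt (dT V (t, θ))) hsin.le
      have h4 : 0 ≤ Real.sinh t * Real.sin θ * dTh V (t, θ) ^ 2 := by
        have := (Real.sinh_pos_iff.2 t0).le
        positivity
      have h5 : 0 ≤ 4 * c * (Real.exp (-t) * (bulk V a (t, θ)
          + 1 / 2 * Real.sin θ * (dT V (t, θ) ^ 2 + dTh V (t, θ) ^ 2))) := by positivity
      simp only [Pi.sub_apply]
      clear_value K'
      linarith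
  have := ge_of_tendsto (hglim.sub_const (g 0)).neg (b := -I) (by
    filter_upwards [eventually_gt_atTop 0] with T hT using neg_le_neg (key T hT))
  rw [hg0] at this
  linarith

/-- In the rigid case `c = 0`, `V_t = 0` the curvature inequality is an equality: the flux is monotone
and vanishes at both ends, so its derivative, the integral of nonnegative terms, is zero. -/
theorem bulk_eq_zero (hV : ContDiffOn ℝ ∞ V halfStrip) (ha : ContDiffOn ℝ ∞ a halfStrip)
    (a0 : ∀ t ≥ 0, a (t, 0) = 0) (api : ∀ t ≥ 0, a (t, Real.pi) = 0)
    (bd : ∀ θ ∈ Ioo 0 Real.pi, V (0, θ) - 1 / 2 * a (0, θ) = 0)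
    (bd' : ∀ θ ∈ Ioo 0 Real.pi, dT V (0, θ) - 1 / 2 * dT a (0, θ) = 0)
    (pos : ∀ t > 0, ∀ θ ∈ Ioo 0 Real.pi, 0 ≤ bulk V a (t, θ))
    (dV : ExpDecay V) (dVt : ExpDecay (dT V)) (da : ExpDecay a) (dat : ExpDecay (dT a))
    (V0 : ∀ t > 0, ∀ θ ∈ Ioo 0 Real.pi, dT V (t, θ) = 0) {t θ : ℝ} (ht : 0 < t) (hθ : θ ∈ Ioo 0 Real.pi) :
    bulk V a (t, θ) = 0 := by
  have cb := (contDiffOn_bulk hV ha).continuousOn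
  have nonneg : ∀ s > 0, ∀ θ ∈ Ioo 0 Real.pi, 0 ≤ Real.sin θ * (tau s * dT V (s, θ)) +
      Real.exp (-s) * (bulk V a (s, θ)
        + 1 / 2 * Real.sin θ * (dT V (s, θ) ^ 2 + dTh V (s, θ) ^ 2)) := by
    intro s hs θ hθ
    have := pos s hs θ hθ
    have := Real.sin_pos_of_mem_Ioo hθ
    rw [V0 s hs θ hθ]; simp only [mul_zero, zero_add]; positivity
  have cint : ∀ s > 0, Continuous fun θ => Real.sin θ * (tau s * dT V (s, θ)) +
      Real.exp (-s) * (bulk V a (s, θ)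
        + 1 / 2 * Real.sin θ * (dT V (s, θ) ^ 2 + dTh V (s, θ) ^ 2)) := by
    intro s hs
    have cs := continuous_slice cb hs.le
    have c1 := continuous_slice (contDiffOn_dT hV).continuousOn hs.le
    have c2 := continuous_slice (contDiffOn_dTh hV).continuousOn hs.le
    exact ((Real.continuous_sin.mul (continuous_const.mul c1)).add (continuous_const.mul (cs.add
          ((continuous_const.mul Real.continuous_sin).mul ((c1.pow 2).add (c2.pow 2))))))
  have dpos : ∀ s > 0, 0 ≤ 1 / 2 * ∫ θ in (0 : ℝ)..Real.pi,
      (Real.sin θ * (tau s * dT V (s, θ)) + Real.exp (-s) * (bulk V a (s, θ)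
        + 1 / 2 * Real.sin θ * (dT V (s, θ) ^ 2 + dTh V (s, θ) ^ 2))) := by
    intro s hs
    have h0 : (∫ θ in (0 : ℝ)..Real.pi, (0 : ℝ)) ≤ ∫ θ in (0 : ℝ)..Real.pi,
      (Real.sin θ * (tau s * dT V (s, θ)) + Real.exp (-s) * (bulk V a (s, θ)
        + 1 / 2 * Real.sin θ * (dT V (s, θ) ^ 2 + dTh V (s, θ) ^ 2))) :=
      intervalIntegral.integral_mono_on_of_le_Ioo Real.pi_pos.le (by simp)
        ((cint s hs).intervalIntegrable _ _) fun θ hθ => nonneg s hs θ hθ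
    simp only [intervalIntegral.integral_zero] at h0
    positivity
  have mono : MonotoneOn (flux V a) (Ici 0) := by
    apply monotoneOn_of_hasDerivWithinAt_nonneg (convex_Ici 0) (continuousOn_flux hV ha)
    · intro s hs; rw [interior_Ici] at hs ⊢
      exact (hasDerivAt_flux hV ha a0 api hs).hasDerivWithinAt
    · intro s hs; rw [interior_Ici] at hs; exact dpos s hs
  have f0 := flux_zero bd bd'
  have lim := tendsto_flux dV dVt da dat
  have fz : ∀ s ≥ 0, flux V a s = 0 := by
    intro s hs
    apply le_antisymm
    · exact ge_of_tendsto lim (by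
        filter_upwards [eventually_ge_atTop s] with T hT using mono hs (hs.trans hT) hT)
    · rw [← f0]; exact mono (by simp) hs hs
  have dz : HasDerivAt (flux V a) 0 t := by
    refine (hasDerivAt_const t (0 : ℝ)).congr_of_eventuallyEq ?_
    filter_upwards [eventually_gt_nhds ht] with s hs using fz s (le_of_lt hs)
  have hz := dz.unique (hasDerivAt_flux hV ha a0 api ht)
  by_contra hne
  have hb : 0 < bulk V a (t, θ) := lt_of_le_of_ne (pos t ht θ hθ) (Ne.symm hne)
  have hcl : ∀ x ∈ Icc 0 Real.pi, 0 ≤ Real.sin x * (tau t * dT V (t, x)) + Real.exp (-t) *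
      (bulk V a (t, x) + 1 / 2 * Real.sin x * (dT V (t, x) ^ 2 + dTh V (t, x) ^ 2)) := by
    intro x hx
    rw [← closure_Ioo Real.pi_pos.ne] at hx
    exact le_on_closure (fun y hy => nonneg t ht y hy) continuousOn_const
      (cint t ht).continuousOn hx
  have hpos := intervalIntegral.integral_pos Real.pi_pos (cint t ht).continuousOn
    (fun x hx => hcl x ⟨hx.1.le, hx.2⟩) ⟨θ, ⟨hθ.1.le, hθ.2.le⟩, by
      have := Real.sin_pos_of_mem_Ioo hθ
      rw [V0 t ht θ hθ]; simp only [mul_zero, zero_add]; positivity⟩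
  linarith

end

/-! ### Decay and the deviation from the Schwarzschild potential -/

theorem exterior_mem_nhds {R : ℝ} {x : E3} (hx : R < ‖x‖) : exterior R ∈ 𝓝 x :=
  mem_of_superset ((isOpen_lt continuous_const continuous_norm).mem_nhds hx)
    fun _ (hy : R < ‖_‖) => hy.le

theorem IsLittleOrder.exists_bound {l : ℕ} {s : ℝ} {f : E3 → ℝ} (h : IsLittleOrder l s f) {j : ℕ}
    (hj : j ≤ l) : ∃ T : ℝ, ∀ x : E3, T ≤ ‖x‖ → ‖iteratedFDeriv ℝ j f x‖ ≤ ‖x‖ ^ (s - j) := by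
  have := (h j hj).def (c := 1) one_pos
  rw [← comap_norm_atTop, eventually_comap] at this
  obtain ⟨T, hT⟩ := eventually_atTop.1 this
  refine ⟨T, fun x hx => ?_⟩
  have := hT _ hx x rfl
  rwa [one_mul, Real.norm_of_nonneg (by positivity)] at this

/-- A continuous function on the closed exterior region, dominated at infinity by a power of
the radius, is dominated by it everywhere. -/
theorem exists_bound_rpow {F : Type*} [NormedAddCommGroup F] {R s T K : ℝ} (hR : 0 < R)
    {f : E3 → F} (hf : ContinuousOn f (exterior R))
    (hT : ∀ x : E3, T ≤ ‖x‖ → ‖f x‖ ≤ K * ‖x‖ ^ s) :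
    ∃ C > 0, ∀ x ∈ exterior R, ‖f x‖ ≤ C * ‖x‖ ^ s := by
  have hK : IsCompact (exterior R ∩ Metric.closedBall 0 T) :=
    (isCompact_closedBall _ _).inter_left (isClosed_le continuous_const continuous_norm)
  have hc : ContinuousOn (fun x : E3 => ‖f x‖ / ‖x‖ ^ s) (exterior R ∩ Metric.closedBall 0 T) := by
    have hn : ∀ x ∈ exterior R ∩ Metric.closedBall 0 T, ‖x‖ ≠ 0 :=
      fun x hx => (hR.trans_le hx.1).ne'
    refine ContinuousOn.div (hf.mono inter_subset_left).norm ?_ ?_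
    · exact continuous_norm.continuousOn.rpow_const fun x hx => Or.inl (hn x hx)
    · intro x hx
      have : 0 < ‖x‖ := hR.trans_le hx.1
      positivity
  obtain ⟨C, hC⟩ := hK.exists_bound_of_continuousOn hc
  refine ⟨max C (max K 1), by positivity, fun x hx => ?_⟩
  have hx0 : 0 < ‖x‖ := hR.trans_le hx
  rcases le_total T ‖x‖ with h | h
  · refine (hT x h).trans ?_
    gcongr
    exact (le_max_left _ _).trans (le_max_right _ _)
  · have := hC x ⟨hx, by simpa using h⟩
    rw [Real.norm_of_nonneg (by positivity), div_le_iff₀ (by positivity)] at this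
    exact this.trans (by gcongr; exact le_max_left _ _)

theorem IsLittleOrder.exists_bound_exterior {R : ℝ} (hR : 0 < R) {l : ℕ} {s : ℝ} {f : E3 → ℝ}
    (h : IsLittleOrder l s f) (hf : ContinuousOn f (exterior R)) :
    ∃ C > 0, ∀ x ∈ exterior R, |f x| ≤ C * ‖x‖ ^ s := by
  obtain ⟨T, hT⟩ := h.exists_bound (Nat.zero_le _)
  refine exists_bound_rpow hR hf (T := T) (K := 1) fun x hx => ?_
  simpa [norm_iteratedFDeriv_zero] using hT x hx

theorem norm_cyl_sphPt {R : ℝ} (hR : 0 < R) (p : ℝ × ℝ) : ‖cyl (sphPt R p)‖ = R * Real.exp p.1 := by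
  rw [norm_cyl, cylRadius_sphPt hR]

theorem hasDerivAt_cyl_sphPt (R t θ : ℝ) :
    HasDerivAt (fun t => cyl (sphPt R (t, θ))) (cyl (sphPt R (t, θ))) t := by
  have : (fun t => cyl (sphPt R (t, θ))) = fun t => Real.exp t • cyl (sphPt R (0, θ)) := by
    funext t; ext i; fin_cases i <;> simp [cyl, sphPt] <;> ring
  rw [this]
  refine ((Real.hasDerivAt_exp t).smul_const _).congr_deriv (congrFun this t).symm

theorem rpow_exp_bound {R : ℝ} (hR : 0 < R) (t : ℝ) :
    (R * Real.exp t) ^ (-1 / 2 : ℝ) = R ^ (-1 / 2 : ℝ) * Real.exp (-(1 / 2) * t) := by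
  rw [Real.mul_rpow hR.le (Real.exp_pos t).le, ← Real.exp_mul]; ring_nf

theorem exists_time {R : ℝ} (hR : 0 < R) (T : ℝ) : ∃ T' > 0, ∀ t ≥ T', T ≤ R * Real.exp t := by
  refine ⟨max (T / R) 1, by positivity, fun t ht => ?_⟩
  have h1 : T / R ≤ t := (le_max_left _ _).trans ht
  have h2 := Real.add_one_le_exp t
  rw [div_le_iff₀ hR] at h1
  nlinarith

theorem IsLittleOrder.expDecay {R : ℝ} (hR : 0 < R) {l : ℕ} {f : E3 → ℝ}
    (h : IsLittleOrder l (-1 / 2) f) : ExpDecay (strip R f) := by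
  obtain ⟨T, hT⟩ := h.exists_bound (Nat.zero_le _)
  obtain ⟨T', _, hT'⟩ := exists_time hR T
  refine ⟨R ^ (-1 / 2 : ℝ), T', fun t ht θ => ?_⟩
  have := hT (cyl (sphPt R (t, θ))) (by rw [norm_cyl_sphPt hR]; exact hT' t ht)
  rw [norm_iteratedFDeriv_zero, norm_cyl_sphPt hR] at this
  rw [← rpow_exp_bound hR]
  simpa [strip] using this

theorem dT_strip {R : ℝ} (hR : 0 < R) {f : E3 → ℝ} (hf : ContDiffOn ℝ ∞ f (exterior R)) {t θ : ℝ}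
    (ht : 0 < t) : dT (strip R f) (t, θ) =
      fderiv ℝ f (cyl (sphPt R (t, θ))) (cyl (sphPt R (t, θ))) := by
  apply dT_eq_of_hasDerivAt (contDiffOn_strip hR hf) ht
  have hx : R < ‖cyl (sphPt R (t, θ))‖ := by
    rw [norm_cyl]; exact cylRadius_sphPt_gt hR (p := (t, θ)) ht
  exact ((hf.contDiffAt (exterior_mem_nhds hx)).differentiableAt
    (by simp)).hasFDerivAt.comp_hasDerivAt t (hasDerivAt_cyl_sphPt R t θ)

theorem IsLittleOrder.expDecay_dT {R : ℝ} (hR : 0 < R) {l : ℕ} (hl : 1 ≤ l) {f : E3 → ℝ}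
    (h : IsLittleOrder l (-1 / 2) f) (hf : ContDiffOn ℝ ∞ f (exterior R)) :
    ExpDecay (dT (strip R f)) := by
  obtain ⟨T, hT⟩ := h.exists_bound hl
  obtain ⟨T', hT0, hT'⟩ := exists_time hR T
  refine ⟨R ^ (-1 / 2 : ℝ), T', fun t ht θ => ?_⟩
  have hb := hT (cyl (sphPt R (t, θ))) (by rw [norm_cyl_sphPt hR]; exact hT' t ht)
  rw [norm_iteratedFDeriv_one] at hb
  rw [dT_strip hR hf (by linarith), ← rpow_exp_bound hR]
  have h1 := (fderiv ℝ f (cyl (sphPt R (t, θ)))).le_opNorm (cyl (sphPt R (t, θ)))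
  have hpos : 0 < R * Real.exp t := by positivity
  refine h1.trans ((mul_le_mul_of_nonneg_right hb (norm_nonneg _)).trans (le_of_eq ?_))
  rw [norm_cyl_sphPt hR, ← Real.rpow_add_one hpos.ne']
  norm_num

/-- The deviation of the potential `U` from that of the Schwarzschild slice,
`-2 log (1 + e^(-t))`. -/
def deviation (R : ℝ) (U : E3 → ℝ) (p : ℝ × ℝ) : ℝ :=
  strip R U p + 2 * Real.log (1 + Real.exp (-p.1))

section
variable {R : ℝ} {U : E3 → ℝ} (hR : 0 < R) (hU : ContDiffOn ℝ ∞ U (exterior R))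
include hR hU

theorem contDiffOn_deviation : ContDiffOn ℝ ∞ (deviation R U) halfStrip := by
  refine (contDiffOn_strip hR hU).add (contDiffOn_const.mul (ContDiffOn.log ?_ fun p _ => ?_))
  · fun_prop
  · have := Real.exp_pos (-p.1); positivity

omit hR hU in
theorem hasDerivAt_schwarzschild (t : ℝ) :
    HasDerivAt (fun t : ℝ => 2 * Real.log (1 + Real.exp (-t))) (-(1 - tau t)) t := by
  have e := (hasDerivAt_neg t).exp
  have hp : 1 + Real.exp (-t) ≠ 0 := by positivity
  refine (((e.const_add 1).log hp).const_mul 2).congr_deriv ?_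
  unfold tau; field_simp; ring

omit hR hU in
theorem hasDerivAt_tau (t : ℝ) : HasDerivAt tau (1 / 2 * (1 - tau t ^ 2)) t := by
  have e := (hasDerivAt_neg t).exp
  have hp : 1 + Real.exp (-t) ≠ 0 := by positivity
  refine ((e.const_sub 1).div (e.const_add 1) hp).congr_deriv ?_
  unfold tau; field_simp; ring

theorem dT_deviation {t θ : ℝ} (ht : 0 ≤ t) :
    dT (deviation R U) (t, θ) = dT (strip R U) (t, θ) - (1 - tau t) := by
  have h1 := hasDerivWithinAt_dT (contDiffOn_deviation hR hU) (θ := θ) ht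
  have h2 := (hasDerivWithinAt_dT (contDiffOn_strip hR hU) (θ := θ) ht).add
    (hasDerivAt_schwarzschild t).hasDerivWithinAt
  exact (uniqueDiffOn_Ici (0 : ℝ) t ht).eq_deriv _ h1 h2

theorem dTh_deviation {t θ : ℝ} (ht : 0 ≤ t) :
    dTh (deviation R U) (t, θ) = dTh (strip R U) (t, θ) :=
  have hs : ContDiffOn ℝ ∞ (strip R U) halfStrip := contDiffOn_strip hR hU
  dTh_eq_of_hasDerivAt (contDiffOn_deviation hR hU) ht
    ((hasDerivAt_dTh hs ht).add_const (2 * Real.log (1 + Real.exp (-t))))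

/-- The scalar curvature expression, written in terms of the deviation: the Schwarzschild
potential solves the equation. -/
theorem bulk_deviation {a : ℝ × ℝ → ℝ} {t θ : ℝ} (ht : 0 < t) :
    bulk (deviation R U) a (t, θ) =
      Real.sin θ * (dT (dT (strip R U)) (t, θ) + dTh (dTh (strip R U)) (t, θ)
        + dT (strip R U) (t, θ)) + Real.cos θ * dTh (strip R U) (t, θ)
      - 1 / 2 * Real.sin θ * (dT (dT a) (t, θ) + dTh (dTh a) (t, θ))
      - 1 / 2 * Real.sin θ * (dT (strip R U) (t, θ) ^ 2 + dTh (strip R U) (t, θ) ^ 2) := by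
  have hs : ContDiffOn ℝ ∞ (strip R U) halfStrip := contDiffOn_strip hR hU
  have hd := contDiffOn_deviation hR hU
  have e1 : dT (dT (deviation R U)) (t, θ) =
      dT (dT (strip R U)) (t, θ) + 1 / 2 * (1 - tau t ^ 2) := by
    apply dT_eq_of_hasDerivAt (contDiffOn_dT hd) ht
    have := (hasDerivAt_dT (contDiffOn_dT hs) (θ := θ) ht).sub
      ((hasDerivAt_tau t).const_sub 1)
    refine (this.congr_of_eventuallyEq ?_).congr_deriv (by ring)
    filter_upwards [eventually_gt_nhds ht] with s hs using dT_deviation hR hU (le_of_lt hs)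
  have e2 : dTh (dTh (deviation R U)) (t, θ) = dTh (dTh (strip R U)) (t, θ) := by
    apply dTh_eq_of_hasDerivAt (contDiffOn_dTh hd) ht.le
    refine (hasDerivAt_dTh (contDiffOn_dTh hs) ht.le).congr_of_eventuallyEq ?_
    exact Eventually.of_forall fun s => dTh_deviation hR hU ht.le
  rw [bulk, e1, e2, dT_deviation hR hU ht.le, dTh_deviation hR hU ht.le]
  ring

omit hU in
theorem expDecay_deviation {l : ℕ} (h : IsLittleOrder l (-1 / 2) U) :
    ExpDecay (deviation R U) := by
  obtain ⟨C, T, hC⟩ := h.expDecay hR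
  refine ⟨C + 2, max T 0, fun t ht θ => ?_⟩
  have h1 := hC t ((le_max_left _ _).trans ht) θ
  have t0 : 0 ≤ t := (le_max_right _ _).trans ht
  have h2 : Real.log (1 + Real.exp (-t)) ≤ Real.exp (-t) := by
    have := Real.log_le_sub_one_of_pos (x := 1 + Real.exp (-t)) (by positivity)
    linarith
  have h3 : 0 ≤ Real.log (1 + Real.exp (-t)) := Real.log_nonneg (by linarith [Real.exp_pos (-t)])
  have h4 : Real.exp (-t) ≤ Real.exp (-(1 / 2) * t) := Real.exp_le_exp.2 (by linarith)
  rw [deviation]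
  refine (abs_add_le _ _).trans ?_
  rw [abs_of_nonneg (by positivity : 0 ≤ 2 * Real.log (1 + Real.exp (-t)))]
  linarith

theorem expDecay_dT_deviation {l : ℕ} (hl : 1 ≤ l) (h : IsLittleOrder l (-1 / 2) U) :
    ExpDecay (dT (deviation R U)) := by
  obtain ⟨C, T, hC⟩ := h.expDecay_dT hR hl hU
  refine ⟨C + 2, max T 0, fun t ht θ => ?_⟩
  have h1 := hC t ((le_max_left _ _).trans ht) θ
  have t0 : 0 ≤ t := (le_max_right _ _).trans ht
  rw [dT_deviation hR hU t0]
  have he := Real.exp_pos (-t)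
  have h2 : 1 - tau t ≤ 2 * Real.exp (-t) := by
    have : 1 - tau t = 2 * Real.exp (-t) / (1 + Real.exp (-t)) := by unfold tau; field_simp; ring
    rw [this]
    exact div_le_self (by positivity) (by linarith)
  have h3 : 0 ≤ 1 - tau t := by
    have : 1 - tau t = 2 * Real.exp (-t) / (1 + Real.exp (-t)) := by unfold tau; field_simp; ring
    rw [this]; positivity
  have h4 : Real.exp (-t) ≤ Real.exp (-(1 / 2) * t) := Real.exp_le_exp.2 (by linarith)
  refine (abs_sub _ _).trans ?_
  rw [abs_of_nonneg h3]
  linarith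

end

/-! ### The energy inequality and its equality case, in the strip -/

section
variable {m₁ : ℝ} {k : ℕ} {U α B A : E3 → ℝ}

theorem strip_axis {R : ℝ} (hR : 0 < R) (hα : ∀ x ∈ exterior R, rho x = 0 → α x = 0) {t θ : ℝ}
    (ht : 0 ≤ t) (hθ : Real.sin θ = 0) : strip R α (t, θ) = 0 := by
  apply hα _ (cyl_sphPt_mem hR (p := (t, θ)) ht)
  simp [rho, cyl, sphPt, hθ]

/-- The hypotheses of the energy inequality in the strip, for the deviation `V` and the function `a`
corresponding to `α`: smoothness up to the boundary, vanishing of `a` on the axis, the two boundary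
conditions, the curvature inequality, and decay. The constant `c` is the boundary value of
`V - a / 2`. -/
structure StripData (V a : ℝ × ℝ → ℝ) (c : ℝ) : Prop where
  smooth_V : ContDiffOn ℝ ∞ V halfStrip
  smooth_a : ContDiffOn ℝ ∞ a halfStrip
  a_zero : ∀ t ≥ 0, a (t, 0) = 0
  a_pi : ∀ t ≥ 0, a (t, Real.pi) = 0
  bd : ∀ θ ∈ Ioo 0 Real.pi, V (0, θ) - 1 / 2 * a (0, θ) = c
  bd' : ∀ θ ∈ Ioo 0 Real.pi, dT V (0, θ) - 1 / 2 * dT a (0, θ) = 0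
  pos : ∀ t > 0, ∀ θ ∈ Ioo 0 Real.pi, 0 ≤ bulk V a (t, θ)
  decay_V : ExpDecay V
  decay_dV : ExpDecay (dT V)
  decay_a : ExpDecay a
  decay_da : ExpDecay (dT a)

theorem sphPt_mem {R : ℝ} (hR : 0 < R) {t θ : ℝ} (ht : 0 < t) (hθ : θ ∈ Ioo 0 Real.pi) :
    0 < sphPt R (t, θ) 0 ∧ R < cylRadius (sphPt R (t, θ)) := by
  have := Real.sin_pos_of_mem_Ioo hθ
  refine ⟨?_, cylRadius_sphPt_gt hR (p := (t, θ)) ht⟩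
  simp only [sphPt, Matrix.cons_val_zero]; positivity

theorem IsAxisymmetricData.stripData (h : IsAxisymmetricData m₁ k U α B A) (hm : 0 < m₁)
    (hk : 5 ≤ k) (hscal : NonnegScalarCurvature (m₁ / 2) (metric U α B A))
    (hmin : MinimalBoundary (m₁ / 2) (metric U α B A)) {C_H : ℝ}
    (hconst : ∀ x : E3, ‖x‖ = m₁ / 2 → U x - 1 / 2 * α x = C_H) :
    StripData (deviation (m₁ / 2) U) (strip (m₁ / 2) α) (C_H + 2 * Real.log 2) := by
  have hR : 0 < m₁ / 2 := by positivity
  refine ⟨contDiffOn_deviation hR h.smooth_U.smooth, contDiffOn_strip hR h.smooth_α.smooth,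
    fun t ht => strip_axis hR h.α_axis ht Real.sin_zero,
    fun t ht => strip_axis hR h.α_axis ht Real.sin_pi, ?_, ?_, ?_,
    expDecay_deviation hR h.decay_U,
    expDecay_dT_deviation hR h.smooth_U.smooth (by omega) h.decay_U,
    h.decay_α.expDecay hR, h.decay_α.expDecay_dT hR (by omega) h.smooth_α.smooth⟩
  · intro θ _
    have := hconst (cyl (sphPt (m₁ / 2) (0, θ))) (by rw [norm_cyl_sphPt hR]; simp)
    simp only [deviation, strip, neg_zero, Real.exp_zero]
    rw [← this]; norm_num; ring
  · intro θ hθ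
    have := h.dT_of_minimal hm hmin hθ
    rw [dT_deviation hR h.smooth_U.smooth le_rfl]
    simp only [tau, neg_zero, Real.exp_zero]
    linarith
  · intro t ht θ hθ
    rw [bulk_deviation hR h.smooth_U.smooth ht, h.strip_equation hm ht hθ rfl rfl rfl]
    have hs := Real.sin_pos_of_mem_Ioo hθ
    obtain ⟨q0, q1⟩ := sphPt_mem hR ht hθ
    have := hscal _ q0 q1
    positivity

/-- In the rigid case the twist and `α` vanish. The curvature expression is a sum of nonnegative
multiples of `R_g` and of the square of the twist, and it is zero; with `V = 0` this leaves
`α_tt + α_θθ = 0`, and a bounded solution with zero boundary values vanishes. -/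
theorem IsAxisymmetricData.rigid (h : IsAxisymmetricData m₁ k U α B A) (hm : 0 < m₁)
    (hk : 5 ≤ k) (hscal : NonnegScalarCurvature (m₁ / 2) (metric U α B A))
    (hmin : MinimalBoundary (m₁ / 2) (metric U α B A)) {C_H : ℝ}
    (hconst : ∀ x : E3, ‖x‖ = m₁ / 2 → U x - 1 / 2 * α x = C_H) (hc : C_H + 2 * Real.log 2 = 0)
    (hV : ∀ t > 0, ∀ θ ∈ Ioo 0 Real.pi, deviation (m₁ / 2) U (t, θ) = 0) :
    (∀ t > 0, ∀ θ ∈ Ioo 0 Real.pi, twist B A (sphPt (m₁ / 2) (t, θ)) = 0) ∧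
    ∀ t ≥ 0, ∀ θ ∈ Icc 0 Real.pi, strip (m₁ / 2) α (t, θ) = 0 := by
  have hR : 0 < m₁ / 2 := by positivity
  have S := h.stripData hm hk hscal hmin hconst
  rw [hc] at S
  have hVt : ∀ t > 0, ∀ θ ∈ Ioo 0 Real.pi, dT (deviation (m₁ / 2) U) (t, θ) = 0 := by
    intro t ht θ hθ
    apply dT_eq_of_hasDerivAt S.smooth_V ht
    refine (hasDerivAt_const t (0 : ℝ)).congr_of_eventuallyEq ?_
    filter_upwards [eventually_gt_nhds ht] with s hs using hV s hs θ hθ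
  have hVθ : ∀ t > 0, ∀ θ ∈ Ioo 0 Real.pi, dTh (deviation (m₁ / 2) U) (t, θ) = 0 := by
    intro t ht θ hθ
    apply dTh_eq_of_hasDerivAt S.smooth_V ht.le
    refine (hasDerivAt_const θ (0 : ℝ)).congr_of_eventuallyEq ?_
    filter_upwards [isOpen_Ioo.mem_nhds hθ] with s hs using hV t ht s hs
  have hbulk : ∀ t > 0, ∀ θ ∈ Ioo 0 Real.pi,
      bulk (deviation (m₁ / 2) U) (strip (m₁ / 2) α) (t, θ) = 0 := fun t ht θ hθ =>
    bulk_eq_zero S.smooth_V S.smooth_a S.a_zero S.a_pi S.bd S.bd' S.pos S.decay_V S.decay_dV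
      S.decay_a S.decay_da hVt ht hθ
  constructor
  · intro t ht θ hθ
    have e := hbulk t ht θ hθ
    rw [bulk_deviation hR h.smooth_U.smooth ht, h.strip_equation hm ht hθ rfl rfl rfl] at e
    have hs := Real.sin_pos_of_mem_Ioo hθ
    obtain ⟨q0, q1⟩ := sphPt_mem hR ht hθ
    have h0 := hscal _ q0 q1
    by_contra hne
    have : 0 < twist B A (sphPt (m₁ / 2) (t, θ)) ^ 2 := by positivity
    have hr : 0 < m₁ / 2 * Real.exp t := by positivity
    refine absurd e (ne_of_gt ?_)
    positivity
  · have harm : ∀ t > 0, ∀ θ ∈ Ioo 0 Real.pi, dT (dT (strip (m₁ / 2) α)) (t, θ)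
        + dTh (dTh (strip (m₁ / 2) α)) (t, θ) = 0 := by
      intro t ht θ hθ
      have e := hbulk t ht θ hθ
      have e1 : dT (dT (deviation (m₁ / 2) U)) (t, θ) = 0 := by
        apply dT_eq_of_hasDerivAt (contDiffOn_dT S.smooth_V) ht
        refine (hasDerivAt_const t (0 : ℝ)).congr_of_eventuallyEq ?_
        filter_upwards [eventually_gt_nhds ht] with s hs using hVt s hs θ hθ
      have e2 : dTh (dTh (deviation (m₁ / 2) U)) (t, θ) = 0 := by
        apply dTh_eq_of_hasDerivAt (contDiffOn_dTh S.smooth_V) ht.le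
        refine (hasDerivAt_const θ (0 : ℝ)).congr_of_eventuallyEq ?_
        filter_upwards [isOpen_Ioo.mem_nhds hθ] with s hs using hVθ t ht s hs
      have hs := Real.sin_pos_of_mem_Ioo hθ
      simp only [bulk, e1, e2, hVt t ht θ hθ, hVθ t ht θ hθ] at e
      have : Real.sin θ * (dT (dT (strip (m₁ / 2) α)) (t, θ)
        + dTh (dTh (strip (m₁ / 2) α)) (t, θ)) = 0 := by linarith
      exact (mul_eq_zero.1 this).resolve_left hs.ne'
    obtain ⟨C, hC0, hC⟩ := h.decay_α.exists_bound_exterior hR h.smooth_α.smooth.continuousOn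
    have hb : ∀ t > 0, ∀ θ, |strip (m₁ / 2) α (t, θ)| ≤ C * (m₁ / 2) ^ (-1 / 2 : ℝ) := by
      intro t ht θ
      have hx := cyl_sphPt_mem hR (p := (t, θ)) ht.le
      refine (hC _ hx).trans ?_
      have : ‖cyl (sphPt (m₁ / 2) (t, θ))‖ ^ (-1 / 2 : ℝ) ≤ (m₁ / 2) ^ (-1 / 2 : ℝ) :=
        Real.rpow_le_rpow_of_nonpos hR hx (by norm_num)
      gcongr
    have hbd : ∀ θ ∈ Icc 0 Real.pi, strip (m₁ / 2) α (0, θ) = 0 := by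
      have hopen : ∀ θ ∈ Ioo 0 Real.pi, strip (m₁ / 2) α (0, θ) = 0 := by
        intro θ hθ
        have h1 := S.bd θ hθ
        have h2 : deviation (m₁ / 2) U (0, θ) = 0 :=
          eq_zero_of_forall_pos S.smooth_V fun t ht => hV t ht θ hθ
        linarith
      intro θ hθ
      rcases eq_or_lt_of_le hθ.1 with h0 | h0
      · rw [← h0]; exact S.a_zero 0 le_rfl
      · rcases eq_or_lt_of_le hθ.2 with hp | hp
        · rw [hp]; exact S.a_pi 0 le_rfl
        · exact hopen θ ⟨h0, hp⟩
    intro t ht θ hθ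
    refine harmonic_eq_zero S.smooth_a harm (fun t ht => ?_) (fun t ht => ?_) hbd
      (M := (C * (m₁ / 2) ^ (-1 / 2 : ℝ)) ^ 2 * |Real.pi - 0|) (fun t ht => ?_) ht hθ
    · rw [S.a_zero t (le_of_lt ht), zero_mul]
    · rw [S.a_pi t (le_of_lt ht), zero_mul]
    · refine (le_abs_self _).trans ?_
      rw [← Real.norm_eq_abs]
      apply intervalIntegral.norm_integral_le_of_norm_le_const
      intro θ _
      rw [Real.norm_of_nonneg (sq_nonneg _), ← sq_abs]
      gcongr
      exact hb t ht θ

end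

/-! ### Integration of axisymmetric functions in spherical coordinates -/

section
open MeasureTheory
open scoped ENNReal

/-- Splitting off the height above the plane `z = 0` preserves volume. -/
theorem volume_preserving_heightPlane :
    MeasurePreserving (fun x : E3 => (x 2, (x 0, x 1))) := by
  have h1 := PiLp.volume_preserving_ofLp (Fin 3)
  have h2 := volume_preserving_piFinSuccAbove (fun _ : Fin 3 => ℝ) 2
  have h3 := (MeasurePreserving.id (volume : Measure ℝ)).prod (volume_preserving_finTwoArrow ℝ)
  have := h3.comp (h2.comp h1)
  exact this

theorem lintegral_eq_heightPlane {f : E3 → ℝ≥0∞} (hf : Measurable f) :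
    ∫⁻ x, f x = ∫⁻ z : ℝ, ∫⁻ w : ℝ × ℝ, f !₂[w.1, w.2, z] := by
  have hm : Measurable fun p : ℝ × (ℝ × ℝ) => f !₂[p.2.1, p.2.2, p.1] := by
    refine hf.comp ((WithLp.measurable_toLp 2 (Fin 3 → ℝ)).comp (measurable_pi_iff.2 fun i => ?_))
    fin_cases i <;> simp <;> fun_prop
  have h := volume_preserving_heightPlane.lintegral_comp hm
  rw [show (volume : Measure (ℝ × ℝ × ℝ)) = volume.prod volume from rfl,
    lintegral_prod _ hm.aemeasurable] at h
  rw [← h]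
  refine lintegral_congr fun x => congrArg f ?_
  ext i; fin_cases i <;> rfl

/-- Integration of an axisymmetric function in spherical coordinates. -/
theorem lintegral_axisymmetric {f : E3 → ℝ≥0∞} (hf : Measurable f)
    (hrot : ∀ ρ > 0, ∀ z φ : ℝ, f (cyl ![ρ, z, φ]) = f (cyl ![ρ, z, 0])) :
    ∫⁻ x, f x = ENNReal.ofReal (2 * Real.pi) * ∫⁻ r in Ioi (0 : ℝ), ∫⁻ θ in Ioo 0 Real.pi,
      ENNReal.ofReal (r ^ 2 * Real.sin θ) * f (cyl ![r * Real.sin θ, r * Real.cos θ, 0]) := by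
  have hcyl : Measurable fun p : ℝ × ℝ => f (cyl ![p.2, p.1, 0]) := by
    refine hf.comp (contDiff_cyl.continuous.measurable.comp (measurable_pi_iff.2 fun i => ?_))
    fin_cases i <;> simp <;> fun_prop
  have inner : ∀ z : ℝ, ∫⁻ w : ℝ × ℝ, f !₂[w.1, w.2, z] =
      ENNReal.ofReal (2 * Real.pi) *
        ∫⁻ ρ in Ioi (0 : ℝ), ENNReal.ofReal ρ * f (cyl ![ρ, z, 0]) := by
    intro z
    have hz : Measurable fun ρ : ℝ => ENNReal.ofReal ρ * f (cyl ![ρ, z, 0]) :=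
      ENNReal.measurable_ofReal.mul (hcyl.comp (measurable_const.prodMk measurable_id))
    rw [← lintegral_comp_polarCoord_symm]
    have : ∫⁻ p in polarCoord.target, ENNReal.ofReal p.1 •
        f !₂[(polarCoord.symm p).1, (polarCoord.symm p).2, z] =
        ∫⁻ p in Ioi (0 : ℝ) ×ˢ Ioo (-Real.pi) Real.pi, ENNReal.ofReal p.1 * f (cyl ![p.1, z, 0]) := by
      refine setLIntegral_congr_fun (measurableSet_Ioi.prod measurableSet_Ioo) fun p hp => ?_
      simp only [smul_eq_mul]
      congr 1
      exact hrot p.1 hp.1 z p.2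
    rw [this, show (volume : Measure (ℝ × ℝ)) = volume.prod volume from rfl,
      ← Measure.prod_restrict, lintegral_prod (fun p : ℝ × ℝ => ENNReal.ofReal p.1 * f (cyl ![p.1, z, 0]))
        (hz.comp measurable_fst).aemeasurable]
    simp only [lintegral_const, Measure.restrict_apply MeasurableSet.univ, univ_inter,
      Real.volume_Ioo, sub_neg_eq_add]
    rw [lintegral_mul_const _ hz, mul_comm, ← two_mul]
  rw [lintegral_eq_heightPlane hf]
  simp only [inner]
  -- the half-plane of pairs `(z, ρ)`, `ρ > 0`, in polar coordinates
  have hG : Measurable (({p : ℝ × ℝ | 0 < p.2}).indicator fun p =>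
      ENNReal.ofReal p.2 * f (cyl ![p.2, p.1, 0])) :=
    ((ENNReal.measurable_ofReal.comp measurable_snd).mul hcyl).indicator
      (measurableSet_lt measurable_const measurable_snd)
  have hH : Measurable fun p : ℝ × ℝ => ENNReal.ofReal (p.1 ^ 2 * Real.sin p.2) *
      f (cyl ![p.1 * Real.sin p.2, p.1 * Real.cos p.2, 0]) := by
    refine (ENNReal.measurable_ofReal.comp (by fun_prop)).mul
      (hcyl.comp (f := fun p : ℝ × ℝ => (p.1 * Real.cos p.2, p.1 * Real.sin p.2)) (by fun_prop))
  rw [lintegral_const_mul']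
  swap; · exact ENNReal.ofReal_ne_top
  congr 1
  have e1 : ∫⁻ z : ℝ, ∫⁻ ρ in Ioi (0 : ℝ), ENNReal.ofReal ρ * f (cyl ![ρ, z, 0]) =
      ∫⁻ p : ℝ × ℝ, ({p : ℝ × ℝ | 0 < p.2}).indicator (fun p =>
      ENNReal.ofReal p.2 * f (cyl ![p.2, p.1, 0])) p := by
    rw [show (volume : Measure (ℝ × ℝ)) = volume.prod volume from rfl,
      lintegral_prod _ hG.aemeasurable]
    refine lintegral_congr fun z => ?_
    rw [← lintegral_indicator measurableSet_Ioi]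
    rfl
  rw [e1, ← lintegral_comp_polarCoord_symm]
  have e2 : ∫⁻ p in polarCoord.target, ENNReal.ofReal p.1 • ({p : ℝ × ℝ | 0 < p.2}).indicator (fun p =>
      ENNReal.ofReal p.2 * f (cyl ![p.2, p.1, 0])) (polarCoord.symm p) =
      ∫⁻ p in Ioi (0 : ℝ) ×ˢ Ioo 0 Real.pi, ENNReal.ofReal (p.1 ^ 2 * Real.sin p.2) *
      f (cyl ![p.1 * Real.sin p.2, p.1 * Real.cos p.2, 0]) := by
    have hsub : Ioi (0 : ℝ) ×ˢ Ioo 0 Real.pi ⊆ polarCoord.target := by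
      rintro p ⟨h1, h2, h3⟩
      exact ⟨h1, by linarith [Real.pi_pos], h3⟩
    rw [← lintegral_indicator polarCoord.open_target.measurableSet,
      ← lintegral_indicator (measurableSet_Ioi.prod measurableSet_Ioo)]
    refine lintegral_congr fun p => ?_
    by_cases hp : p ∈ Ioi (0 : ℝ) ×ˢ Ioo 0 Real.pi
    · have h1 : 0 < p.1 := hp.1
      have h2 := Real.sin_pos_of_mem_Ioo hp.2
      rw [indicator_of_mem hp, indicator_of_mem (hsub hp), polarCoord_symm_apply,
        indicator_of_mem (show (p.1 * Real.cos p.2, p.1 * Real.sin p.2) ∈ {p : ℝ × ℝ | 0 < p.2} from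
          mul_pos h1 h2), smul_eq_mul, ← mul_assoc, ← ENNReal.ofReal_mul h1.le]
      ring_nf
    · rw [indicator_of_notMem hp]
      by_cases hp' : p ∈ polarCoord.target
      · have h1 : 0 < p.1 := hp'.1
        have h2 : Real.sin p.2 ≤ 0 := by
          apply Real.sin_nonpos_of_nonpos_of_neg_pi_le _ hp'.2.1.le
          by_contra! h
          exact hp ⟨h1, h, hp'.2.2⟩
        rw [indicator_of_mem hp', polarCoord_symm_apply, indicator_of_notMem, smul_zero]
        exact not_lt.2 (mul_nonpos_of_nonneg_of_nonpos h1.le h2)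
      · rw [indicator_of_notMem hp']
  rw [e2, show (volume : Measure (ℝ × ℝ)) = volume.prod volume from rfl,
      ← Measure.prod_restrict, lintegral_prod _ hH.aemeasurable]

end

/-! ### The Dirichlet energy in the strip -/

section
open MeasureTheory
open scoped ENNReal

theorem isOpen_openExterior (R : ℝ) : IsOpen (openExterior R) :=
  isOpen_lt continuous_const continuous_norm

theorem norm_gradient (f : E3 → ℝ) (x : E3) : ‖gradient f x‖ = ‖fderiv ℝ f x‖ := by
  simp [gradient]

theorem measurable_norm_gradient (f : E3 → ℝ) : Measurable fun x => ‖gradient f x‖ := by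
  simp only [norm_gradient]
  exact (measurable_fderiv ℝ f).norm

theorem fderiv_cyl_apply (q : Fin 3 → ℝ) (i : Fin 3) :
    fderiv ℝ cyl q (Pi.single i 1) = cylFrame q i := by
  have h : HasFDerivAt cyl (fderiv ℝ cyl q) q :=
    (contDiff_cyl.differentiable (by simp) q).hasFDerivAt
  have hline : HasDerivAt (fun s : ℝ => q + s • (Pi.single i 1 : Fin 3 → ℝ)) (Pi.single i 1) 0 := by
    simpa using ((hasDerivAt_id (0 : ℝ)).smul_const (Pi.single i 1 : Fin 3 → ℝ)).const_add q
  have h' : HasFDerivAt cyl (fderiv ℝ cyl q) (q + (0 : ℝ) • (Pi.single i 1 : Fin 3 → ℝ)) := by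
    simpa using h
  have h1 := h'.comp_hasDerivAt 0 hline
  have c0 : ∀ j, HasDerivAt (fun s : ℝ => (q + s • (Pi.single i 1 : Fin 3 → ℝ)) j)
      ((Pi.single i 1 : Fin 3 → ℝ) j) 0 := hasDerivAt_pi.1 hline
  have h2 : HasDerivAt (fun s : ℝ => cyl (q + s • (Pi.single i 1 : Fin 3 → ℝ))) (cylFrame q i) 0 := by
    have key : HasDerivAt (fun s : ℝ => fun j => cyl (q + s • (Pi.single i 1 : Fin 3 → ℝ)) j)
        (fun j => cylFrame q i j) 0 := by
      rw [hasDerivAt_pi]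
      intro j
      have e0 := (c0 0).mul (c0 2).cos
      have e1 := (c0 0).mul (c0 2).sin
      have e2 := c0 1
      fin_cases j
      · refine e0.congr_deriv ?_
        fin_cases i <;> simp [cylFrame]
      · refine e1.congr_deriv ?_
        fin_cases i <;> simp [cylFrame]
      · refine e2.congr_deriv ?_
        fin_cases i <;> simp [cylFrame]
    exact (PiLp.hasFDerivAt_toLp 2 (𝕜 := ℝ) _).comp_hasDerivAt (0 : ℝ) key
  exact h1.unique h2

theorem pd_comp_cyl {f : E3 → ℝ} {q : Fin 3 → ℝ} (hf : DifferentiableAt ℝ f (cyl q)) (i : Fin 3) :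
    pd i (fun q => f (cyl q)) q = fderiv ℝ f (cyl q) (cylFrame q i) := by
  rw [pd, ← fderiv_cyl_apply]
  have : (fun q => f (cyl q)) = f ∘ cyl := rfl
  rw [this, fderiv_comp _ hf (contDiff_cyl.differentiable (by simp) q)]
  rfl

theorem norm_gradient_sq {f : E3 → ℝ} {q : Fin 3 → ℝ} (hq : 0 < q 0)
    (hf : DifferentiableAt ℝ f (cyl q)) :
    ‖gradient f (cyl q)‖ ^ 2 = pd 0 (fun q => f (cyl q)) q ^ 2 + pd 1 (fun q => f (cyl q)) q ^ 2
      + (pd 2 (fun q => f (cyl q)) q / q 0) ^ 2 := by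
  simp only [pd_comp_cyl hf]
  have hv : ∀ v : E3, fderiv ℝ f (cyl q) v = ∑ i, gradient f (cyl q) i * v i := by
    intro v
    rw [← inner_gradient_left, PiLp.inner_apply]
    simp [mul_comm]
  simp only [hv]
  rw [EuclideanSpace.norm_eq, Real.sq_sqrt (Finset.sum_nonneg fun _ _ => by positivity)]
  simp only [Fin.sum_univ_three, Real.norm_eq_abs, sq_abs]
  set a := gradient f (cyl q) 0
  set b := gradient f (cyl q) 1
  set c := gradient f (cyl q) 2
  simp [cylFrame]
  have : (-(a * (q 0 * Real.sin (q 2))) + b * (q 0 * Real.cos (q 2))) / q 0 =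
      -(a * Real.sin (q 2)) + b * Real.cos (q 2) := by
    rw [div_eq_iff hq.ne']; ring
  rw [this]
  linear_combination (-(a ^ 2) - b ^ 2) * Real.sin_sq_add_cos_sq (q 2)

section
variable {R : ℝ} {f : E3 → ℝ}

theorem SmoothAxisymmetric.differentiableAt (hf : SmoothAxisymmetric R f) {x : E3}
    (hx : R < ‖x‖) : DifferentiableAt ℝ f x :=
  (hf.smooth.contDiffAt (exterior_mem_nhds hx)).differentiableAt (by simp)

theorem SmoothAxisymmetric.pd_rot (hf : SmoothAxisymmetric R f) {q : Fin 3 → ℝ}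
    (hr : R < cylRadius q) (s : ℝ) (i : Fin 3) :
    pd i (fun q => f (cyl q)) (q + s • (Pi.single 2 1 : Fin 3 → ℝ)) =
      pd i (fun q => f (cyl q)) q := by
  rw [pd, pd, ← fderiv_comp_add_right (f := fun q => f (cyl q))]
  congr 1
  apply Filter.EventuallyEq.fderiv_eq
  filter_upwards [(isOpen_openChart R).mem_nhds hr] with p hp
  exact hf.comp_cyl_add (le_of_lt hp) s

theorem SmoothAxisymmetric.norm_gradient_rot (hf : SmoothAxisymmetric R f) {q : Fin 3 → ℝ}
    (hq : 0 < q 0) (hr : R < cylRadius q) (s : ℝ) :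
    ‖gradient f (cyl (q + s • Pi.single 2 1))‖ = ‖gradient f (cyl q)‖ := by
  have h0 : (q + s • (Pi.single 2 1 : Fin 3 → ℝ)) 0 = q 0 := by simp
  have hr' : R < cylRadius (q + s • (Pi.single 2 1 : Fin 3 → ℝ)) := by rwa [cylRadius_add_single]
  rw [← sq_eq_sq₀ (norm_nonneg _) (norm_nonneg _), norm_gradient_sq (by rw [h0]; exact hq)
    (hf.differentiableAt (by rw [norm_cyl]; exact hr')), norm_gradient_sq hq
    (hf.differentiableAt (by rw [norm_cyl]; exact hr))]
  simp only [hf.pd_rot hr, h0]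

/-- The coordinates `(t, θ)` are conformal in the half-planes `φ = const`, with factor `R e^t = r`. -/
theorem SmoothAxisymmetric.norm_gradient_strip (hR : 0 < R) (hf : SmoothAxisymmetric R f) {t θ : ℝ}
    (ht : 0 < t) (hθ : θ ∈ Ioo 0 Real.pi) :
    (R * Real.exp t) ^ 2 * ‖gradient f (cyl (sphPt R (t, θ)))‖ ^ 2 =
      dT (strip R f) (t, θ) ^ 2 + dTh (strip R f) (t, θ) ^ 2 := by
  obtain ⟨q0, q1⟩ := sphPt_mem hR ht hθ
  have hg : ContDiffOn ℝ ∞ (fun q => f (cyl q)) (openChart R) :=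
    (contDiffOn_comp_cyl hf.smooth).mono fun q (hq : R < cylRadius q) => hq.le
  have hs : ContDiffOn ℝ ∞ (fun p => (fun q => f (cyl q)) (sphPt R p)) halfStrip :=
    contDiffOn_strip hR hf.smooth
  rw [norm_gradient_sq q0 (hf.differentiableAt (by rw [norm_cyl]; exact q1)),
    pd_two_eq_zero hf q1.le]
  have e1 : dT (strip R f) (t, θ) = _ := dT_comp_sphPt hR hs hg ht
  have e2 : dTh (strip R f) (t, θ) = _ := dTh_comp_sphPt hR hs hg ht
  rw [e1, e2]
  have hr : (R * Real.exp t) ^ 2 = sphPt R (t, θ) 0 ^ 2 + sphPt R (t, θ) 1 ^ 2 := by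
    simp only [sphPt, Matrix.cons_val_zero, Matrix.cons_val_one]
    linear_combination -(R * Real.exp t) ^ 2 * Real.sin_sq_add_cos_sq θ
  rw [hr]; ring

/-- The density `½ Φ_* |∇f|²` of the energy of `f`. -/
def energyDensity (R : ℝ) (f : E3 → ℝ) (x : E3) : ℝ :=
  1 / 2 * (1 - R ^ 2 / ‖x‖ ^ 2) * ‖gradient f x‖ ^ 2

theorem energyDensity_nonneg (hR : 0 < R) {x : E3} (hx : R < ‖x‖) : 0 ≤ energyDensity R f x := by
  have : R ^ 2 / ‖x‖ ^ 2 ≤ 1 := by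
    rw [div_le_one (by have := hR.trans hx; positivity)]
    gcongr
  have : 0 ≤ 1 - R ^ 2 / ‖x‖ ^ 2 := by linarith
  unfold energyDensity; positivity

theorem measurable_energyDensity : Measurable (energyDensity R f) := by
  have := measurable_norm_gradient f
  unfold energyDensity
  fun_prop

/-- The energy in the coordinates `t = log (r / R)` and `θ`, with a radial weight `w`. -/
theorem SmoothAxisymmetric.lintegral_energyDensity (hR : 0 < R) (hf : SmoothAxisymmetric R f)
    {w : ℝ → ℝ≥0∞} (hw : Measurable w) (hw' : ∀ r, w r ≠ ⊤) :
    ∫⁻ x in openExterior R, w ‖x‖ * ENNReal.ofReal (energyDensity R f x) =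
      ENNReal.ofReal (2 * Real.pi) * ∫⁻ t in Ioi (0 : ℝ), w (R * Real.exp t) *
        ∫⁻ θ in Ioo 0 Real.pi, ENNReal.ofReal (R * (Real.sinh t * Real.sin θ *
          (dT (strip R f) (t, θ) ^ 2 + dTh (strip R f) (t, θ) ^ 2))) := by
  have hmeas : Measurable ((openExterior R).indicator fun x =>
      w ‖x‖ * ENNReal.ofReal (energyDensity R f x)) :=
    ((hw.comp measurable_norm).mul
      (ENNReal.measurable_ofReal.comp measurable_energyDensity)).indicator
      (isOpen_openExterior R).measurableSet
  rw [← lintegral_indicator (isOpen_openExterior R).measurableSet, lintegral_axisymmetric hmeas]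
  · congr 1
    -- substitute `r = R e^t`
    have hderiv : ∀ t ∈ Ioi (0 : ℝ), HasDerivWithinAt (fun t => R * Real.exp t) (R * Real.exp t)
      (Ioi 0) t := fun t _ => ((Real.hasDerivAt_exp t).const_mul R).hasDerivWithinAt
    have hinj : InjOn (fun t => R * Real.exp t) (Ioi 0) := by
      intro a _ b _ hab
      exact Real.exp_injective (mul_left_cancel₀ hR.ne' hab)
    have himage : (fun t => R * Real.exp t) '' Ioi 0 = Ioi R := by
      ext r
      constructor
      · rintro ⟨t, ht, rfl⟩
        have := Real.one_lt_exp_iff.2 ht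
        change R < R * Real.exp t
        nlinarith
      · intro hr
        have hr' : 1 < r / R := by rwa [lt_div_iff₀ hR, one_mul]
        refine ⟨Real.log (r / R), Real.log_pos hr', ?_⟩
        simp only
        rw [Real.exp_log (by linarith)]; field_simp
    have hsplit : ∫⁻ r in Ioi (0 : ℝ), ∫⁻ θ in Ioo 0 Real.pi, ENNReal.ofReal (r ^ 2 * Real.sin θ) *
        (openExterior R).indicator (fun x => w ‖x‖ * ENNReal.ofReal (energyDensity R f x))
          (cyl ![r * Real.sin θ, r * Real.cos θ, 0]) =
        ∫⁻ r in Ioi R, ∫⁻ θ in Ioo 0 Real.pi, ENNReal.ofReal (r ^ 2 * Real.sin θ) *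
        (w r * ENNReal.ofReal (energyDensity R f (cyl ![r * Real.sin θ, r * Real.cos θ, 0]))) := by
      rw [← lintegral_indicator measurableSet_Ioi, ← lintegral_indicator measurableSet_Ioi]
      refine lintegral_congr fun r => ?_
      by_cases hr0 : 0 < r
      · have hn : ∀ θ, ‖cyl ![r * Real.sin θ, r * Real.cos θ, 0]‖ = r := by
          intro θ
          rw [norm_cyl, cylRadius]
          simp only [Matrix.cons_val_zero, Matrix.cons_val_one]
          rw [show (r * Real.sin θ) ^ 2 + (r * Real.cos θ) ^ 2 = r ^ 2 by
            linear_combination r ^ 2 * Real.sin_sq_add_cos_sq θ, Real.sqrt_sq hr0.le]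
        rw [indicator_of_mem (show r ∈ Ioi (0 : ℝ) from hr0)]
        by_cases hr : R < r
        · rw [indicator_of_mem (show r ∈ Ioi R from hr)]
          refine lintegral_congr fun θ => ?_
          rw [indicator_of_mem (show _ ∈ openExterior R from by change R < ‖_‖; rw [hn]; exact hr), hn]
        · rw [indicator_of_notMem (show r ∉ Ioi R from hr)]
          refine (lintegral_congr fun θ => ?_).trans lintegral_zero
          rw [indicator_of_notMem, mul_zero]
          intro h
          exact hr ((hn θ) ▸ h)
      · rw [indicator_of_notMem (show r ∉ Ioi (0 : ℝ) from hr0),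
          indicator_of_notMem (show r ∉ Ioi R from fun h => hr0 (hR.trans h))]
    rw [hsplit, ← himage, lintegral_image_eq_lintegral_abs_deriv_mul measurableSet_Ioi hderiv hinj]
    refine setLIntegral_congr_fun measurableSet_Ioi fun t ht => ?_
    have ht : 0 < t := ht
    have hr : 0 < R * Real.exp t := by positivity
    have hr' : 1 ≤ Real.exp t := Real.one_le_exp ht.le
    rw [← lintegral_const_mul' _ _ ENNReal.ofReal_ne_top, ← lintegral_const_mul' _ _ (hw' _)]
    refine setLIntegral_congr_fun measurableSet_Ioo fun θ hθ => ?_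
    have hn : ‖cyl (sphPt R (t, θ))‖ = R * Real.exp t := norm_cyl_sphPt hR (t, θ)
    have hgrad := hf.norm_gradient_strip hR ht hθ
    have hpt : (![R * Real.exp t * Real.sin θ, R * Real.exp t * Real.cos θ, 0] : Fin 3 → ℝ) =
      sphPt R (t, θ) := rfl
    have hsin := Real.sin_pos_of_mem_Ioo hθ
    rw [hpt, mul_left_comm (ENNReal.ofReal _) (w _), mul_left_comm (ENNReal.ofReal _) (w _),
      ← ENNReal.ofReal_mul (by positivity), ← ENNReal.ofReal_mul (by positivity), ← hgrad,
      energyDensity, hn, abs_of_pos hr, Real.sinh_eq, Real.exp_neg]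
    congr 2
    field_simp
  · intro ρ hρ z φ
    have e : (![ρ, z, φ] : Fin 3 → ℝ) = ![ρ, z, 0] + φ • Pi.single 2 1 := by
      ext i; fin_cases i <;> simp
    have hn : ‖cyl ![ρ, z, φ]‖ = ‖cyl ![ρ, z, 0]‖ := by
      rw [e, norm_cyl, cylRadius_add_single, norm_cyl]
    by_cases hx : R < ‖cyl ![ρ, z, 0]‖
    · rw [indicator_of_mem (show _ ∈ openExterior R from hx),
        indicator_of_mem (show cyl ![ρ, z, φ] ∈ openExterior R from by
          change R < ‖_‖; rw [hn]; exact hx)]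
      have hg := hf.norm_gradient_rot (q := ![ρ, z, 0]) hρ (by rwa [norm_cyl] at hx) φ
      rw [← e] at hg
      simp only [energyDensity, hn, hg]
    · rw [indicator_of_notMem (show _ ∉ openExterior R from hx),
        indicator_of_notMem (show cyl ![ρ, z, φ] ∉ openExterior R from fun h => hx (hn ▸ h))]

end

end

/-! ### Square integrability of `∇U` -/

section
open MeasureTheory
open scoped ENNReal

theorem volume_axis : volume {x : E3 | rho x = 0} = 0 := by
  set L : E3 →ₗ[ℝ] ℝ := ((EuclideanSpace.proj (0 : Fin 3) : E3 →L[ℝ] ℝ) : E3 →ₗ[ℝ] ℝ)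
  have hsub : {x : E3 | rho x = 0} ⊆ (LinearMap.ker L : Set E3) := by
    intro x (hx : rho x = 0)
    rw [rho, Real.sqrt_eq_zero (by positivity)] at hx
    have : x 0 = 0 := by nlinarith [sq_nonneg (x 0), sq_nonneg (x 1)]
    exact this
  refine measure_mono_null hsub (Measure.addHaar_submodule _ _ ?_)
  intro h
  have : (EuclideanSpace.single 0 1 : E3) ∈ LinearMap.ker L := h ▸ Submodule.mem_top
  have h1 : (EuclideanSpace.single 0 1 : E3) 0 = 0 := this
  simp at h1

/-- Every point off the axis is in the range of the cylindrical chart. -/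
theorem exists_cyl_eq {x : E3} (hx : rho x ≠ 0) : ∃ q : Fin 3 → ℝ, 0 < q 0 ∧ cyl q = x := by
  have hpos : 0 < rho x := lt_of_le_of_ne (Real.sqrt_nonneg _) (Ne.symm hx)
  set w : ℂ := ⟨x 0, x 1⟩
  have hw : ‖w‖ = rho x := by
    rw [Complex.norm_def, Complex.normSq_mk, rho]; ring_nf
  refine ⟨![rho x, x 2, w.arg], hpos, ?_⟩
  ext i
  fin_cases i
  · simpa [cyl, hw] using Complex.norm_mul_cos_arg w
  · simpa [cyl, hw] using Complex.norm_mul_sin_arg w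
  · rfl

theorem isBilinear_metric (U α B A : E3 → ℝ) (x v w : E3) : metric U α B A x v w =
    ∑ i, ∑ j, v i * w j * metric U α B A x (EuclideanSpace.single i 1) (EuclideanSpace.single j 1) := by
  simp only [metric, connForm, dRho, dPhi, Fin.sum_univ_three]
  simp
  ring

section
variable {m₁ : ℝ} {k : ℕ} {U α B A : E3 → ℝ}

theorem differentiableAt_rho {x : E3} (hx : rho x ≠ 0) : DifferentiableAt ℝ rho x := by
  have : x 0 ^ 2 + x 1 ^ 2 ≠ 0 := by
    intro h; rw [rho, h, Real.sqrt_zero] at hx; exact hx rfl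
  unfold rho
  have h0 : DifferentiableAt ℝ (fun x : E3 => x 0 ^ 2 + x 1 ^ 2) x := by fun_prop
  exact h0.sqrt this

theorem IsAxisymmetricData.differentiableAt_metric (h : IsAxisymmetricData m₁ k U α B A) {x : E3}
    (hx : m₁ / 2 < ‖x‖) (hρ : rho x ≠ 0) (v w : E3) :
    DifferentiableAt ℝ (fun y => metric U α B A y v w) x := by
  have hU := h.smooth_U.differentiableAt hx
  have hα := h.smooth_α.differentiableAt hx
  have hB := h.smooth_B.differentiableAt hx
  have hA := h.smooth_A.differentiableAt hx
  have hr := differentiableAt_rho hρ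
  have dr : ∀ v, DifferentiableAt ℝ (fun y => dRho y v) x := fun v => by
    have hn : DifferentiableAt ℝ (fun y : E3 => y 0 * v 0 + y 1 * v 1) x := by fun_prop
    exact (hn.mul (hr.fun_inv hρ)).congr_of_eventuallyEq
      (Eventually.of_forall fun y => div_eq_mul_inv _ _)
  have dp : ∀ v, DifferentiableAt ℝ (fun y => dPhi y v) x := fun v => by
    have hn : DifferentiableAt ℝ (fun y : E3 => y 0 * v 1 - y 1 * v 0) x := by fun_prop
    exact (hn.mul ((hr.fun_pow 2).fun_inv (pow_ne_zero 2 hρ))).congr_of_eventuallyEq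
      (Eventually.of_forall fun y => div_eq_mul_inv _ _)
  have dc : ∀ v, DifferentiableAt ℝ (fun y => connForm B A y v) x := fun v =>
    ((dp v).add ((hr.mul hB).mul (dr v))).add (hA.mul_const _)
  unfold metric
  exact ((((hU.const_mul _).add (hα.const_mul _)).exp).mul
    (((dr v).mul (dr w)).add (differentiableAt_const _))).add
    (((hr.pow 2).mul (hU.const_mul _).exp).mul ((dc v).mul (dc w)))

/-- The sum of the absolute values of the first derivatives of the Cartesian components. -/
def metricDeriv (U α B A : E3 → ℝ) (x : E3) : ℝ :=
  ∑ i : Fin 3, ∑ j : Fin 3, ∑ l : Fin 3, |fderiv ℝ (fun y : E3 => metric U α B A y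
    (EuclideanSpace.single i 1) (EuclideanSpace.single j 1)) x (EuclideanSpace.single l 1)|

/-- Since `e^(-2U)` is the square of the length of the unit vector tangent to the orbits of the
rotations, which is constant along the half-planes `φ = const`, the derivatives of `U` are
controlled by those of the Cartesian components of the metric. -/
theorem IsAxisymmetricData.norm_gradient_le (h : IsAxisymmetricData m₁ k U α B A) {x : E3}
    (hx : m₁ / 2 < ‖x‖) (hρ : rho x ≠ 0) :
    ‖gradient U x‖ ≤ Real.exp (2 * U x) * metricDeriv U α B A x := by
  obtain ⟨q, hq, rfl⟩ := exists_cyl_eq hρ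
  set u : E3 := !₂[-Real.sin (q 2), Real.cos (q 2), 0] with hu
  have hUd := h.smooth_U.differentiableAt hx
  -- the derivative of `e^(-2U)` along the half-plane
  have key : ∀ i : Fin 3, i ≠ 2 → |pd i (fun q => U (cyl q)) q| ≤
      1 / 2 * Real.exp (2 * U (cyl q)) * metricDeriv U α B A (cyl q) := by
    intro i hi
    set v := cylFrame q i
    have hline : HasDerivAt (fun s : ℝ => cyl (q + s • (Pi.single i 1 : Fin 3 → ℝ))) v 0 := by
      have h0 : HasDerivAt (fun s : ℝ => q + s • (Pi.single i 1 : Fin 3 → ℝ)) (Pi.single i 1) 0 := by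
        simpa using ((hasDerivAt_id (0 : ℝ)).smul_const (Pi.single i 1 : Fin 3 → ℝ)).const_add q
      have h1 : HasFDerivAt cyl (fderiv ℝ cyl q) (q + (0 : ℝ) • (Pi.single i 1 : Fin 3 → ℝ)) := by
        simpa using (contDiff_cyl.differentiable (by simp) q).hasFDerivAt
      exact (h1.comp_hasDerivAt 0 h0).congr_deriv (fderiv_cyl_apply q i)
    have hq2 : ∀ s : ℝ, (q + s • (Pi.single i 1 : Fin 3 → ℝ)) 2 = q 2 := by
      intro s; simp [Pi.single_eq_of_ne (Ne.symm hi)]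
    have hbase : cyl (q + (0 : ℝ) • (Pi.single i 1 : Fin 3 → ℝ)) = cyl q := by simp
    have d1 : HasDerivAt (fun s : ℝ => Real.exp (-2 * U (cyl (q + s • (Pi.single i 1 : Fin 3 → ℝ)))))
        (Real.exp (-2 * U (cyl q)) * (-2 * fderiv ℝ U (cyl q) v)) 0 := by
      have hU' : HasFDerivAt U (fderiv ℝ U (cyl q)) (cyl (q + (0 : ℝ) • (Pi.single i 1 : Fin 3 → ℝ))) := by
        rw [hbase]; exact hUd.hasFDerivAt
      have := ((hU'.comp_hasDerivAt 0 hline).const_mul (-2)).exp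
      simpa [hbase] using this
    have d2 : HasDerivAt (fun s : ℝ => metric U α B A (cyl (q + s • (Pi.single i 1 : Fin 3 → ℝ))) u u)
        (fderiv ℝ (fun y => metric U α B A y u u) (cyl q) v) 0 := by
      have hm : HasFDerivAt (fun y => metric U α B A y u u)
          (fderiv ℝ (fun y => metric U α B A y u u) (cyl q))
          (cyl (q + (0 : ℝ) • (Pi.single i 1 : Fin 3 → ℝ))) := by
        rw [hbase]; exact (h.differentiableAt_metric hx hρ u u).hasFDerivAt
      exact hm.comp_hasDerivAt 0 hline
    have hpos : ∀ᶠ s : ℝ in 𝓝 0, 0 < (q + s • (Pi.single i 1 : Fin 3 → ℝ)) 0 := by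
      have : Continuous fun s : ℝ => (q + s • (Pi.single i 1 : Fin 3 → ℝ)) 0 := by fun_prop
      exact this.continuousAt.eventually_mem (isOpen_Ioi.mem_nhds (by simpa using hq))
    have heq : (fun s : ℝ => metric U α B A (cyl (q + s • (Pi.single i 1 : Fin 3 → ℝ))) u u) =ᶠ[𝓝 0]
        fun s : ℝ => Real.exp (-2 * U (cyl (q + s • (Pi.single i 1 : Fin 3 → ℝ)))) := by
      filter_upwards [hpos] with s hs
      have hr := rho_cyl hs
      set p := q + s • (Pi.single i 1 : Fin 3 → ℝ)
      have e1 : dRho (cyl p) u = 0 := by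
        rw [dRho, div_eq_zero_iff]; left
        simp only [cyl, hu, hq2, p]; simp; ring
      have e2 : dPhi (cyl p) u = 1 / p 0 := by
        rw [dPhi, hr, div_eq_div_iff (by positivity) hs.ne']
        simp only [cyl, hu, p, hq2]; simp only [Matrix.cons_val_zero, Matrix.cons_val_one]
        linear_combination (q + s • (Pi.single i 1 : Fin 3 → ℝ)) 0 ^ 2 * Real.sin_sq_add_cos_sq (q 2)
      have e3 : u 2 = 0 := rfl
      rw [metric, connForm, e1, e2, e3, hr]
      field_simp
      ring
    have heq' := (d2.congr_of_eventuallyEq heq.symm).unique d1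
    rw [pd_comp_cyl hUd]
    -- expand the derivative in the Cartesian components
    have hexp : fderiv ℝ (fun y => metric U α B A y u u) (cyl q) v =
        ∑ i, ∑ j, u i * u j * ∑ l, v l * fderiv ℝ (fun y : E3 => metric U α B A y
          (EuclideanSpace.single i 1) (EuclideanSpace.single j 1)) (cyl q)
          (EuclideanSpace.single l 1) := by
      have hv : v = ∑ l, v l • (EuclideanSpace.single l 1 : E3) := by
        ext j; fin_cases j <;> simp [Fin.sum_univ_three]
      have hsum : HasFDerivAt (fun y => metric U α B A y u u)
          (∑ i, ∑ j, (u i * u j) • fderiv ℝ (fun y : E3 => metric U α B A y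
          (EuclideanSpace.single i 1) (EuclideanSpace.single j 1)) (cyl q)) (cyl q) := by
        have : (fun y => metric U α B A y u u) = fun y => ∑ i, ∑ j, u i * u j *
            metric U α B A y (EuclideanSpace.single i 1) (EuclideanSpace.single j 1) :=
          funext fun y => isBilinear_metric U α B A y u u
        rw [this]
        refine HasFDerivAt.fun_sum fun i _ => HasFDerivAt.fun_sum fun j _ => ?_
        exact (h.differentiableAt_metric hx hρ _ _).hasFDerivAt.const_mul _
      rw [hsum.fderiv]
      simp only [sum_apply, smul_apply, smul_eq_mul]
      refine Finset.sum_congr rfl fun i _ => Finset.sum_congr rfl fun j _ => ?_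
      congr 1
      conv_lhs => rw [hv]
      simp only [map_sum, map_smul, smul_eq_mul]
    have hu1 : ∀ j, |u j| ≤ 1 := by
      intro j
      fin_cases j
      · simpa [hu] using Real.abs_sin_le_one (q 2)
      · simpa [hu] using Real.abs_cos_le_one (q 2)
      · simp [hu]
    have hv1 : ∀ j, |v j| ≤ 1 := by
      intro j
      fin_cases i
      · fin_cases j
        · simpa [v, cylFrame] using Real.abs_cos_le_one (q 2)
        · simpa [v, cylFrame] using Real.abs_sin_le_one (q 2)
        · simp [v, cylFrame]
      · fin_cases j <;> simp [v, cylFrame]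
      · exact absurd rfl hi
    have hle : |fderiv ℝ (fun y => metric U α B A y u u) (cyl q) v| ≤ metricDeriv U α B A (cyl q) := by
      rw [hexp, metricDeriv]
      refine (Finset.abs_sum_le_sum_abs _ _).trans (Finset.sum_le_sum fun i _ => ?_)
      refine (Finset.abs_sum_le_sum_abs _ _).trans (Finset.sum_le_sum fun j _ => ?_)
      rw [abs_mul, abs_mul]
      refine (mul_le_of_le_one_left (abs_nonneg _)
        (mul_le_one₀ (hu1 i) (abs_nonneg _) (hu1 j))).trans ?_
      refine (Finset.abs_sum_le_sum_abs _ _).trans (Finset.sum_le_sum fun l _ => ?_)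
      rw [abs_mul]
      exact mul_le_of_le_one_left (abs_nonneg _) (hv1 l)
    rw [heq', abs_mul, abs_mul, abs_of_pos (Real.exp_pos _)] at hle
    have he : Real.exp (2 * U (cyl q)) * Real.exp (-2 * U (cyl q)) = 1 := by
      rw [← Real.exp_add]; simp
    have h2 : |(-2 : ℝ)| = 2 := by norm_num
    rw [h2] at hle
    have := mul_le_mul_of_nonneg_left hle (Real.exp_pos (2 * U (cyl q))).le
    rw [← mul_assoc, he, one_mul] at this
    linarith
  have hr : m₁ / 2 < cylRadius q := by rwa [norm_cyl] at hx
  have h0 := key 0 (by decide)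
  have h1 := key 1 (by decide)
  have hsq := norm_gradient_sq hq hUd
  rw [pd_two_eq_zero h.smooth_U hr.le] at hsq
  have hnn : 0 ≤ Real.exp (2 * U (cyl q)) * metricDeriv U α B A (cyl q) :=
    (mul_nonneg_iff_of_pos_left (by norm_num : (0:ℝ) < 1 / 2)).1 (by
      rw [← mul_assoc]; exact (abs_nonneg _).trans h0)
  refine abs_le_of_sq_le_sq' ?_ hnn |>.2
  have a0 := sq_le_sq' (neg_le_of_abs_le h0) (le_of_abs_le h0)
  have a1 := sq_le_sq' (neg_le_of_abs_le h1) (le_of_abs_le h1)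
  rw [hsq, zero_div]
  nlinarith [sq_nonneg (Real.exp (2 * U (cyl q)) * metricDeriv U α B A (cyl q))]

theorem IsAxisymmetricData.memLp_gradient (h : IsAxisymmetricData m₁ k U α B A) (hm : 0 < m₁) :
    ∃ R₁ > m₁ / 2, MemLp (fun x => ‖gradient U x‖) 2 (volume.restrict (openExterior R₁)) := by
  obtain ⟨R₁, hR₁, hL⟩ := h.deriv_memLp
  obtain ⟨C, hC0, hC⟩ := h.decay_U.exists_bound_exterior (R := m₁ / 2) (by positivity)
    h.smooth_U.smooth.continuousOn
  have hbd : ∀ x ∈ openExterior R₁, U x ≤ C * (m₁ / 2) ^ (-1 / 2 : ℝ) := by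
    intro x (hx : R₁ < ‖x‖)
    have h1 : m₁ / 2 ≤ ‖x‖ := (hR₁.trans hx).le
    have : ‖x‖ ^ (-1 / 2 : ℝ) ≤ (m₁ / 2) ^ (-1 / 2 : ℝ) :=
      Real.rpow_le_rpow_of_nonpos (by positivity) h1 (by norm_num)
    refine (le_abs_self _).trans ((hC x h1).trans ?_)
    gcongr
  refine ⟨R₁, hR₁, ?_⟩
  have hmd : MemLp (fun x => Real.exp (2 * (C * (m₁ / 2) ^ (-1 / 2 : ℝ))) * metricDeriv U α B A x) 2
      (volume.restrict (openExterior R₁)) := by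
    refine MemLp.const_mul ?_ _
    unfold metricDeriv
    exact memLp_finsetSum _ fun i _ => memLp_finsetSum _ fun j _ =>
      memLp_finsetSum _ fun l _ => (hL i j l).abs
  refine hmd.mono (measurable_norm_gradient U).aestronglyMeasurable ?_
  have hax : ∀ᵐ x ∂(volume.restrict (openExterior R₁)), rho x ≠ 0 :=
    ae_restrict_of_ae (measure_eq_zero_iff_ae_notMem.1 volume_axis)
  filter_upwards [hax, ae_restrict_mem (isOpen_openExterior R₁).measurableSet] with x hx hx1
  have h1 := h.norm_gradient_le (hR₁.trans hx1) hx
  rw [Real.norm_of_nonneg (norm_nonneg _)]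
  refine h1.trans (le_trans ?_ (le_abs_self _))
  have : 0 ≤ metricDeriv U α B A x := by unfold metricDeriv; positivity
  have := hbd x hx1
  gcongr

end

end

/-! ### The functional as an energy plus boundary terms -/

section
open MeasureTheory
open scoped ENNReal

/-- The deviation of `U` from the potential `-2 log (1 + R / r)` of the Schwarzschild slice. -/
def excess (R : ℝ) (U : E3 → ℝ) (x : E3) : ℝ := U x + 2 * Real.log (1 + R / ‖x‖)

/-- The energy density `½ Φ_* |∇U_S|²` of the Schwarzschild potential, as a function of `r`. -/
def schwarzschildDensity (R r : ℝ) : ℝ := 2 * R ^ 2 * (r - R) / (r ^ 4 * (r + R))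

section
variable {R : ℝ} {U : E3 → ℝ}

theorem norm_rot (t : ℝ) (x : E3) : ‖rot t x‖ = ‖x‖ := by
  rw [EuclideanSpace.norm_eq, EuclideanSpace.norm_eq]
  congr 1
  simp [Fin.sum_univ_three, rot]
  linear_combination (x 0 ^ 2 + x 1 ^ 2) * Real.sin_sq_add_cos_sq t

theorem smoothAxisymmetric_excess (hR : 0 < R) (hU : SmoothAxisymmetric R U) :
    SmoothAxisymmetric R (excess R U) where
  smooth := by
    refine hU.smooth.add (contDiffOn_const.mul (ContDiffOn.log ?_ fun x hx => ?_))
    · refine contDiffOn_const.add (contDiffOn_const.div ?_ fun x hx => (hR.trans_le hx).ne')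
      exact fun x hx => (contDiffAt_norm ℝ (norm_pos_iff.1 (hR.trans_le hx))).contDiffWithinAt
    · have : 0 < ‖x‖ := hR.trans_le hx
      positivity
  axisymmetric t x hx := by
    rw [excess, excess, hU.axisymmetric t x hx, norm_rot]

theorem strip_excess (hR : 0 < R) : strip R (excess R U) = deviation R U := by
  funext p
  rw [strip, excess, deviation, norm_cyl_sphPt hR, strip, Real.exp_neg]
  congr 4
  field_simp

theorem hasGradientAt_norm {x : E3} (hx : x ≠ 0) :
    HasGradientAt (fun y : E3 => ‖y‖) (‖x‖⁻¹ • x) x := by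
  have h1 : HasFDerivAt (fun y : E3 => ‖y‖ ^ 2) (2 • (innerSL ℝ x)) x :=
    (hasStrictFDerivAt_norm_sq x).hasFDerivAt
  have hn : 0 < ‖x‖ := norm_pos_iff.2 hx
  have h2 := h1.sqrt (by positivity)
  rw [hasGradientAt_iff_hasFDerivAt]
  refine (h2.congr_of_eventuallyEq (Eventually.of_forall fun y => by
    simp [Real.sqrt_sq (norm_nonneg y)])).congr_fderiv ?_
  ext v
  simp [Real.sqrt_sq hn.le]
  field_simp

theorem hasGradientAt_comp_norm {h : ℝ → ℝ} {d : ℝ} {x : E3} (hx : x ≠ 0)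
    (hh : HasDerivAt h d ‖x‖) : HasGradientAt (fun y : E3 => h ‖y‖) ((d / ‖x‖) • x) x := by
  have := hh.comp_hasFDerivAt x (hasGradientAt_iff_hasFDerivAt.1 (hasGradientAt_norm hx))
  rw [hasGradientAt_iff_hasFDerivAt]
  refine this.congr_fderiv ?_
  ext v
  simp
  field_simp

theorem gradient_excess (hR : 0 < R) {x : E3} (hx : R < ‖x‖) (hU : DifferentiableAt ℝ U x) :
    gradient (excess R U) x = gradient U x + ((-2 * R / (‖x‖ * (‖x‖ + R))) / ‖x‖) • x := by
  have hr : 0 < ‖x‖ := hR.trans hx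
  have hx0 : x ≠ 0 := norm_pos_iff.1 hr
  have : HasDerivAt (fun r : ℝ => 2 * Real.log (1 + R / r)) (-2 * R / (‖x‖ * (‖x‖ + R))) ‖x‖ := by
    have e1 := ((hasDerivAt_const ‖x‖ R).div (hasDerivAt_id ‖x‖) hr.ne').const_add 1
    have hp : 1 + R / ‖x‖ ≠ 0 := by positivity
    refine ((e1.log hp).const_mul 2).congr_deriv ?_
    simp
    field_simp
  have h2 := hasGradientAt_comp_norm hx0 this
  have h1 := hU.hasGradientAt
  refine HasGradientAt.gradient ?_
  rw [hasGradientAt_iff_hasFDerivAt] at h1 h2 ⊢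
  rw [map_add]
  exact h1.add h2

/-- Completing the square: the integrand of `J` is the energy density of the deviation of `U` from
the Schwarzschild potential, minus the energy density of that potential. -/
theorem integrand_eq (hR : 0 < R) {x : E3} (hx : R < ‖x‖) (hU : DifferentiableAt ℝ U x) :
    1 / 2 * PhiStar (2 * R) x * ‖gradient U x + (1 / PhiStar (2 * R) x) •
        gradient (fun y => PhiStar (2 * R) y - PsiStar (2 * R) y) x‖ ^ 2
      - 1 / (2 * PhiStar (2 * R) x) *
        ‖gradient (fun y => PhiStar (2 * R) y - PsiStar (2 * R) y) x‖ ^ 2 =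
    energyDensity R (excess R U) x - schwarzschildDensity R ‖x‖ := by
  have hr : 0 < ‖x‖ := hR.trans hx
  have hx0 : x ≠ 0 := norm_pos_iff.1 hr
  have hd : ‖x‖ - R ≠ 0 := by linarith
  have hs : ‖x‖ + R ≠ 0 := by linarith
  have hP : PhiStar (2 * R) x = (‖x‖ - R) * (‖x‖ + R) / ‖x‖ ^ 2 := by
    rw [PhiStar]; field_simp; ring
  have g1 : gradient (fun y => PhiStar (2 * R) y - PsiStar (2 * R) y) x =
      ((-2 * R * (‖x‖ - R) / ‖x‖ ^ 3) / ‖x‖) • x := by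
    have : HasDerivAt (fun r : ℝ => (1 - (2 * R) ^ 2 / (4 * r ^ 2)) - -(2 * R / r))
        (-2 * R * (‖x‖ - R) / ‖x‖ ^ 3) ‖x‖ := by
      have e1 := ((hasDerivAt_const ‖x‖ ((2 * R) ^ 2)).div
        (((hasDerivAt_id ‖x‖).pow 2).const_mul 4) (by simp; exact hx0)).const_sub 1
      have e2 := ((hasDerivAt_const ‖x‖ (2 * R)).div (hasDerivAt_id ‖x‖) hr.ne').neg
      refine (e1.sub e2).congr_deriv ?_
      simp
      field_simp
      ring
    exact (hasGradientAt_comp_norm hx0 this).gradient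
  have g2 := gradient_excess hR hx hU
  have e : (1 / PhiStar (2 * R) x) • gradient (fun y => PhiStar (2 * R) y - PsiStar (2 * R) y) x =
      ((-2 * R / (‖x‖ * (‖x‖ + R))) / ‖x‖) • x := by
    rw [g1, smul_smul, hP]
    congr 1
    field_simp
  rw [e, ← g2, g1, norm_smul, mul_pow, Real.norm_eq_abs, sq_abs, hP, energyDensity,
    schwarzschildDensity]
  have e3 : (1 - R ^ 2 / ‖x‖ ^ 2) = (‖x‖ - R) * (‖x‖ + R) / ‖x‖ ^ 2 := by field_simp; ring
  rw [e3]
  congr 1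
  field_simp

theorem energyDensity_excess_le (hR : 0 < R) {x : E3} (hx : R < ‖x‖) (hU : DifferentiableAt ℝ U x) :
    energyDensity R (excess R U) x ≤ ‖gradient U x‖ ^ 2 + 2 * schwarzschildDensity R ‖x‖ := by
  have hr : 0 < ‖x‖ := hR.trans hx
  have hx0 : x ≠ 0 := norm_pos_iff.1 hr
  have g2 := gradient_excess hR hx hU
  have hΦ : 0 ≤ 1 - R ^ 2 / ‖x‖ ^ 2 := by
    have : R ^ 2 / ‖x‖ ^ 2 ≤ 1 := by
      rw [div_le_one (by positivity)]; gcongr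
    linarith
  have hΦ1 : 1 - R ^ 2 / ‖x‖ ^ 2 ≤ 1 := by
    have : 0 ≤ R ^ 2 / ‖x‖ ^ 2 := by positivity
    linarith
  set w : E3 := ((-2 * R / (‖x‖ * (‖x‖ + R))) / ‖x‖) • x with hw
  have hwn : (1 - R ^ 2 / ‖x‖ ^ 2) * ‖w‖ ^ 2 = 2 * schwarzschildDensity R ‖x‖ := by
    rw [hw, norm_smul, mul_pow, Real.norm_eq_abs, sq_abs, schwarzschildDensity]
    field_simp
    ring
  have hsq : ‖gradient U x + w‖ ^ 2 ≤ 2 * ‖gradient U x‖ ^ 2 + 2 * ‖w‖ ^ 2 := by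
    have h1 := norm_add_le (gradient U x) w
    nlinarith [norm_nonneg (gradient U x + w), sq_nonneg (‖gradient U x‖ - ‖w‖)]
  rw [energyDensity, g2, ← hwn]
  nlinarith [mul_le_mul_of_nonneg_left hsq hΦ, mul_le_mul_of_nonneg_right hΦ1 (sq_nonneg ‖gradient U x‖)]

end

/-! ### The energy of the Schwarzschild potential -/

theorem finrank_E3 : Module.finrank ℝ E3 = 3 := by simp

theorem volume_real_ball : (volume : Measure E3).real (Metric.ball 0 1) = 4 / 3 * Real.pi := by
  rw [Measure.real, EuclideanSpace.volume_ball_fin_three]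
  rw [ENNReal.toReal_mul, ENNReal.toReal_pow, ENNReal.toReal_ofReal (by norm_num),
    ENNReal.toReal_ofReal (by positivity)]
  ring

/-- An antiderivative of `r²` times the energy density of the Schwarzschild potential; it tends to
`0` at infinity. -/
theorem hasDerivAt_primitive {R r : ℝ} (hR : 0 < R) (hr : 0 < r) :
    HasDerivAt (fun r => 2 * R ^ 2 * (2 / R * Real.log (r / (r + R)) + r⁻¹))
      (r ^ 2 * schwarzschildDensity R r) r := by
  have e1 := (hasDerivAt_id r).div ((hasDerivAt_id r).add_const R) (by simp; positivity)
  have hp : r / (r + R) ≠ 0 := by positivity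
  refine ((((e1.log hp).const_mul (2 / R)).add (hasDerivAt_inv hr.ne')).const_mul
    (2 * R ^ 2)).congr_deriv ?_
  simp [schwarzschildDensity]
  field_simp
  ring

theorem radial_integral {R : ℝ} (hR : 0 < R) :
    IntegrableOn (fun r => r ^ 2 * schwarzschildDensity R r) (Ioi R) ∧
    ∫ r in Ioi R, r ^ 2 * schwarzschildDensity R r = 2 * R * (2 * Real.log 2 - 1) := by
  have hder : ∀ r ∈ Ici R, HasDerivAt (fun r => 2 * R ^ 2 * (2 / R * Real.log (r / (r + R)) + r⁻¹))
      (r ^ 2 * schwarzschildDensity R r) r := fun r hr =>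
    hasDerivAt_primitive hR (hR.trans_le hr)
  have hpos : ∀ r ∈ Ioi R, 0 ≤ r ^ 2 * schwarzschildDensity R r := by
    intro r (hr : R < r)
    have : 0 < r := hR.trans hr
    have : 0 ≤ r - R := by linarith
    unfold schwarzschildDensity; positivity
  have hlim : Tendsto (fun r => 2 * R ^ 2 * (2 / R * Real.log (r / (r + R)) + r⁻¹)) atTop (𝓝 0) := by
    have h1 : Tendsto (fun r : ℝ => r / (r + R)) atTop (𝓝 1) := by
      have h0 : Tendsto (fun r : ℝ => 1 - R / (r + R)) atTop (𝓝 (1 - 0)) :=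
        (tendsto_const_nhds.div_atTop (tendsto_atTop_add_const_right _ _ tendsto_id)).const_sub 1
      rw [sub_zero] at h0
      refine h0.congr' ?_
      filter_upwards [eventually_gt_atTop 0] with r hr
      field_simp; ring
    have h2 := h1.log one_ne_zero
    have h3 := ((h2.const_mul (2 / R)).add tendsto_inv_atTop_zero).const_mul (2 * R ^ 2)
    simpa using h3
  refine ⟨integrableOn_Ioi_deriv_of_nonneg' hder hpos hlim, ?_⟩
  rw [integral_Ioi_of_hasDerivAt_of_nonneg' hder hpos hlim]
  rw [show R / (R + R) = 2⁻¹ by field_simp; norm_num, Real.log_inv]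
  field_simp
  ring

theorem integral_schwarzschildDensity {R : ℝ} (hR : 0 < R) :
    IntegrableOn (fun x : E3 => schwarzschildDensity R ‖x‖) (openExterior R) ∧
    ∫ x in openExterior R, schwarzschildDensity R ‖x‖ =
      4 * Real.pi * (2 * R * (2 * Real.log 2 - 1)) := by
  obtain ⟨h1, h2⟩ := radial_integral hR
  have hind : (openExterior R).indicator (fun x : E3 => schwarzschildDensity R ‖x‖) =
      fun x : E3 => (Ioi R).indicator (schwarzschildDensity R) ‖x‖ := by
    funext x; rfl
  have hsmul : (fun y : ℝ => y ^ (Module.finrank ℝ E3 - 1) • (Ioi R).indicator (schwarzschildDensity R) y) =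
      (Ioi R).indicator fun y => y ^ 2 * schwarzschildDensity R y := by
    funext y
    simp only [finrank_E3, indicator]
    split_ifs <;> simp
  have hsub : Ioi (0 : ℝ) ∩ Ioi R = Ioi R := by
    rw [inter_eq_right]; exact Ioi_subset_Ioi hR.le
  constructor
  · rw [← integrable_indicator_iff (isOpen_openExterior R).measurableSet, hind,
      integrable_fun_norm_addHaar volume (f := (Ioi R).indicator (schwarzschildDensity R)), hsmul]
    rw [integrableOn_indicator_iff measurableSet_Ioi, inter_comm, hsub]
    exact h1
  · rw [← integral_indicator (isOpen_openExterior R).measurableSet, hind,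
      integral_fun_norm_addHaar volume ((Ioi R).indicator (schwarzschildDensity R)), hsmul,
      setIntegral_indicator measurableSet_Ioi, hsub, h2, volume_real_ball, finrank_E3]
    simp
    ring

/-! ### Integrals and radial derivatives on the boundary sphere -/

theorem sphereIntegral_const {R c : ℝ} {f : E3 → ℝ} (hR : 0 < R) (hf : ∀ x, ‖x‖ = R → f x = c) :
    sphereIntegral R f = 4 * Real.pi * R ^ 2 * c := by
  have : (fun u : Metric.sphere (0 : E3) 1 => f (R • (u : E3))) = fun _ => c := by
    funext u
    apply hf
    rw [norm_smul, norm_eq_of_mem_sphere, Real.norm_of_nonneg hR.le, mul_one]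
  rw [sphereIntegral, this, integral_const, Measure.toSphere_real_apply_univ, volume_real_ball,
    finrank_E3]
  simp
  ring

theorem radialDeriv_radial {f : E3 → ℝ} {h : ℝ → ℝ} {d : ℝ} {x : E3} (hx : 0 < ‖x‖)
    (hf : ∀ y, f y = h ‖y‖) (hh : HasDerivAt h d ‖x‖) : radialDeriv f x = d := by
  have heq : EqOn (fun t : ℝ => f (t • (‖x‖⁻¹ • x))) h (Ici ‖x‖) := by
    intro t (ht : ‖x‖ ≤ t)
    have : 0 ≤ t := hx.le.trans ht
    simp only
    rw [hf, norm_smul, norm_smul, norm_inv, norm_norm, inv_mul_cancel₀ hx.ne', mul_one,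
      Real.norm_of_nonneg this]
  rw [radialDeriv, derivWithin_congr heq (heq self_mem_Ici)]
  exact hh.hasDerivWithinAt.derivWithin (uniqueDiffOn_Ici _ _ self_mem_Ici)

end

/-! ### The functional as an energy -/

section
open MeasureTheory
open scoped ENNReal

/-- The energy density in the strip. -/
def stripDensity (V : ℝ × ℝ → ℝ) (p : ℝ × ℝ) : ℝ :=
  Real.sinh p.1 * Real.sin p.2 * (dT V p ^ 2 + dTh V p ^ 2)

theorem continuousOn_stripDensity {V : ℝ × ℝ → ℝ} (hV : ContDiffOn ℝ ∞ V halfStrip) :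
    ContinuousOn (stripDensity V) halfStrip := by
  have h1 := (contDiffOn_dT hV).continuousOn
  have h2 := (contDiffOn_dTh hV).continuousOn
  have h3 : Continuous fun p : ℝ × ℝ => Real.sinh p.1 * Real.sin p.2 :=
    (Real.continuous_sinh.comp continuous_fst).mul (Real.continuous_sin.comp continuous_snd)
  exact h3.continuousOn.mul ((h1.pow 2).add (h2.pow 2))

theorem stripDensity_nonneg {V : ℝ × ℝ → ℝ} {t θ : ℝ} (ht : 0 ≤ t) (hθ : θ ∈ Icc 0 Real.pi) :
    0 ≤ stripDensity V (t, θ) := by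
  have h1 : 0 ≤ Real.sinh t := Real.sinh_nonneg_iff.2 ht
  have h2 := Real.sin_nonneg_of_mem_Icc hθ
  unfold stripDensity
  positivity

section
variable {R : ℝ} {f : E3 → ℝ}

/-- The energy in a bounded region is finite, since the density is bounded in the strip. -/
theorem SmoothAxisymmetric.lintegral_energyDensity_lt_top (hR : 0 < R)
    (hf : SmoothAxisymmetric R f) (R₁ : ℝ) :
    ∫⁻ x in openExterior R ∩ Metric.ball 0 R₁, ENNReal.ofReal (energyDensity R f x) < ⊤ := by
  rcases le_or_gt R₁ R with hle | hlt
  · have : openExterior R ∩ Metric.ball 0 R₁ = ∅ := by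
      ext x
      simp only [mem_inter_iff, Metric.mem_ball, dist_zero_right, mem_empty_iff_false, iff_false,
        not_and, not_lt]
      exact fun hx => hle.trans (le_of_lt hx)
    rw [this]; simp
  set T := Real.log (R₁ / R) with hT
  have hcont := continuousOn_stripDensity (contDiffOn_strip hR hf.smooth)
  obtain ⟨M, hM⟩ := (isCompact_Icc.prod isCompact_Icc : IsCompact (Icc 0 T ×ˢ Icc 0 Real.pi)).exists_bound_of_continuousOn
    (hcont.mono fun p hp => hp.1.1)
  set w : ℝ → ℝ≥0∞ := (Iio R₁).indicator 1 with hw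
  have h1 := hf.lintegral_energyDensity hR (w := w) (measurable_one.indicator measurableSet_Iio)
    (fun r => by simp only [hw, indicator]; split_ifs <;> simp)
  have h2 : ∫⁻ x in openExterior R ∩ Metric.ball 0 R₁, ENNReal.ofReal (energyDensity R f x) =
      ∫⁻ x in openExterior R, w ‖x‖ * ENNReal.ofReal (energyDensity R f x) := by
    rw [inter_comm, ← setLIntegral_indicator Metric.isOpen_ball.measurableSet]
    refine lintegral_congr fun x => ?_
    simp only [hw, indicator, Metric.mem_ball, dist_zero_right, mem_Iio]
    split_ifs <;> simp
  rw [h2, h1]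
  refine ENNReal.mul_lt_top ENNReal.ofReal_lt_top ?_
  have h3 : ∫⁻ t in Ioi (0 : ℝ), w (R * Real.exp t) * ∫⁻ θ in Ioo 0 Real.pi,
      ENNReal.ofReal (R * (Real.sinh t * Real.sin θ *
          (dT (strip R f) (t, θ) ^ 2 + dTh (strip R f) (t, θ) ^ 2))) ≤
      ∫⁻ t in Ioi (0 : ℝ), (Iio T).indicator (fun _ => ENNReal.ofReal (R * M) * volume (Ioo 0 Real.pi)) t := by
    refine setLIntegral_mono' measurableSet_Ioi fun t ht => ?_
    by_cases htT : t < T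
    · rw [indicator_of_mem (show t ∈ Iio T from htT)]
      have hw1 : w (R * Real.exp t) ≤ 1 := by
        simp only [hw, indicator]; split_ifs <;> simp
      refine (mul_le_of_le_one_left' hw1).trans ?_
      refine (setLIntegral_mono' measurableSet_Ioo (g := fun _ => ENNReal.ofReal (R * M))
        fun θ hθ => ?_).trans (by rw [setLIntegral_const])
      refine ENNReal.ofReal_le_ofReal (mul_le_mul_of_nonneg_left ?_ hR.le)
      exact (le_abs_self _).trans (hM (t, θ) ⟨⟨le_of_lt ht, htT.le⟩, hθ.1.le, hθ.2.le⟩)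
    · have : w (R * Real.exp t) = 0 := by
        apply indicator_of_notMem
        rw [mem_Iio, not_lt]
        have h4 : T ≤ t := not_lt.1 htT
        rw [hT, Real.log_le_iff_le_exp (by have := hR.trans hlt; positivity), div_le_iff₀ hR] at h4
        linarith
      rw [this, zero_mul]; exact zero_le
  refine h3.trans_lt ?_
  rw [setLIntegral_indicator measurableSet_Iio, setLIntegral_const]
  refine ENNReal.mul_lt_top (ENNReal.mul_lt_top ENNReal.ofReal_lt_top (by simp)) ?_
  rw [Iio_inter_Ioi]
  simp

/-- The energy bounds the energies of the truncated strips. -/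
theorem SmoothAxisymmetric.strip_energy_le (hR : 0 < R) (hf : SmoothAxisymmetric R f)
    (hint : IntegrableOn (energyDensity R f) (openExterior R)) {T : ℝ} (hT : 0 < T) :
    (∫ t in (0 : ℝ)..T, 1 / 2 * ∫ θ in (0 : ℝ)..Real.pi, stripDensity (strip R f) (t, θ)) ≤
      1 / (4 * Real.pi) * (∫ x in openExterior R, energyDensity R f x) / R := by
  have hcont := continuousOn_stripDensity (contDiffOn_strip hR hf.smooth)
  have hI := continuousOn_integral_slice hcont
  have hinner : ∀ t ∈ Ici (0 : ℝ), 0 ≤ ∫ θ in (0 : ℝ)..Real.pi, stripDensity (strip R f) (t, θ) :=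
    fun t ht => intervalIntegral.integral_nonneg Real.pi_pos.le fun θ hθ => stripDensity_nonneg ht hθ
  have h1 := hf.lintegral_energyDensity hR (w := fun _ => 1) measurable_const (by simp)
  simp only [one_mul] at h1
  have h2 : ENNReal.ofReal (∫ x in openExterior R, energyDensity R f x) =
      ∫⁻ x in openExterior R, ENNReal.ofReal (energyDensity R f x) := by
    refine ofReal_integral_eq_lintegral_ofReal hint ?_
    filter_upwards [ae_restrict_mem (isOpen_openExterior R).measurableSet] with x hx
    exact energyDensity_nonneg hR hx
  have h3 : ∀ t ∈ Ioc 0 T, ∫⁻ θ in Ioo 0 Real.pi, ENNReal.ofReal (R * (Real.sinh t * Real.sin θ *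
          (dT (strip R f) (t, θ) ^ 2 + dTh (strip R f) (t, θ) ^ 2))) =
      ENNReal.ofReal (R * ∫ θ in (0 : ℝ)..Real.pi, stripDensity (strip R f) (t, θ)) := by
    intro t ht
    have hc := continuous_slice hcont ht.1.le
    rw [← intervalIntegral.integral_const_mul, intervalIntegral.integral_of_le Real.pi_pos.le,
      integral_Ioc_eq_integral_Ioo, ofReal_integral_eq_lintegral_ofReal]
    · rfl
    · exact ((hc.const_mul R).integrableOn_Icc (a := 0) (b := Real.pi)).mono_set Ioo_subset_Icc_self
    · filter_upwards [ae_restrict_mem measurableSet_Ioo] with θ hθ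
      exact mul_nonneg hR.le (stripDensity_nonneg ht.1.le (Ioo_subset_Icc_self hθ))
  have h4 : ENNReal.ofReal (R * ∫ t in (0 : ℝ)..T, ∫ θ in (0 : ℝ)..Real.pi,
      stripDensity (strip R f) (t, θ)) ≤ ∫⁻ t in Ioi (0 : ℝ), ∫⁻ θ in Ioo 0 Real.pi,
      ENNReal.ofReal (R * (Real.sinh t * Real.sin θ *
          (dT (strip R f) (t, θ) ^ 2 + dTh (strip R f) (t, θ) ^ 2))) := by
    refine le_trans (le_of_eq ?_) (lintegral_mono_set (Ioc_subset_Ioi_self : Ioc 0 T ⊆ Ioi 0))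
    rw [setLIntegral_congr_fun measurableSet_Ioc h3, ← intervalIntegral.integral_const_mul,
      intervalIntegral.integral_of_le hT.le, ofReal_integral_eq_lintegral_ofReal]
    · exact ((continuousOn_const.mul (hI.mono Icc_subset_Ici_self)).integrableOn_Icc
        (a := 0) (b := T)).mono_set Ioc_subset_Icc_self
    · filter_upwards [ae_restrict_mem measurableSet_Ioc] with t ht
      exact mul_nonneg hR.le (hinner t ht.1.le)
  have h5 := mul_le_mul_right h4 (ENNReal.ofReal (2 * Real.pi))
  rw [← h1, ← h2, ← ENNReal.ofReal_mul (by positivity), ENNReal.ofReal_le_ofReal_iff] at h5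
  · rw [intervalIntegral.integral_const_mul, le_div_iff₀ hR]
    have := Real.pi_pos
    rw [one_div_mul_eq_div (4 * Real.pi), le_div_iff₀ (by positivity)]
    linarith
  · refine setIntegral_nonneg (isOpen_openExterior R).measurableSet fun x hx => ?_
    exact energyDensity_nonneg hR hx

end

section
variable {m₁ : ℝ} {k : ℕ} {U α B A : E3 → ℝ}

/-- The energy is finite: near the boundary by smoothness, near infinity because `∇U` and the gradient
of the Schwarzschild potential are square integrable there. -/
theorem IsAxisymmetricData.integrableOn_energyDensity (h : IsAxisymmetricData m₁ k U α B A)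
    (hm : 0 < m₁) :
    IntegrableOn (energyDensity (m₁ / 2) (excess (m₁ / 2) U)) (openExterior (m₁ / 2)) := by
  have hR : 0 < m₁ / 2 := by positivity
  obtain ⟨R₁, hR₁, hL⟩ := h.memLp_gradient hm
  have hfar : IntegrableOn (energyDensity (m₁ / 2) (excess (m₁ / 2) U)) (openExterior R₁) := by
    have h1 : IntegrableOn (fun x => ‖gradient U x‖ ^ 2) (openExterior R₁) := hL.integrable_sq
    have h2 : IntegrableOn (fun x : E3 => schwarzschildDensity (m₁ / 2) ‖x‖) (openExterior R₁) :=
      (integral_schwarzschildDensity hR).1.mono_set fun x (hx : R₁ < ‖x‖) => hR₁.trans hx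
    refine (h1.add (h2.const_mul 2)).mono' measurable_energyDensity.aestronglyMeasurable ?_
    filter_upwards [ae_restrict_mem (isOpen_openExterior R₁).measurableSet] with x hx
    have hx' : m₁ / 2 < ‖x‖ := hR₁.trans hx
    rw [Real.norm_of_nonneg (energyDensity_nonneg hR hx')]
    exact energyDensity_excess_le hR hx' (h.smooth_U.differentiableAt hx')
  have hnear : IntegrableOn (energyDensity (m₁ / 2) (excess (m₁ / 2) U))
      (openExterior (m₁ / 2) ∩ Metric.ball 0 (R₁ + 1)) := by
    refine ⟨measurable_energyDensity.aestronglyMeasurable, ?_⟩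
    rw [hasFiniteIntegral_iff_ofReal]
    · exact (smoothAxisymmetric_excess hR h.smooth_U).lintegral_energyDensity_lt_top hR _
    · filter_upwards [ae_restrict_mem ((isOpen_openExterior _).inter Metric.isOpen_ball).measurableSet]
        with x hx
      exact energyDensity_nonneg hR hx.1
  refine (hnear.union hfar).mono_set fun x hx => ?_
  rcases le_or_gt ‖x‖ R₁ with h1 | h1
  · exact Or.inl ⟨hx, by simpa using by linarith⟩
  · exact Or.inr h1

/-- The functional is the energy of the deviation from the Schwarzschild potential, plus a function
of `c = C_H + 2 log 2`. -/
theorem IsAxisymmetricData.J_eq (h : IsAxisymmetricData m₁ k U α B A) (hm : 0 < m₁) {C_H : ℝ}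
    (hconst : ∀ x : E3, ‖x‖ = m₁ / 2 → U x - 1 / 2 * α x = C_H) :
    J m₁ (PhiStar m₁) (PsiStar m₁) U α =
      1 / (4 * Real.pi) * (∫ x in openExterior (m₁ / 2),
        energyDensity (m₁ / 2) (excess (m₁ / 2) U) x)
      + m₁ * (1 - (C_H + 2 * Real.log 2) - Real.exp (-(C_H + 2 * Real.log 2))) := by
  have hR : 0 < m₁ / 2 := by positivity
  have h2R : 2 * (m₁ / 2) = m₁ := by ring
  have hpi := Real.pi_pos
  obtain ⟨hB1, hB2⟩ := integral_schwarzschildDensity hR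
  have hvol : (∫ x in openExterior (m₁ / 2),
      (1 / 2 * PhiStar m₁ x * ‖gradient U x + (1 / PhiStar m₁ x) •
        gradient (fun y => PhiStar m₁ y - PsiStar m₁ y) x‖ ^ 2
        - 1 / (2 * PhiStar m₁ x) * ‖gradient (fun y => PhiStar m₁ y - PsiStar m₁ y) x‖ ^ 2)) =
      (∫ x in openExterior (m₁ / 2), energyDensity (m₁ / 2) (excess (m₁ / 2) U) x)
        - 4 * Real.pi * (2 * (m₁ / 2) * (2 * Real.log 2 - 1)) := by
    rw [← hB2, ← integral_sub (h.integrableOn_energyDensity hm) hB1]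
    refine setIntegral_congr_fun (isOpen_openExterior _).measurableSet fun x hx => ?_
    have := integrand_eq hR hx (h.smooth_U.differentiableAt hx)
    rw [h2R] at this
    exact this
  have hs1 : sphereIntegral (m₁ / 2) (fun x => 2 / m₁ * PhiStar m₁ x + 1 / 2 * α x *
      (radialDeriv (PhiStar m₁) x + 2 / m₁ * PhiStar m₁ x) - U x * radialDeriv (PsiStar m₁) x) =
      4 * Real.pi * (m₁ / 2) ^ 2 * (-(4 / m₁) * C_H) := by
    refine sphereIntegral_const hR fun x hx => ?_
    have hx0 : 0 < ‖x‖ := by rw [hx]; exact hR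
    have e0 : PhiStar m₁ x = 0 := by rw [PhiStar, hx]; field_simp; norm_num
    have e1 : radialDeriv (PhiStar m₁) x = 4 / m₁ := by
      refine radialDeriv_radial hx0 (h := fun r => 1 - m₁ ^ 2 / (4 * r ^ 2)) (fun y => rfl) ?_
      refine (((hasDerivAt_const ‖x‖ (m₁ ^ 2)).div
        (((hasDerivAt_id ‖x‖).pow 2).const_mul 4) (by simp; exact norm_pos_iff.1 hx0)).const_sub
        1).congr_deriv ?_
      simp [hx]
      field_simp
      norm_num
    have e2 : radialDeriv (PsiStar m₁) x = 4 / m₁ := by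
      refine radialDeriv_radial hx0 (h := fun r => -(m₁ / r)) (fun y => rfl) ?_
      refine ((hasDerivAt_const ‖x‖ m₁).div (hasDerivAt_id ‖x‖) hx0.ne').neg.congr_deriv ?_
      simp [hx]
      field_simp
      norm_num
    rw [e0, e1, e2, ← hconst x hx]
    ring
  have hs2 : sphereIntegral (m₁ / 2) (fun x => Real.exp (α x - 2 * U x)) =
      4 * Real.pi * (m₁ / 2) ^ 2 * Real.exp (-2 * C_H) := by
    refine sphereIntegral_const hR fun x hx => ?_
    rw [← hconst x hx]; ring_nf
  rw [J, hvol, hs1, hs2]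
  have hexp : Real.exp (-(C_H + 2 * Real.log 2)) = Real.exp (-C_H) / 4 := by
    rw [neg_add, Real.exp_add, Real.exp_neg (2 * Real.log 2), two_mul, Real.exp_add,
      Real.exp_log two_pos]
    ring
  have hsq : 1 / (16 * Real.pi) * (4 * Real.pi * (m₁ / 2) ^ 2 * Real.exp (-2 * C_H)) =
      (m₁ / 4 * Real.exp (-C_H)) ^ 2 := by
    rw [show -2 * C_H = -C_H + -C_H by ring, Real.exp_add]
    field_simp
    norm_num
  rw [hsq, Real.sqrt_sq (by positivity), hexp]
  field_simp
  ring

end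

end

/-! ### The inequality, and the vanishing of the deviation in the case of equality -/

section
open MeasureTheory

variable {m₁ : ℝ} {k : ℕ} {U α B A : E3 → ℝ}

/-- The comparison of the two bounds in `c`: the difference has derivative
`2 (c - 1 + e^(-c)) ≥ 0`. -/
theorem sq_ge_of_nonneg {c : ℝ} (hc : 0 ≤ c) : 2 * (c - 1 + Real.exp (-c)) ≤ c ^ 2 := by
  have hmono : MonotoneOn (fun c : ℝ => c ^ 2 - 2 * (c - 1 + Real.exp (-c))) (Ici 0) := by
    have hd : ∀ x : ℝ, HasDerivAt (fun c : ℝ => c ^ 2 - 2 * (c - 1 + Real.exp (-c)))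
        (2 * x - 2 * (1 - Real.exp (-x))) x := by
      intro x
      refine (((hasDerivAt_id x).pow 2).sub ((((hasDerivAt_id x).sub_const 1).add
        (hasDerivAt_neg x).exp).const_mul 2)).congr_deriv ?_
      simp; ring
    refine monotoneOn_of_deriv_nonneg (convex_Ici 0)
      (fun x _ => (hd x).continuousAt.continuousWithinAt)
      (fun x _ => (hd x).differentiableAt.differentiableWithinAt) fun x _ => ?_
    rw [(hd x).deriv]
    have := Real.add_one_le_exp (-x)
    linarith
  have := hmono self_mem_Ici hc hc
  simp at this
  linarith

/-- The energy of the deviation controls the boundary constant; this is `energy_bound`, transferred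
from the strip, where lengths are measured in units of `R = m₁ / 2`. -/
theorem IsAxisymmetricData.energy_ge (h : IsAxisymmetricData m₁ k U α B A) (hm : 0 < m₁)
    (hk : 5 ≤ k) (hscal : NonnegScalarCurvature (m₁ / 2) (metric U α B A))
    (hmin : MinimalBoundary (m₁ / 2) (metric U α B A)) {C_H : ℝ} (hC : -2 * Real.log 2 ≤ C_H)
    (hconst : ∀ x : E3, ‖x‖ = m₁ / 2 → U x - 1 / 2 * α x = C_H) :
    m₁ * (C_H + 2 * Real.log 2) ^ 2 ≤ 1 / (4 * Real.pi) * (∫ x in openExterior (m₁ / 2),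
        energyDensity (m₁ / 2) (excess (m₁ / 2) U) x) := by
  have hR : 0 < m₁ / 2 := by positivity
  have S := h.stripData hm hk hscal hmin hconst
  have he := smoothAxisymmetric_excess hR h.smooth_U
  have := energy_bound S.smooth_V S.smooth_a S.a_zero S.a_pi S.bd S.bd' S.pos S.decay_V S.decay_dV
    S.decay_a S.decay_da (by linarith) (I := 1 / (4 * Real.pi) * (∫ x in openExterior (m₁ / 2),
        energyDensity (m₁ / 2) (excess (m₁ / 2) U) x) / (m₁ / 2)) (fun T hT => by
      have := he.strip_energy_le hR (h.integrableOn_energyDensity hm) hT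
      rw [strip_excess hR] at this
      exact this)
  rw [le_div_iff₀ hR] at this
  linarith

/-- With `E` the energy term, `J = E - m₁ (c - 1 + e^(-c))` and
`E ≥ m₁ c² ≥ 2 m₁ (c - 1 + e^(-c))`. -/
theorem IsAxisymmetricData.J_nonneg (h : IsAxisymmetricData m₁ k U α B A) (hm : 0 < m₁)
    (hk : 5 ≤ k) (hscal : NonnegScalarCurvature (m₁ / 2) (metric U α B A))
    (hmin : MinimalBoundary (m₁ / 2) (metric U α B A)) {C_H : ℝ} (hC : -2 * Real.log 2 ≤ C_H)
    (hconst : ∀ x : E3, ‖x‖ = m₁ / 2 → U x - 1 / 2 * α x = C_H) :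
    0 ≤ J m₁ (PhiStar m₁) (PsiStar m₁) U α := by
  have h1 := h.energy_ge hm hk hscal hmin hC hconst
  have h2 := sq_ge_of_nonneg (c := C_H + 2 * Real.log 2) (by linarith)
  rw [h.J_eq hm hconst]
  nlinarith [sq_nonneg (C_H + 2 * Real.log 2)]

/-- In the case of equality the boundary constant is that of the Schwarzschild slice, and so is the
potential. -/
theorem IsAxisymmetricData.eq_of_J_eq_zero (h : IsAxisymmetricData m₁ k U α B A) (hm : 0 < m₁)
    (hk : 5 ≤ k) (hscal : NonnegScalarCurvature (m₁ / 2) (metric U α B A))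
    (hmin : MinimalBoundary (m₁ / 2) (metric U α B A)) {C_H : ℝ} (hC : -2 * Real.log 2 ≤ C_H)
    (hconst : ∀ x : E3, ‖x‖ = m₁ / 2 → U x - 1 / 2 * α x = C_H)
    (hJ : J m₁ (PhiStar m₁) (PsiStar m₁) U α = 0) :
    C_H + 2 * Real.log 2 = 0 ∧
      ∀ t > 0, ∀ θ ∈ Ioo 0 Real.pi, deviation (m₁ / 2) U (t, θ) = 0 := by
  have hR : 0 < m₁ / 2 := by positivity
  have h1 := h.energy_ge hm hk hscal hmin hC hconst
  have h2 := sq_ge_of_nonneg (c := C_H + 2 * Real.log 2) (by linarith)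
  rw [h.J_eq hm hconst] at hJ
  have hc : C_H + 2 * Real.log 2 = 0 := by
    have : m₁ * (C_H + 2 * Real.log 2) ^ 2 ≤ 0 := by
      nlinarith [mul_le_mul_of_nonneg_left h2 hm.le]
    have : (C_H + 2 * Real.log 2) ^ 2 ≤ 0 := by
      by_contra! hlt
      exact absurd this (not_le.2 (mul_pos hm hlt))
    nlinarith
  refine ⟨hc, ?_⟩
  rw [hc] at hJ
  have hE : 1 / (4 * Real.pi) * (∫ x in openExterior (m₁ / 2),
        energyDensity (m₁ / 2) (excess (m₁ / 2) U) x) = 0 := by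
    simpa using hJ
  set V := deviation (m₁ / 2) U with hVdef
  have hV : ContDiffOn ℝ ∞ V halfStrip := contDiffOn_deviation hR h.smooth_U.smooth
  have hcont := continuousOn_stripDensity hV
  have hI := continuousOn_integral_slice hcont
  have hzero : ∀ T > 0, (∫ t in (0 : ℝ)..T, ∫ θ in (0 : ℝ)..Real.pi, stripDensity V (t, θ)) ≤ 0 := by
    intro T hT
    have := (smoothAxisymmetric_excess hR h.smooth_U).strip_energy_le hR
      (h.integrableOn_energyDensity hm) hT
    rw [strip_excess hR, hE, zero_div, intervalIntegral.integral_const_mul] at this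
    linarith
  have hinner : ∀ t ∈ Ici (0 : ℝ), 0 ≤ ∫ θ in (0 : ℝ)..Real.pi, stripDensity V (t, θ) :=
    fun t ht => intervalIntegral.integral_nonneg Real.pi_pos.le fun θ hθ => stripDensity_nonneg ht hθ
  have hdens : ∀ t > 0, ∀ θ ∈ Ioo 0 Real.pi, stripDensity V (t, θ) = 0 := by
    intro t ht θ hθ
    have hIt : (∫ θ in (0 : ℝ)..Real.pi, stripDensity V (t, θ)) = 0 := by
      by_contra hne
      have hlt := lt_of_le_of_ne (hinner t ht.le) (Ne.symm hne)
      have := intervalIntegral.integral_pos (by linarith : (0 : ℝ) < t + 1)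
        (hI.mono Icc_subset_Ici_self) (fun s hs => hinner s hs.1.le) ⟨t, ⟨ht.le, by linarith⟩, hlt⟩
      exact absurd (hzero (t + 1) (by linarith)) (not_le.2 this)
    by_contra hne
    have hlt := lt_of_le_of_ne (stripDensity_nonneg ht.le (Ioo_subset_Icc_self hθ)) (Ne.symm hne)
    have := intervalIntegral.integral_pos Real.pi_pos
      (continuous_slice hcont ht.le).continuousOn
      (fun s hs => stripDensity_nonneg ht.le (Ioc_subset_Icc_self hs)) ⟨θ, Ioo_subset_Icc_self hθ, hlt⟩
    exact this.ne' hIt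
  have hVt : ∀ t > 0, ∀ θ ∈ Ioo 0 Real.pi, dT V (t, θ) = 0 := by
    intro t ht θ hθ
    have h3 := hdens t ht θ hθ
    have h4 := Real.sinh_pos_iff.2 ht
    have h5 := Real.sin_pos_of_mem_Ioo hθ
    rw [stripDensity] at h3
    have h6 := (mul_eq_zero.1 h3).resolve_left (mul_pos h4 h5).ne'
    nlinarith [sq_nonneg (dT V (t, θ)), sq_nonneg (dTh V (t, θ))]
  intro t ht θ hθ
  -- `V` is constant in `t`, and tends to zero
  have hconstV : ∀ s ≥ t, V (s, θ) = V (t, θ) := by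
    intro s hs
    refine (constant_of_derivWithin_zero (f := fun s => V (s, θ)) (a := t) (b := s)
      (fun x hx => ((hasDerivAt_dT hV (lt_of_lt_of_le ht hx.1)).differentiableAt).differentiableWithinAt)
      (fun x hx => ?_)) s ⟨hs, le_rfl⟩
    have hx0 : 0 < x := lt_of_lt_of_le ht hx.1
    have := (hasDerivAt_dT hV (θ := θ) hx0)
    rw [hVt x hx0 θ hθ] at this
    have hne : t < s := lt_of_le_of_lt hx.1 hx.2
    exact this.hasDerivWithinAt.derivWithin (uniqueDiffOn_Icc hne x ⟨hx.1, hx.2.le⟩)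
  refine tendsto_nhds_unique (tendsto_const_nhds.congr' ?_)
    (tendsto_of_expDecay (expDecay_deviation hR h.decay_U) θ)
  filter_upwards [eventually_ge_atTop t] with s hs using (hconstV s hs).symm

end

/-! ### The connection form and its closedness -/

/-- Every point of the chart, off the axis and with `r > R`, is a point of the strip up to a
rotation. -/
theorem exists_sphPt {R : ℝ} (hR : 0 < R) {q : Fin 3 → ℝ} (hq : 0 < q 0) (hr : R < cylRadius q) :
    ∃ t > 0, ∃ θ ∈ Ioo 0 Real.pi, q = sphPt R (t, θ) + q 2 • Pi.single 2 1 := by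
  set w : ℂ := ⟨q 1, q 0⟩ with hw
  have hn : ‖w‖ = cylRadius q := by
    rw [Complex.norm_def, Complex.normSq_mk, cylRadius]; ring_nf
  have harg : 0 < w.arg := by
    refine lt_of_le_of_ne (Complex.arg_nonneg_iff.2 hq.le) fun h => ?_
    have := (Complex.arg_eq_zero_iff.1 h.symm).2
    exact hq.ne' this
  have harg' : w.arg < Real.pi := by
    refine lt_of_le_of_ne (Complex.arg_le_pi w) fun h => ?_
    have := (Complex.arg_eq_pi_iff.1 h).2
    exact hq.ne' this
  have hr0 : 0 < cylRadius q := hR.trans hr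
  refine ⟨Real.log (cylRadius q / R), Real.log_pos ((one_lt_div hR).2 hr), w.arg, ⟨harg, harg'⟩, ?_⟩
  have he : R * Real.exp (Real.log (cylRadius q / R)) = ‖w‖ := by
    rw [Real.exp_log (by positivity), hn]; field_simp
  ext i
  fin_cases i
  · simp [sphPt, he, Complex.norm_mul_sin_arg, hw]
  · simp [sphPt, he, Complex.norm_mul_cos_arg, hw]
  · simp [sphPt]

/-- The covector `ρ B dρ + A dz = B (x dx + y dy) + A dz`, which is smooth on the axis too. -/
def omega (B A : E3 → ℝ) (x : E3) : E3 →L[ℝ] ℝ :=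
  B x • (x 0 • EuclideanSpace.proj (0 : Fin 3) + x 1 • EuclideanSpace.proj (1 : Fin 3))
    + A x • EuclideanSpace.proj (2 : Fin 3)

theorem omega_apply (B A : E3 → ℝ) (x v : E3) :
    omega B A x v = B x * (x 0 * v 0 + x 1 * v 1) + A x * v 2 := by
  simp [omega]; ring

theorem abs_apply_le (x : E3) (i : Fin 3) : |x i| ≤ ‖x‖ := PiLp.norm_apply_le x i

theorem norm_omega_le (B A : E3 → ℝ) (x : E3) : ‖omega B A x‖ ≤ 2 * (|B x| * ‖x‖) + |A x| := by
  refine ContinuousLinearMap.opNorm_le_bound _ (by positivity) fun v => ?_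
  rw [omega_apply, Real.norm_eq_abs]
  have h0 := abs_apply_le v 0
  have h1 := abs_apply_le v 1
  have h2 := abs_apply_le v 2
  have k0 := abs_apply_le x 0
  have k1 := abs_apply_le x 1
  calc |B x * (x 0 * v 0 + x 1 * v 1) + A x * v 2|
      ≤ |B x| * (|x 0| * |v 0| + |x 1| * |v 1|) + |A x| * |v 2| := by
        refine (abs_add_le _ _).trans ?_
        rw [abs_mul, abs_mul, ← abs_mul (x 0), ← abs_mul (x 1)]
        gcongr
        exact abs_add_le _ _
    _ ≤ |B x| * (‖x‖ * ‖v‖ + ‖x‖ * ‖v‖) + |A x| * ‖v‖ := by gcongr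
    _ = (2 * (|B x| * ‖x‖) + |A x|) * ‖v‖ := by ring

section
variable {R : ℝ} {B A : E3 → ℝ}

theorem contDiffOn_omega (hB : ContDiffOn ℝ ∞ B (exterior R)) (hA : ContDiffOn ℝ ∞ A (exterior R)) :
    ContDiffOn ℝ ∞ (omega B A) (exterior R) := by
  have h0 : ContDiff ℝ ∞ fun x : E3 => x 0 := (EuclideanSpace.proj (0 : Fin 3) : E3 →L[ℝ] ℝ).contDiff
  have h1 : ContDiff ℝ ∞ fun x : E3 => x 1 := (EuclideanSpace.proj (1 : Fin 3) : E3 →L[ℝ] ℝ).contDiff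
  exact (hB.smul ((h0.contDiffOn.smul contDiffOn_const).add (h1.contDiffOn.smul contDiffOn_const))).add
    (hA.smul contDiffOn_const)

theorem fderiv_omega {x : E3} (hB : DifferentiableAt ℝ B x) (hA : DifferentiableAt ℝ A x) (u v : E3) :
    fderiv ℝ (omega B A) x u v = fderiv ℝ B x u * (x 0 * v 0 + x 1 * v 1)
      + B x * (u 0 * v 0 + u 1 * v 1) + fderiv ℝ A x u * v 2 := by
  have p : ∀ i : Fin 3, HasFDerivAt (fun y : E3 => y i) (EuclideanSpace.proj i : E3 →L[ℝ] ℝ) x :=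
    fun i => (EuclideanSpace.proj i : E3 →L[ℝ] ℝ).hasFDerivAt
  have h1 : HasFDerivAt (omega B A) _ x :=
    (hB.hasFDerivAt.smul (((p 0).smul_const (EuclideanSpace.proj (0 : Fin 3) : E3 →L[ℝ] ℝ)).add
    ((p 1).smul_const (EuclideanSpace.proj (1 : Fin 3) : E3 →L[ℝ] ℝ)))).add
    (hA.hasFDerivAt.smul_const (EuclideanSpace.proj (2 : Fin 3) : E3 →L[ℝ] ℝ))
  rw [h1.fderiv]
  simp
  ring

/-- An axisymmetric function has no derivative along the orbits of the rotations. -/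
theorem SmoothAxisymmetric.fderiv_apply {f : E3 → ℝ} (hf : SmoothAxisymmetric R f) {q : Fin 3 → ℝ}
    (hq : 0 < q 0) (hr : R < cylRadius q) (u : E3) :
    fderiv ℝ f (cyl q) u = (Real.cos (q 2) * u 0 + Real.sin (q 2) * u 1) *
      pd 0 (fun q => f (cyl q)) q + u 2 * pd 1 (fun q => f (cyl q)) q := by
  have hd := hf.differentiableAt (x := cyl q) (by rwa [norm_cyl])
  have hu : u = (Real.cos (q 2) * u 0 + Real.sin (q 2) * u 1) • cylFrame q 0 + u 2 • cylFrame q 1 +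
      ((-Real.sin (q 2) * u 0 + Real.cos (q 2) * u 1) / q 0) • cylFrame q 2 := by
    have hsc := Real.sin_sq_add_cos_sq (q 2)
    ext i
    fin_cases i
    · simp [cylFrame]; field_simp; linear_combination (-u 0) * hsc
    · simp [cylFrame]; field_simp; linear_combination (-u 1) * hsc
    · simp [cylFrame]
  have h2 := pd_two_eq_zero hf hr.le
  simp only [pd_comp_cyl hd] at h2 ⊢
  conv_lhs => rw [hu]
  simp only [map_add, map_smul, smul_eq_mul, h2]
  ring

/-- The only component of the exterior derivative of `ρ B dρ + A dz` is the twist, by axisymmetry. -/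
theorem fderiv_omega_symm_off_axis (hB : SmoothAxisymmetric R B) (hA : SmoothAxisymmetric R A)
    (hR : 0 < R)
    (htw : ∀ t > 0, ∀ θ ∈ Ioo 0 Real.pi, twist B A (sphPt R (t, θ)) = 0) {q : Fin 3 → ℝ}
    (hq : 0 < q 0) (hr : R < cylRadius q) (u v : E3) :
    fderiv ℝ (omega B A) (cyl q) u v = fderiv ℝ (omega B A) (cyl q) v u := by
  have hn : R < ‖cyl q‖ := by rwa [norm_cyl]
  have key : pd 0 (fun q => A (cyl q)) q = q 0 * pd 1 (fun q => B (cyl q)) q := by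
    obtain ⟨t, ht, θ, hθ, e⟩ := exists_sphPt hR hq hr
    set p := sphPt R (t, θ) with hp
    have hrp : R < cylRadius p := cylRadius_sphPt_gt hR (p := (t, θ)) ht
    have h1 := htw t ht θ hθ
    have h2 : pd 1 (fun q => q 0 * B (cyl q)) p = p 0 * pd 1 (fun q => B (cyl q)) p := by
      have hd : DifferentiableAt ℝ (fun q => B (cyl q)) p :=
        (hB.differentiableAt (by rwa [norm_cyl])).comp p (contDiff_cyl.differentiable (by simp) p)
      have h0 : HasFDerivAt (fun q : Fin 3 → ℝ => q 0)
        (ContinuousLinearMap.proj (R := ℝ) (φ := fun _ => ℝ) (0 : Fin 3)) p :=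
        (ContinuousLinearMap.proj (R := ℝ) (φ := fun _ => ℝ) (0 : Fin 3)).hasFDerivAt
      have := (h0.mul hd.hasFDerivAt).fderiv
      rw [pd]
      erw [this]
      simp [pd]
    rw [twist, h2] at h1
    have hq0 : q 0 = p 0 := by rw [e]; simp
    rw [e, hA.pd_rot hrp, hB.pd_rot hrp, ← e, hq0]
    linarith
  rw [fderiv_omega (hB.differentiableAt hn) (hA.differentiableAt hn),
    fderiv_omega (hB.differentiableAt hn) (hA.differentiableAt hn),
    hB.fderiv_apply hq hr, hB.fderiv_apply hq hr, hA.fderiv_apply hq hr, hA.fderiv_apply hq hr, key]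
  simp only [cyl, Matrix.cons_val_zero, Matrix.cons_val_one]
  ring

/-- Points off the axis accumulate at every point. -/
theorem mem_closure_off_axis (x : E3) : x ∈ closure {y : E3 | rho y ≠ 0} := by
  have : Dense {y : E3 | rho y = 0}ᶜ :=
    MeasureTheory.Measure.dense_of_ae (μ := MeasureTheory.volume)
      (MeasureTheory.measure_eq_zero_iff_ae_notMem.1 volume_axis)
  exact this x

/-- When the twist vanishes, the connection form is closed. -/
theorem fderiv_omega_symm (hB : SmoothAxisymmetric R B) (hA : SmoothAxisymmetric R A)
    (hR : 0 < R)
    (htw : ∀ t > 0, ∀ θ ∈ Ioo 0 Real.pi, twist B A (sphPt R (t, θ)) = 0) {x : E3}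
    (hx : R < ‖x‖) (u v : E3) :
    fderiv ℝ (omega B A) x u v = fderiv ℝ (omega B A) x v u := by
  have hc : ContinuousOn (fderiv ℝ (omega B A)) (openExterior R) :=
    ((contDiffOn_omega hB.smooth hA.smooth).mono fun y (hy : R < ‖y‖) => hy.le).continuousOn_fderiv_of_isOpen
      (isOpen_openExterior R) (by simp)
  have hw : ∀ u v : E3, ContinuousOn (fun y => fderiv ℝ (omega B A) y u v) (openExterior R) :=
    fun u v => (hc.clm_apply continuousOn_const).clm_apply continuousOn_const
  have heq : EqOn (fun y => fderiv ℝ (omega B A) y u v) (fun y => fderiv ℝ (omega B A) y v u)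
      (openExterior R ∩ {y | rho y ≠ 0}) := by
    rintro y ⟨hy, hρ⟩
    obtain ⟨q, hq, rfl⟩ := exists_cyl_eq hρ
    exact fderiv_omega_symm_off_axis hB hA hR htw hq (by rw [← norm_cyl]; exact hy) u v
  exact heq.of_subset_closure (hw u v) (hw v u) inter_subset_left
    ((isOpen_openExterior R).inter_closure.trans' (fun y hy => ⟨hy, mem_closure_off_axis y⟩)) hx

end

/-! ### A primitive of a decaying closed form -/

section
open MeasureTheory

/-- The primitive, vanishing at infinity, of a closed `1`-form `w` on an exterior region: minus the
integral of `w` along the ray from `x` to infinity. -/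
def primitive (w : E3 → E3 →L[ℝ] ℝ) (x : E3) : ℝ := -∫ s in Ioi (1 : ℝ), w (s • x) x

variable {R C : ℝ} {w : E3 → E3 →L[ℝ] ℝ}

theorem smul_mem_exterior {R s : ℝ} {x : E3} (hs : 1 ≤ s) (hx : x ∈ exterior R) :
    s • x ∈ exterior R := by
  change R ≤ ‖s • x‖
  have : R ≤ ‖x‖ := hx
  rw [norm_smul, Real.norm_of_nonneg (by linarith)]
  nlinarith [norm_nonneg x]

theorem rpow_norm_smul {s : ℝ} (hs : 1 ≤ s) (x : E3) (p : ℝ) : ‖s • x‖ ^ p = s ^ p * ‖x‖ ^ p := by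
  rw [norm_smul, Real.norm_of_nonneg (by linarith), Real.mul_rpow (by linarith) (norm_nonneg _)]

/-- The integrand of the primitive decays like `s^(-3/2)`. -/
theorem ray_bound (hC : ∀ x ∈ exterior R, ‖w x‖ ≤ C * ‖x‖ ^ (-3 / 2 : ℝ)) {x : E3}
    (hx : x ∈ exterior R) {s : ℝ} (hs : 1 ≤ s) :
    ‖w (s • x) x‖ ≤ C * ‖x‖ ^ (-3 / 2 : ℝ) * ‖x‖ * s ^ (-3 / 2 : ℝ) := by
  have h1 := hC _ (smul_mem_exterior hs hx)
  rw [rpow_norm_smul hs] at h1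
  refine ((w (s • x)).le_opNorm x).trans ?_
  calc ‖w (s • x)‖ * ‖x‖ ≤ C * (s ^ (-3 / 2 : ℝ) * ‖x‖ ^ (-3 / 2 : ℝ)) * ‖x‖ := by gcongr
    _ = _ := by ring

theorem integrableOn_rpow_Ioi : IntegrableOn (fun s : ℝ => s ^ (-3 / 2 : ℝ)) (Ioi 1) :=
  integrableOn_Ioi_rpow_of_lt (by norm_num) one_pos

theorem continuousOn_ray (hw : ContinuousOn w (exterior R)) {x : E3} (hx : x ∈ exterior R) :
    ContinuousOn (fun s : ℝ => w (s • x)) (Ici 1) :=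
  hw.comp (by fun_prop) fun s (hs : 1 ≤ s) => smul_mem_exterior hs hx

theorem integrableOn_ray (hw : ContinuousOn w (exterior R))
    (hC : ∀ x ∈ exterior R, ‖w x‖ ≤ C * ‖x‖ ^ (-3 / 2 : ℝ)) {x : E3} (hx : x ∈ exterior R) :
    IntegrableOn (fun s : ℝ => w (s • x) x) (Ioi 1) := by
  refine (integrableOn_rpow_Ioi.const_mul (C * ‖x‖ ^ (-3 / 2 : ℝ) * ‖x‖)).mono' ?_ ?_
  · exact (((continuousOn_ray hw hx).clm_apply continuousOn_const).mono
      Ioi_subset_Ici_self).aestronglyMeasurable measurableSet_Ioi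
  · filter_upwards [ae_restrict_mem measurableSet_Ioi] with s hs
    exact ray_bound hC hx (le_of_lt hs)

/-- Along a ray the primitive is an antiderivative of the form. -/
theorem hasDerivWithinAt_primitive_ray (hw : ContinuousOn w (exterior R))
    (hC : ∀ x ∈ exterior R, ‖w x‖ ≤ C * ‖x‖ ^ (-3 / 2 : ℝ)) {x : E3} (hx : x ∈ exterior R) {s : ℝ}
    (hs : 1 ≤ s) :
    HasDerivWithinAt (fun s : ℝ => primitive w (s • x)) (w (s • x) x) (Ici 1) s := by
  have hcont : ContinuousOn (fun s : ℝ => w (s • x) x) (Ici 1) :=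
    (continuousOn_ray hw hx).clm_apply continuousOn_const
  have hform : ∀ s ∈ Ici (1 : ℝ), primitive w (s • x) = primitive w x +
      ∫ u in (1 : ℝ)..s, w (u • x) x := by
    intro s (hs : 1 ≤ s)
    have hs0 : 0 < s := by linarith
    have h1 : (∫ u in Ioi (1 : ℝ), w (u • s • x) (s • x)) = ∫ u in Ioi s, w (u • x) x := by
      have := integral_comp_mul_right_Ioi (fun u => w (u • x) x) 1 hs0
      rw [one_mul] at this
      simp only [smul_smul, map_smul, smul_eq_mul] at this ⊢
      rw [integral_const_mul, this]
      field_simp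
    have h2 := integrableOn_ray hw hC hx
    have h3 := intervalIntegral.integral_interval_add_Ioi (a := 1) (b := s) h2
      (h2.mono_set (Ioi_subset_Ioi hs))
    rw [primitive, primitive, h1, ← h3]
    ring
  refine HasDerivWithinAt.congr (f := fun s => primitive w x + ∫ u in (1 : ℝ)..s, w (u • x) x)
    ?_ hform (hform s hs)
  refine HasDerivWithinAt.const_add _ ?_
  -- extend the integrand continuously to `s < 1`
  set g : ℝ → ℝ := fun u => w (max u 1 • x) x
  have hg : Continuous g := hcont.comp_continuous (f := fun u : ℝ => max u 1) (by fun_prop)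
    fun u => le_max_right u 1
  have h4 := (hg.integral_hasStrictDerivAt 1 s).hasDerivAt.hasDerivWithinAt (s := Ici 1)
  have hgs : g s = w (s • x) x := by simp only [g]; rw [max_eq_left hs]
  rw [hgs] at h4
  have hcongr : ∀ s ∈ Ici (1 : ℝ), (∫ u in (1 : ℝ)..s, w (u • x) x) = ∫ u in (1 : ℝ)..s, g u := by
    intro s hs
    refine intervalIntegral.integral_congr fun u hu => ?_
    rw [uIcc_of_le hs] at hu
    simp only [g]; rw [max_eq_left hu.1]
  exact h4.congr hcongr (hcongr s hs)

/-- A decaying closed form is the differential of its integral along rays. Closedness turns the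
derivative of the integrand `w (s x) x` with respect to `x` into the total derivative
`d/ds (s w (s x))`, whose integral over `s ≥ 1` is `-w x`. -/
theorem hasFDerivAt_primitive (hR : 0 < R) (hw : ContDiffOn ℝ ∞ w (exterior R))
    (hC : ∀ x ∈ exterior R, ‖w x‖ ≤ C * ‖x‖ ^ (-3 / 2 : ℝ))
    {C' T : ℝ} (hC' : ∀ x : E3, T ≤ ‖x‖ → ‖fderiv ℝ w x‖ ≤ C' * ‖x‖ ^ (-5 / 2 : ℝ))
    (hsymm : ∀ x : E3, R < ‖x‖ → ∀ u v, fderiv ℝ w x u v = fderiv ℝ w x v u)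
    {x : E3} (hx : R < ‖x‖) : HasFDerivAt (primitive w) (w x) x := by
  obtain ⟨R', hR', hRx⟩ := exists_between hx
  have hR0 : 0 < R' := hR.trans hR'
  have hwo : ContDiffOn ℝ ∞ w (openExterior R) := hw.mono fun y (hy : R < ‖y‖) => hy.le
  have hcd : ContinuousOn (fderiv ℝ w) (exterior R') :=
    (hwo.continuousOn_fderiv_of_isOpen (isOpen_openExterior R) (by simp)).mono
      fun y (hy : R' ≤ ‖y‖) => hR'.trans_le hy
  obtain ⟨D, hD0, hD⟩ := exists_bound_rpow (F := E3 →L[ℝ] E3 →L[ℝ] ℝ) (f := fderiv ℝ w) hR0 hcd hC'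
  have hdiff : ∀ y : E3, R < ‖y‖ → HasFDerivAt w (fderiv ℝ w y) y := fun y hy =>
    ((hw.contDiffAt (exterior_mem_nhds hy)).differentiableAt (by simp)).hasFDerivAt
  have hsub : exterior R' ⊆ exterior R := fun y (hy : R' ≤ ‖y‖) => hR'.le.trans hy
  obtain ⟨ε, hε, hball⟩ := Metric.mem_nhds_iff.1 (exterior_mem_nhds hRx)
  -- the derivative of the integrand, a total derivative in `s` because the form is closed
  set F' : E3 → ℝ → E3 →L[ℝ] ℝ := fun y s => s • fderiv ℝ w (s • y) y + w (s • y) with hF'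
  have hFd : ∀ y ∈ exterior R', ∀ s : ℝ, 1 ≤ s → HasFDerivAt (fun y => w (s • y) y) (F' y s) y := by
    intro y hy s hs
    have hy' : R < ‖s • y‖ := hR'.trans_le (smul_mem_exterior hs hy)
    have h1 : HasFDerivAt (fun y : E3 => s • y) (s • ContinuousLinearMap.id ℝ E3) y :=
      (hasFDerivAt_id y).const_smul s
    have h2 := ((hdiff _ hy').comp y h1).clm_apply (hasFDerivAt_id y)
    refine h2.congr_fderiv ?_
    ext v
    simp only [hF', add_apply, smul_apply, smul_eq_mul, ContinuousLinearMap.coe_comp,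
      Function.comp_apply, ContinuousLinearMap.flip_apply, ContinuousLinearMap.id_apply, map_smul]
    simp
    rw [hsymm _ hy' v y]
    ring
  have hF'b : ∀ y ∈ exterior R', ∀ s : ℝ, 1 ≤ s →
      ‖F' y s‖ ≤ (D + C) * ‖y‖ ^ (-3 / 2 : ℝ) * s ^ (-3 / 2 : ℝ) := by
    intro y hy s hs
    have hs0 : 0 < s := by linarith
    have hy0 : 0 < ‖y‖ := hR0.trans_le hy
    have h1 := hD _ (smul_mem_exterior hs hy)
    have h2 := hC _ (smul_mem_exterior hs (hsub hy))
    rw [rpow_norm_smul hs] at h1 h2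
    have e1 : s * s ^ (-5 / 2 : ℝ) = s ^ (-3 / 2 : ℝ) := by
      rw [mul_comm, ← Real.rpow_add_one hs0.ne']; norm_num
    have e2 : ‖y‖ * ‖y‖ ^ (-5 / 2 : ℝ) = ‖y‖ ^ (-3 / 2 : ℝ) := by
      rw [mul_comm, ← Real.rpow_add_one hy0.ne']; norm_num
    calc ‖F' y s‖ ≤ s * (‖fderiv ℝ w (s • y)‖ * ‖y‖) + ‖w (s • y)‖ := by
          refine (norm_add_le _ _).trans ?_
          rw [norm_smul, Real.norm_of_nonneg hs0.le]
          gcongr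
          exact (fderiv ℝ w (s • y)).le_opNorm y
      _ ≤ s * (D * (s ^ (-5 / 2 : ℝ) * ‖y‖ ^ (-5 / 2 : ℝ)) * ‖y‖)
          + C * (s ^ (-3 / 2 : ℝ) * ‖y‖ ^ (-3 / 2 : ℝ)) := by gcongr
      _ = D * (s * s ^ (-5 / 2 : ℝ)) * (‖y‖ * ‖y‖ ^ (-5 / 2 : ℝ))
          + C * (s ^ (-3 / 2 : ℝ) * ‖y‖ ^ (-3 / 2 : ℝ)) := by ring
      _ = _ := by rw [e1, e2]; ring
  have hF'c : ContinuousOn (F' x) (Ici 1) := by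
    have h1 : ContinuousOn (fun s : ℝ => fderiv ℝ w (s • x)) (Ici 1) :=
      hcd.comp (by fun_prop) fun s (hs : 1 ≤ s) => smul_mem_exterior hs hRx.le
    exact (continuousOn_id.smul (h1.clm_apply continuousOn_const)).add
      (continuousOn_ray hw.continuousOn hx.le)
  have hF'int : IntegrableOn (F' x) (Ioi 1) := by
    refine (integrableOn_rpow_Ioi.const_mul ((D + C) * ‖x‖ ^ (-3 / 2 : ℝ))).mono'
      ((hF'c.mono Ioi_subset_Ici_self).aestronglyMeasurable measurableSet_Ioi) ?_
    filter_upwards [ae_restrict_mem measurableSet_Ioi] with s hs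
    exact hF'b x hRx.le s (le_of_lt hs)
  have hCnn : 0 ≤ C := by
    have h1 := (norm_nonneg _).trans (hC x hx.le)
    have h2 : 0 < ‖x‖ ^ (-3 / 2 : ℝ) := Real.rpow_pos_of_pos (hR.trans hx) _
    exact nonneg_of_mul_nonneg_left h1 h2
  have main := hasFDerivAt_integral_of_dominated_of_fderiv_le
    (μ := volume.restrict (Ioi (1 : ℝ))) (F := fun y s => w (s • y) y) (F' := F') (x₀ := x)
    (bound := fun s => (D + C) * R' ^ (-3 / 2 : ℝ) * s ^ (-3 / 2 : ℝ))
    (Metric.ball_mem_nhds x hε)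
    (by
      filter_upwards [exterior_mem_nhds hx] with y hy
      exact (integrableOn_ray hw.continuousOn hC hy).aestronglyMeasurable)
    (integrableOn_ray hw.continuousOn hC hx.le) hF'int.aestronglyMeasurable
    (by
      filter_upwards [ae_restrict_mem measurableSet_Ioi] with s hs y hy
      have hy' : R' ≤ ‖y‖ := hball hy
      refine (hF'b y hy' s (le_of_lt hs)).trans ?_
      have : ‖y‖ ^ (-3 / 2 : ℝ) ≤ R' ^ (-3 / 2 : ℝ) :=
        Real.rpow_le_rpow_of_nonpos hR0 hy' (by norm_num)
      have hs1 : (1 : ℝ) < s := hs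
      have : 0 ≤ s ^ (-3 / 2 : ℝ) := Real.rpow_nonneg (by linarith) _
      gcongr)
    (integrableOn_rpow_Ioi.const_mul _)
    (by
      filter_upwards [ae_restrict_mem measurableSet_Ioi] with s hs y hy
      exact hFd y (hball hy) s (le_of_lt hs))
  -- the integral of the total derivative
  have hval : ∫ s in Ioi (1 : ℝ), F' x s = 0 - w x := by
    have hder : ∀ s ∈ Ici (1 : ℝ), HasDerivAt (fun s : ℝ => s • w (s • x)) (F' x s) s := by
      intro s (hs : 1 ≤ s)
      have hy' : R < ‖s • x‖ := hR'.trans_le (smul_mem_exterior hs hRx.le)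
      have h1 : HasDerivAt (fun s : ℝ => s • x) x s := by
        simpa using (hasDerivAt_id s).smul_const x
      have h2 := (hasDerivAt_id s).smul ((hdiff _ hy').comp_hasDerivAt s h1)
      refine h2.congr_deriv ?_
      simp [hF']
    have hlim : Tendsto (fun s : ℝ => s • w (s • x)) atTop (𝓝 0) := by
      have hz : Tendsto (fun s : ℝ => C * ‖x‖ ^ (-3 / 2 : ℝ) * s ^ (-(1 / 2) : ℝ)) atTop (𝓝 0) := by
        simpa using (tendsto_rpow_neg_atTop (y := 1 / 2) (by norm_num)).const_mul
          (C * ‖x‖ ^ (-3 / 2 : ℝ))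
      refine squeeze_zero_norm' ?_ hz
      filter_upwards [eventually_ge_atTop 1] with s hs
      have hs0 : 0 < s := by linarith
      have h2 := hC _ (smul_mem_exterior hs hx.le)
      rw [rpow_norm_smul hs] at h2
      rw [norm_smul, Real.norm_of_nonneg hs0.le]
      have e1 : s * s ^ (-3 / 2 : ℝ) = s ^ (-(1 / 2) : ℝ) := by
        rw [mul_comm, ← Real.rpow_add_one hs0.ne']; norm_num
      calc s * ‖w (s • x)‖ ≤ s * (C * (s ^ (-3 / 2 : ℝ) * ‖x‖ ^ (-3 / 2 : ℝ))) := by gcongr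
        _ = C * ‖x‖ ^ (-3 / 2 : ℝ) * (s * s ^ (-3 / 2 : ℝ)) := by ring
        _ = _ := by rw [e1]
    have := integral_Ioi_of_hasDerivAt_of_tendsto' hder hF'int hlim
    rwa [one_smul, one_smul] at this
  rw [hval] at main
  exact main.neg.congr_fderiv (by simp)

end

/-! ### Smoothness of the primitive up to the boundary -/

section
open MeasureTheory
variable {R C : ℝ} {w : E3 → E3 →L[ℝ] ℝ}

/-- On a radial segment near `x` the increments of the primitive are close to those of `w x`. -/
theorem primitive_ray_increment (hw : ContinuousOn w (exterior R))
    (hC : ∀ x ∈ exterior R, ‖w x‖ ≤ C * ‖x‖ ^ (-3 / 2 : ℝ)) {x y : E3} (hy : y ∈ exterior R)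
    {σ ε : ℝ} (hσ : 1 ≤ σ) (hε : ∀ s ∈ Icc 1 σ, ‖w (s • y) - w x‖ ≤ ε) :
    |primitive w (σ • y) - primitive w y - w x ((σ - 1) • y)| ≤ ε * (‖y‖ * (σ - 1)) := by
  have hd : ∀ s ∈ Icc 1 σ, HasDerivWithinAt (fun s : ℝ => primitive w (s • y) - s • w x y)
      (w (s • y) y - w x y) (Icc 1 σ) s := by
    intro s hs
    refine ((hasDerivWithinAt_primitive_ray hw hC hy hs.1).mono Icc_subset_Ici_self).sub ?_
    simpa using ((hasDerivAt_id s).smul_const (w x y)).hasDerivWithinAt (s := Icc 1 σ)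
  have := Convex.norm_image_sub_le_of_norm_hasDerivWithin_le (C := ε * ‖y‖) hd (fun s hs => by
    rw [← sub_apply]
    refine ((w (s • y) - w x).le_opNorm y).trans ?_
    exact mul_le_mul_of_nonneg_right (hε s hs) (norm_nonneg _)) (convex_Icc 1 σ)
    (left_mem_Icc.2 hσ) (right_mem_Icc.2 hσ)
  rw [Real.norm_eq_abs, Real.norm_eq_abs, abs_of_nonneg (by linarith : 0 ≤ σ - 1)] at this
  calc _ = |primitive w (σ • y) - σ • w x y - (primitive w ((1 : ℝ) • y) - (1 : ℝ) • w x y)| := by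
        congr 1
        simp only [one_smul, map_smul, smul_eq_mul]
        ring
    _ ≤ _ := this.trans (by rw [mul_assoc])

/-- The primitive is differentiable up to the boundary. A boundary point is joined to a nearby point
by two radial segments and a segment between them, which lies in the interior. -/
theorem hasFDerivWithinAt_primitive (hR : 0 < R) (hw : ContinuousOn w (exterior R))
    (hC : ∀ x ∈ exterior R, ‖w x‖ ≤ C * ‖x‖ ^ (-3 / 2 : ℝ))
    (hint : ∀ x : E3, R < ‖x‖ → HasFDerivAt (primitive w) (w x) x) {x : E3} (hx : x ∈ exterior R) :
    HasFDerivWithinAt (primitive w) (w x) (exterior R) x := by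
  have hx0 : 0 < ‖x‖ := hR.trans_le hx
  set K : ℝ := 2 + (2 * ‖x‖ + 1) / R with hK
  have hKpos : 0 < K := by positivity
  rw [hasFDerivWithinAt_iff_isLittleO, Asymptotics.isLittleO_iff]
  intro c hc
  obtain ⟨δ, hδ, hcont⟩ := Metric.continuousWithinAt_iff.1 (hw x hx) (c / K) (by positivity)
  -- the size of the neighbourhood in which all the segments stay close to `x`
  set η : ℝ := min 1 (min (R / 2) (δ / K)) with hη
  have hηpos : 0 < η := by positivity
  have h1 : η ≤ 1 := min_le_left _ _
  have h2 : η ≤ R / 2 := (min_le_right _ _).trans (min_le_left _ _)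
  have h3 : η ≤ δ / K := (min_le_right _ _).trans (min_le_right _ _)
  filter_upwards [self_mem_nhdsWithin, mem_nhdsWithin_of_mem_nhds (Metric.ball_mem_nhds x hηpos)]
    with y hy hyx
  rw [Metric.mem_ball, dist_eq_norm] at hyx
  set d := ‖y - x‖ with hd
  have hd0 : 0 ≤ d := norm_nonneg _
  set σ : ℝ := 1 + d / R with hσ
  have hσ1 : 1 ≤ σ := by rw [hσ]; have : 0 ≤ d / R := by positivity
                         linarith
  have hσR : (σ - 1) * R = d := by rw [hσ]; field_simp; ring
  have hσ2 : σ ≤ 2 := by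
    have : d / R ≤ 1 := by rw [div_le_one hR]; linarith
    rw [hσ]; linarith
  have hyn : ‖y‖ ≤ ‖x‖ + 1 := by
    have := norm_sub_norm_le y x
    linarith
  have hKd : K * d < δ := by
    have := hyx.trans_le h3
    rw [lt_div_iff₀ hKpos] at this
    linarith
  have e0 : (σ - 1) = d / R := by rw [hσ]; ring
  have hnear : ∀ p ∈ exterior R, ‖p - x‖ ≤ K * d → ‖w p - w x‖ ≤ c / K := by
    intro p hp hpx
    have := hcont hp (by rw [dist_eq_norm]; linarith)
    rw [dist_eq_norm] at this
    exact this.le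
  -- the radial segments
  have hray : ∀ p ∈ exterior R, ‖p‖ ≤ ‖x‖ + 1 → ‖p - x‖ ≤ d →
      |primitive w (σ • p) - primitive w p - w x ((σ - 1) • p)| ≤ c / K * (‖p‖ * (σ - 1)) := by
    intro p hp hpn hpx
    refine primitive_ray_increment hw hC hp hσ1 fun s hs => ?_
    refine hnear _ (smul_mem_exterior hs.1 hp) ?_
    have : s • p - x = (s - 1) • p + (p - x) := by rw [sub_smul, one_smul]; abel
    rw [this]
    refine (norm_add_le _ _).trans ?_
    rw [norm_smul, Real.norm_of_nonneg (by linarith [hs.1])]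
    have h5 : (s - 1) * ‖p‖ ≤ d / R * (‖x‖ + 1) := by
      have : s - 1 ≤ d / R := by rw [← e0]; linarith [hs.2]
      have := hs.1
      gcongr
    have h6 : K * d = 2 * d + d / R * (2 * ‖x‖ + 1) := by rw [hK]; field_simp
    have h7 : 0 ≤ d / R * ‖x‖ := by positivity
    rw [h6]; nlinarith
  -- the segment between them
  have hseg : |primitive w (σ • y) - primitive w (σ • x) - w x (σ • y - σ • x)| ≤
      c / K * (2 * d) := by
    rcases eq_or_lt_of_le hd0 with hd0' | hdpos
    · have : y = x := by rw [← sub_eq_zero, ← norm_eq_zero, ← hd, ← hd0']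
      rw [this, ← hd0']; simp
    have hmem : ∀ p ∈ segment ℝ (σ • x) (σ • y), R < ‖p‖ ∧ ‖p - x‖ ≤ K * d := by
      intro p hp
      rw [segment_eq_image'] at hp
      obtain ⟨u, hu, rfl⟩ := hp
      have e1 : σ • x + u • (σ • y - σ • x) = σ • (x + u • (y - x)) := by
        module
      have hlow : R - d / 2 ≤ ‖x + u • (y - x)‖ := by
        rcases le_total u (1 / 2) with hu2 | hu2
        · have := norm_sub_norm_le x (-(u • (y - x)))
          rw [sub_neg_eq_add, norm_neg, norm_smul, Real.norm_of_nonneg hu.1, ← hd] at this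
          have hx' : R ≤ ‖x‖ := hx
          nlinarith
        · have e2 : x + u • (y - x) = y - (1 - u) • (y - x) := by
            rw [sub_smul, one_smul]; abel
          have := norm_sub_norm_le y ((1 - u) • (y - x))
          rw [← e2, norm_smul, Real.norm_of_nonneg (by linarith [hu.2]), ← hd] at this
          have hy' : R ≤ ‖y‖ := hy
          nlinarith
      constructor
      · simp only
        rw [e1, norm_smul, Real.norm_of_nonneg (by linarith)]
        have : σ * (R - d / 2) ≤ σ * ‖x + u • (y - x)‖ := by gcongr
        nlinarith
      · have e2 : σ • x + u • (σ • y - σ • x) - x = (σ - 1) • x + (u * σ) • (y - x) := by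
          module
        simp only
        rw [e2]
        refine (norm_add_le _ _).trans ?_
        rw [norm_smul, norm_smul, Real.norm_of_nonneg (by linarith),
          Real.norm_of_nonneg (mul_nonneg hu.1 (by linarith)), ← hd, e0]
        have h8 : u * σ ≤ 2 := by nlinarith [hu.1, hu.2]
        have h6 : K * d = 2 * d + d / R * (2 * ‖x‖ + 1) := by rw [hK]; field_simp
        have h7 : 0 ≤ d / R * ‖x‖ := by positivity
        have h9 : 0 ≤ d / R := by positivity
        rw [h6]; nlinarith
    have := Convex.norm_image_sub_le_of_norm_hasFDerivWithin_le' (f := primitive w) (f' := w)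
      (φ := w x) (C := c / K) (fun p hp => (hint p (hmem p hp).1).hasFDerivWithinAt)
      (fun p hp => hnear p (hmem p hp).1.le (hmem p hp).2) (convex_segment _ _)
      (left_mem_segment ℝ (σ • x) (σ • y)) (right_mem_segment ℝ _ _)
    rw [Real.norm_eq_abs] at this
    refine this.trans ?_
    have hcK : 0 ≤ c / K := by positivity
    rw [← smul_sub, norm_smul, Real.norm_of_nonneg (by linarith), ← hd]
    gcongr
  have hrx := hray x hx (by linarith) (by simpa using hd0)
  have hry := hray y hy hyn le_rfl
  have hsum : primitive w y - primitive w x - w x (y - x) =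
      (primitive w (σ • x) - primitive w x - w x ((σ - 1) • x))
      + (primitive w (σ • y) - primitive w (σ • x) - w x (σ • y - σ • x))
      - (primitive w (σ • y) - primitive w y - w x ((σ - 1) • y)) := by
    simp only [map_sub, map_smul, smul_eq_mul]; ring
  rw [hsum, Real.norm_eq_abs]
  refine (abs_sub _ _).trans ((add_le_add_left (abs_add_le _ _) _).trans ?_)
  have hcK : 0 < c / K := by positivity
  have hfin : c / K * (‖x‖ * (σ - 1)) + c / K * (2 * d) + c / K * (‖y‖ * (σ - 1)) ≤ c * d := by
    have : ‖x‖ * (σ - 1) + 2 * d + ‖y‖ * (σ - 1) ≤ K * d := by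
      have h6 : K * d = 2 * d + d / R * (2 * ‖x‖ + 1) := by rw [hK]; field_simp
      rw [h6, e0]
      have : 0 ≤ d / R := by positivity
      nlinarith
    calc _ = c / K * (‖x‖ * (σ - 1) + 2 * d + ‖y‖ * (σ - 1)) := by ring
      _ ≤ c / K * (K * d) := by gcongr
      _ = c * d := by field_simp
  linarith

/-- The primitive is as smooth as the form, up to the boundary: its derivative within the exterior
region is the form itself. -/
theorem contDiffOn_primitive (hw : ContDiffOn ℝ ∞ w (exterior R))
    (hd : ∀ x ∈ exterior R, HasFDerivWithinAt (primitive w) (w x) (exterior R) x) :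
    ContDiffOn ℝ ∞ (primitive w) (exterior R) := by
  rw [contDiffOn_infty]
  intro n
  have : ContDiffOn ℝ (n + 1) (primitive w) (exterior R) := by
    rw [contDiffOn_succ_iff_hasFDerivWithinAt (by simp)]
    intro x hx
    refine ⟨exterior R, ?_, fun h => absurd h (by simp), w, hd, contDiffOn_infty.1 hw n⟩
    rw [insert_eq_of_mem hx]
    exact self_mem_nhdsWithin
  exact this.of_le le_self_add

end

/-! ### The isometry onto the Schwarzschild slice in the case of equality -/

section
variable {m₁ : ℝ} {k : ℕ} {U α B A : E3 → ℝ}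

theorem rpow_succ_norm {R : ℝ} (hR : 0 < R) {x : E3} (hx : x ∈ exterior R) {p q : ℝ}
    (h : p + 1 = q) : ‖x‖ ^ p * ‖x‖ = ‖x‖ ^ q := by
  have hx0 : 0 < ‖x‖ := hR.trans_le hx
  rw [← Real.rpow_add_one hx0.ne', h]

theorem IsAxisymmetricData.omega_decay (h : IsAxisymmetricData m₁ k U α B A) (hm : 0 < m₁) :
    ∃ C, ∀ x ∈ exterior (m₁ / 2), ‖omega B A x‖ ≤ C * ‖x‖ ^ (-3 / 2 : ℝ) := by
  have hR : 0 < m₁ / 2 := by positivity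
  obtain ⟨C1, _, h1⟩ := h.decay_B.exists_bound_exterior hR h.smooth_B.smooth.continuousOn
  obtain ⟨C2, _, h2⟩ := h.decay_A.exists_bound_exterior hR h.smooth_A.smooth.continuousOn
  refine ⟨2 * C1 + C2, fun x hx => (norm_omega_le B A x).trans ?_⟩
  have e := rpow_succ_norm hR hx (p := -5 / 2) (q := -3 / 2) (by norm_num)
  calc 2 * (|B x| * ‖x‖) + |A x| ≤ 2 * (C1 * ‖x‖ ^ (-5 / 2 : ℝ) * ‖x‖) + C2 * ‖x‖ ^ (-3 / 2 : ℝ) := by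
        gcongr
        · exact h1 x hx
        · exact h2 x hx
    _ = _ := by rw [mul_assoc C1, e]; ring

theorem IsAxisymmetricData.fderiv_omega_decay (h : IsAxisymmetricData m₁ k U α B A) (hm : 0 < m₁)
    (hk : 5 ≤ k) :
    ∃ C T, ∀ x : E3, T ≤ ‖x‖ → ‖fderiv ℝ (omega B A) x‖ ≤ C * ‖x‖ ^ (-5 / 2 : ℝ) := by
  have hR : 0 < m₁ / 2 := by positivity
  obtain ⟨C1, _, h1⟩ := h.decay_B.exists_bound_exterior hR h.smooth_B.smooth.continuousOn
  obtain ⟨T1, hB⟩ := h.decay_B.exists_bound (j := 1) (by omega)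
  obtain ⟨T2, hA⟩ := h.decay_A.exists_bound (j := 1) (by omega)
  refine ⟨3 + 2 * C1, max (m₁ / 2 + 1) (max T1 T2), fun x hx => ?_⟩
  have hxR : m₁ / 2 < ‖x‖ := by linarith [(le_max_left _ _).trans hx]
  have b1 := hB x ((le_max_left _ _).trans ((le_max_right _ _).trans hx))
  have b2 := hA x ((le_max_right _ _).trans ((le_max_right _ _).trans hx))
  have b3 := h1 x hxR.le
  rw [norm_iteratedFDeriv_one] at b1 b2
  norm_num at b1 b2
  have e := rpow_succ_norm hR (le_of_lt hxR : x ∈ exterior (m₁ / 2)) (p := -7 / 2) (q := -5 / 2)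
    (by norm_num)
  have hp : 0 ≤ ‖x‖ ^ (-5 / 2 : ℝ) := by positivity
  have hC : 0 ≤ (3 + 2 * C1) * ‖x‖ ^ (-5 / 2 : ℝ) := by positivity
  refine ContinuousLinearMap.opNorm_le_bound _ hC fun u => ?_
  refine ContinuousLinearMap.opNorm_le_bound _ (by positivity) fun v => ?_
  rw [fderiv_omega (h.smooth_B.differentiableAt hxR) (h.smooth_A.differentiableAt hxR),
    Real.norm_eq_abs]
  have c1 : |fderiv ℝ B x u| ≤ ‖x‖ ^ (-7 / 2 : ℝ) * ‖u‖ := by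
    refine ((fderiv ℝ B x).le_opNorm u).trans ?_
    have : ‖fderiv ℝ B x‖ ≤ ‖x‖ ^ (-7 / 2 : ℝ) := by convert! b1 using 2; norm_num
    gcongr
  have c2 : |fderiv ℝ A x u| ≤ ‖x‖ ^ (-5 / 2 : ℝ) * ‖u‖ := by
    refine ((fderiv ℝ A x).le_opNorm u).trans ?_
    have : ‖fderiv ℝ A x‖ ≤ ‖x‖ ^ (-5 / 2 : ℝ) := by convert! b2 using 2; norm_num
    gcongr
  have p : ∀ y z : E3, |y 0 * z 0 + y 1 * z 1| ≤ 2 * (‖y‖ * ‖z‖) := by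
    intro y z
    have h0 := abs_apply_le y 0
    have h1 := abs_apply_le y 1
    have k0 := abs_apply_le z 0
    have k1 := abs_apply_le z 1
    calc _ ≤ |y 0| * |z 0| + |y 1| * |z 1| := by
          rw [← abs_mul, ← abs_mul]; exact abs_add_le _ _
      _ ≤ ‖y‖ * ‖z‖ + ‖y‖ * ‖z‖ := by gcongr
      _ = _ := by ring
  calc _ ≤ |fderiv ℝ B x u| * |x 0 * v 0 + x 1 * v 1| + |B x| * |u 0 * v 0 + u 1 * v 1|
        + |fderiv ℝ A x u| * |v 2| := by
        rw [← abs_mul, ← abs_mul, ← abs_mul]; exact abs_add_three _ _ _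
    _ ≤ (‖x‖ ^ (-7 / 2 : ℝ) * ‖u‖) * (2 * (‖x‖ * ‖v‖)) + (C1 * ‖x‖ ^ (-5 / 2 : ℝ)) * (2 * (‖u‖ * ‖v‖))
        + (‖x‖ ^ (-5 / 2 : ℝ) * ‖u‖) * ‖v‖ := by
        have := p x v
        have := p u v
        have := abs_apply_le v 2
        gcongr
    _ = 2 * (‖x‖ ^ (-7 / 2 : ℝ) * ‖x‖) * (‖u‖ * ‖v‖)
        + (2 * C1 + 1) * ‖x‖ ^ (-5 / 2 : ℝ) * (‖u‖ * ‖v‖) := by ring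
    _ = _ := by rw [e]; ring

theorem rot_add (s t : ℝ) (x : E3) : rot s (rot t x) = rot (s + t) x := by
  ext i
  fin_cases i <;> simp [rot, Real.cos_add, Real.sin_add] <;> ring

theorem rot_zero (x : E3) : rot 0 x = x := by
  ext i
  fin_cases i <;> simp [rot]

theorem rot_smul (t s : ℝ) (x : E3) : rot t (s • x) = s • rot t x := by
  ext i
  fin_cases i <;> simp [rot] <;> ring

theorem rot_mem_exterior {R : ℝ} (t : ℝ) {x : E3} (hx : x ∈ exterior R) : rot t x ∈ exterior R := by
  change R ≤ ‖rot t x‖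
  rw [norm_rot]; exact hx

theorem omega_rot {R : ℝ} (hB : SmoothAxisymmetric R B) (hA : SmoothAxisymmetric R A) (t : ℝ)
    {x : E3} (hx : x ∈ exterior R) (v : E3) :
    omega B A (rot t x) (rot t v) = omega B A x v := by
  rw [omega_apply, omega_apply, hB.axisymmetric t x hx, hA.axisymmetric t x hx]
  simp [rot]
  left
  linear_combination (x 0 * v 0 + x 1 * v 1) * Real.sin_sq_add_cos_sq t

theorem primitive_rot {R : ℝ} (hB : SmoothAxisymmetric R B) (hA : SmoothAxisymmetric R A) (t : ℝ)
    {x : E3} (hx : x ∈ exterior R) : primitive (omega B A) (rot t x) = primitive (omega B A) x := by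
  rw [primitive, primitive]
  congr 1
  refine MeasureTheory.setIntegral_congr_fun measurableSet_Ioi fun s hs => ?_
  rw [← rot_smul, omega_rot hB hA t (smul_mem_exterior (le_of_lt hs) hx)]

theorem contDiffOn_rot {S : Set E3} {l : E3 → ℝ} (hl : ContDiffOn ℝ ∞ l S) :
    ContDiffOn ℝ ∞ (fun x => rot (l x) x) S := by
  have hc : ∀ i : Fin 3, ContDiff ℝ ∞ fun x : E3 => x i := fun i =>
    (EuclideanSpace.proj i : E3 →L[ℝ] ℝ).contDiff
  refine contDiffOn_piLp' 2 fun i => ?_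
  fin_cases i
  · exact (hl.cos.mul (hc 0).contDiffOn).sub (hl.sin.mul (hc 1).contDiffOn)
  · exact (hl.sin.mul (hc 0).contDiffOn).add (hl.cos.mul (hc 1).contDiffOn)
  · exact (hc 2).contDiffOn

/-- The differential of the rotation by a variable angle `l`: it adds to `v` the multiple `dl(v)` of
the Killing field `∂_φ`, and then rotates. -/
theorem fderiv_rot {x : E3} {l : E3 → ℝ} {l' : E3 →L[ℝ] ℝ} (hl : HasFDerivAt l l' x) (v : E3) :
    fderiv ℝ (fun x => rot (l x) x) x v = rot (l x) (v + l' v • !₂[-x 1, x 0, 0]) := by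
  have hc : ∀ i : Fin 3, HasFDerivAt (fun x : E3 => x i) (EuclideanSpace.proj i : E3 →L[ℝ] ℝ) x :=
    fun i => (EuclideanSpace.proj i : E3 →L[ℝ] ℝ).hasFDerivAt
  have e0 := (hl.cos.mul (hc 0)).sub (hl.sin.mul (hc 1))
  have e1 := (hl.sin.mul (hc 0)).add (hl.cos.mul (hc 1))
  have hd : DifferentiableAt ℝ (fun x => rot (l x) x) x := by
    rw [differentiableAt_piLp]
    intro i
    fin_cases i
    · exact e0.differentiableAt
    · exact e1.differentiableAt
    · exact (hc 2).differentiableAt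
  have hcomp : ∀ i : Fin 3, fderiv ℝ (fun x => rot (l x) x) x v i =
      fderiv ℝ (fun x => rot (l x) x i) x v := by
    intro i
    have := HasFDerivAt.comp x (f := fun x => rot (l x) x)
      (EuclideanSpace.proj i : E3 →L[ℝ] ℝ).hasFDerivAt hd.hasFDerivAt
    exact (congrArg (fun L => L v) this.fderiv).symm
  ext i
  rw [hcomp]
  fin_cases i
  · refine (congrArg (fun L => L v) e0.fderiv).trans ?_
    simp [rot]; ring
  · refine (congrArg (fun L => L v) e1.fderiv).trans ?_
    simp [rot]; ring
  · refine (congrArg (fun L => L v) (hc 2).fderiv).trans ?_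
    simp [rot]

theorem inner_rot (t : ℝ) (v w : E3) : inner ℝ (rot t v) (rot t w) = inner ℝ v w := by
  simp [PiLp.inner_apply, Fin.sum_univ_three, rot]
  linear_combination (v 0 * w 0 + v 1 * w 1) * Real.sin_sq_add_cos_sq t

/-- If `V`, `α` and the twist vanish, then the map `x ↦ rot (λ x) x`, where `λ` is the primitive of
`ρ B dρ + A dz`, pulls `dφ` back to `dφ + ρ B dρ + A dz`, so that it is an isometry onto the
Schwarzschild slice. Its inverse is the rotation by `-λ`, because `λ` is axisymmetric. -/
theorem IsAxisymmetricData.isSchwarzschildSlice (h : IsAxisymmetricData m₁ k U α B A) (hm : 0 < m₁)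
    (hk : 5 ≤ k)
    (hV : ∀ t > 0, ∀ θ ∈ Ioo 0 Real.pi, deviation (m₁ / 2) U (t, θ) = 0)
    (htw : ∀ t > 0, ∀ θ ∈ Ioo 0 Real.pi, twist B A (sphPt (m₁ / 2) (t, θ)) = 0)
    (hα : ∀ t ≥ 0, ∀ θ ∈ Icc 0 Real.pi, strip (m₁ / 2) α (t, θ) = 0) :
    IsSchwarzschildSlice (m₁ / 2) (metric U α B A) := by
  have hR : 0 < m₁ / 2 := by positivity
  set R := m₁ / 2 with hRdef
  set w := omega B A with hw
  set l := primitive w with hl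
  have hws := contDiffOn_omega h.smooth_B.smooth h.smooth_A.smooth
  obtain ⟨C, hC⟩ := h.omega_decay hm
  obtain ⟨C', T, hC'⟩ := h.fderiv_omega_decay hm hk
  have hint : ∀ x : E3, R < ‖x‖ → HasFDerivAt l (w x) x := fun x hx =>
    hasFDerivAt_primitive hR hws hC hC'
      (fun y hy u v => fderiv_omega_symm h.smooth_B h.smooth_A hR htw hy u v) hx
  have hls : ContDiffOn ℝ ∞ l (exterior R) := contDiffOn_primitive hws fun x hx =>
    hasFDerivWithinAt_primitive hR hws.continuousOn hC hint hx
  have hlrot : ∀ t : ℝ, ∀ x ∈ exterior R, l (rot t x) = l x := fun t x hx =>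
    primitive_rot h.smooth_B h.smooth_A t hx
  refine ⟨m₁, hm, fun x => rot (l x) x, fun x => rot (-l x) x, contDiffOn_rot hls,
    contDiffOn_rot hls.neg, fun x hx => rot_mem_exterior _ hx, fun x hx => rot_mem_exterior _ hx,
    ⟨fun x hx => ?_, fun x hx => ?_⟩, fun t x hx => ?_, fun x hx hρ v v' => ?_⟩
  · simp only [hlrot _ x hx, rot_add]
    rw [neg_add_cancel, rot_zero]
  · simp only [hlrot _ x hx, rot_add]
    rw [add_neg_cancel, rot_zero]
  · simp only [hlrot _ x hx, rot_add]
    rw [add_comm]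
  · have hx' : R < ‖x‖ := hx
    have hx0 : 0 < ‖x‖ := hR.trans hx'
    rw [fderiv_rot (hint x hx'), fderiv_rot (hint x hx'), schwarzschild, norm_rot, inner_rot]
    -- the values of the potentials
    have hUx : U x = -2 * Real.log (1 + R / ‖x‖) ∧ α x = 0 := by
      obtain ⟨q, hq, rfl⟩ := exists_cyl_eq hρ
      have hr : R < cylRadius q := by rwa [norm_cyl] at hx'
      obtain ⟨t, ht, θ, hθ, e⟩ := exists_sphPt hR hq hr
      have hrp : R < cylRadius (sphPt R (t, θ)) := cylRadius_sphPt_gt hR (p := (t, θ)) ht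
      have h1 := hV t ht θ hθ
      have h2 := hα t ht.le θ (Ioo_subset_Icc_self hθ)
      have h3 : U (cyl q) = strip R U (t, θ) := by rw [e, h.smooth_U.comp_cyl_add hrp.le]; rfl
      have h4 : α (cyl q) = strip R α (t, θ) := by rw [e, h.smooth_α.comp_cyl_add hrp.le]; rfl
      refine ⟨?_, h4.trans h2⟩
      rw [deviation] at h1
      have hn : ‖cyl q‖ = R * Real.exp t := by
        rw [norm_cyl, e, cylRadius_add_single, cylRadius_sphPt hR]
      have h5 : R / ‖cyl q‖ = Real.exp (-t) := by rw [hn, Real.exp_neg]; field_simp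
      rw [h3, h5]; simp only at h1; linarith
    have hexp : Real.exp (-2 * U x) = (1 + m₁ / (2 * ‖x‖)) ^ 4 := by
      have hpos : 0 < 1 + R / ‖x‖ := by positivity
      rw [hUx.1, show -2 * (-2 * Real.log (1 + R / ‖x‖)) = (4 : ℕ) * Real.log (1 + R / ‖x‖) by
        push_cast; ring, Real.exp_nat_mul, Real.exp_log hpos, hRdef]
      congr 2
      field_simp
    rw [metric, hUx.2, mul_zero, add_zero, hexp]
    have hρ2 : rho x ^ 2 = x 0 ^ 2 + x 1 ^ 2 := Real.sq_sqrt (by positivity)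
    have hinner : inner ℝ (v + w x v • !₂[-x 1, x 0, 0]) (v' + w x v' • !₂[-x 1, x 0, 0]) =
        v 0 * v' 0 + v 1 * v' 1 + v 2 * v' 2 + (x 0 * v 1 - x 1 * v 0) * w x v'
        + (x 0 * v' 1 - x 1 * v' 0) * w x v + (x 0 ^ 2 + x 1 ^ 2) * (w x v * w x v') := by
      simp [PiLp.inner_apply, Fin.sum_univ_three]; ring
    have hconn : ∀ v, rho x ^ 2 * connForm B A x v = x 0 * v 1 - x 1 * v 0 + rho x ^ 2 * w x v := by
      intro v
      rw [connForm, dPhi, dRho, hw, omega_apply]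
      field_simp
      ring
    have hmain : rho x ^ 2 * (rho x ^ 2 * (connForm B A x v * connForm B A x v')) =
        (x 0 * v 1 - x 1 * v 0 + rho x ^ 2 * w x v) * (x 0 * v' 1 - x 1 * v' 0 + rho x ^ 2 * w x v') := by
      rw [← hconn, ← hconn]; ring
    have hdr : rho x ^ 2 * (dRho x v * dRho x v') = (x 0 * v 0 + x 1 * v 1) * (x 0 * v' 0 + x 1 * v' 1) := by
      rw [dRho, dRho]; field_simp
    rw [hinner]
    apply mul_left_cancel₀ (pow_ne_zero 2 hρ)
    have goal : rho x ^ 2 * (v 0 * v' 0 + v 1 * v' 1 + v 2 * v' 2 + (x 0 * v 1 - x 1 * v 0) * w x v'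
        + (x 0 * v' 1 - x 1 * v' 0) * w x v + (x 0 ^ 2 + x 1 ^ 2) * (w x v * w x v')) =
        rho x ^ 2 * (dRho x v * dRho x v') + rho x ^ 2 * (v 2 * v' 2) +
        rho x ^ 2 * (rho x ^ 2 * (connForm B A x v * connForm B A x v')) := by
      rw [hmain, hdr, hρ2]; ring
    linear_combination (1 + m₁ / (2 * ‖x‖)) ^ 4 * goal

end

/-! ### Conformal maps of planar domains -/

section Conformal
variable {S : Set (Fin 3 → ℝ)} {a b : (Fin 3 → ℝ) → ℝ}

theorem pd_congr_on {f g : (Fin 3 → ℝ) → ℝ} (hS : IsOpen S) (h : EqOn f g S) {q : Fin 3 → ℝ}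
    (hq : q ∈ S) (i : Fin 3) : pd i f q = pd i g q :=
  pd_congr (by filter_upwards [hS.mem_nhds hq] with p hp using h hp)

/-- The logarithm of the modulus of a conformal map of the half-plane is harmonic. The relations
expressing conformality are differentiated, which needs no choice of orientation. -/
theorem laplacian_log_of_conformal (hS : IsOpen S) (ha : ContDiffOn ℝ ∞ a S)
    (hb : ContDiffOn ℝ ∞ b S)
    (h1 : ∀ q ∈ S, pd 0 a q * pd 0 a q + pd 0 b q * pd 0 b q
      = pd 1 a q * pd 1 a q + pd 1 b q * pd 1 b q)
    (h2 : ∀ q ∈ S, pd 0 a q * pd 1 a q + pd 0 b q * pd 1 b q = 0)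
    (h3 : ∀ q ∈ S, 0 < pd 0 a q * pd 0 a q + pd 0 b q * pd 0 b q)
    (h4 : ∀ q ∈ S, 0 < a q * a q + b q * b q) {q : Fin 3 → ℝ} (hq : q ∈ S) :
    pd 0 (pd 0 fun q => Real.log (a q * a q + b q * b q)) q
      + pd 1 (pd 1 fun q => Real.log (a q * a q + b q * b q)) q = 0 := by
  have dif : ∀ {f : (Fin 3 → ℝ) → ℝ}, ContDiffOn ℝ ∞ f S → ∀ p ∈ S, DifferentiableAt ℝ f p :=
    fun hf p hp => (hf.contDiffAt (hS.mem_nhds hp)).differentiableAt (by simp)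
  have sa := fun i => contDiffOn_pd hS ha i
  have sb := fun i => contDiffOn_pd hS hb i
  have da := dif ha
  have db := dif hb
  have da' := fun i => dif (sa i)
  have db' := fun i => dif (sb i)
  have prod : ∀ {f g : (Fin 3 → ℝ) → ℝ} (i : Fin 3), ContDiffOn ℝ ∞ f S → ContDiffOn ℝ ∞ g S →
      ∀ p ∈ S, pd i (fun q => f q * g q) p = pd i f p * g p + f p * pd i g p :=
    fun i hf hg p hp => pd_mul (dif hf p hp) (dif hg p hp)
  have sum2 : ∀ {f g h k : (Fin 3 → ℝ) → ℝ} (i : Fin 3), ContDiffOn ℝ ∞ f S →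
      ContDiffOn ℝ ∞ g S → ContDiffOn ℝ ∞ h S → ContDiffOn ℝ ∞ k S →
      ∀ p ∈ S, pd i (fun q => f q * g q + h q * k q) p =
        pd i f p * g p + f p * pd i g p + (pd i h p * k p + h p * pd i k p) := by
    intro f g h k i hf hg hh hk p hp
    rw [pd_add (dif (hf.mul hg) p hp) (dif (hh.mul hk) p hp), prod i hf hg p hp, prod i hh hk p hp]
  have ca : pd 1 (pd 0 a) q = pd 0 (pd 1 a) q := pd_comm (ha.contDiffAt (hS.mem_nhds hq)) _ _
  have cb : pd 1 (pd 0 b) q = pd 0 (pd 1 b) q := pd_comm (hb.contDiffAt (hS.mem_nhds hq)) _ _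
  -- the differentiated conformality relations
  have e10 := pd_congr_on hS h1 hq 0
  have e11 := pd_congr_on hS h1 hq 1
  have e20 := pd_congr_on hS (g := fun _ => 0) h2 hq 0
  have e21 := pd_congr_on hS (g := fun _ => 0) h2 hq 1
  rw [sum2 0 (sa 0) (sa 0) (sb 0) (sb 0) q hq, sum2 0 (sa 1) (sa 1) (sb 1) (sb 1) q hq] at e10
  rw [sum2 1 (sa 0) (sa 0) (sb 0) (sb 0) q hq, sum2 1 (sa 1) (sa 1) (sb 1) (sb 1) q hq, ca, cb] at e11
  rw [sum2 0 (sa 0) (sa 1) (sb 0) (sb 1) q hq, pd_const] at e20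
  rw [sum2 1 (sa 0) (sa 1) (sb 0) (sb 1) q hq, pd_const, ca, cb] at e21
  have k1 := h1 q hq
  have k2 := h2 q hq
  have k3 := h3 q hq
  have k4 := h4 q hq
  set a0 := pd 0 a q
  set a1 := pd 1 a q
  set b0 := pd 0 b q
  set b1 := pd 1 b q
  set Da := pd 0 (pd 0 a) q + pd 1 (pd 1 a) q with hDa
  set Db := pd 0 (pd 0 b) q + pd 1 (pd 1 b) q with hDb
  have f0 : a0 * Da + b0 * Db = 0 := by
    rw [hDa, hDb]; linear_combination e10 / 2 + e21
  have f1 : a1 * Da + b1 * Db = 0 := by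
    rw [hDa, hDb]; linear_combination e20 - e11 / 2
  have hJ : (a0 * b1 - a1 * b0) ^ 2 = (a0 * a0 + b0 * b0) ^ 2 := by
    linear_combination (-(a0 * a0 + b0 * b0)) * k1 - (a0 * a1 + b0 * b1) * k2
  have hJ0 : a0 * b1 - a1 * b0 ≠ 0 := by
    intro h; rw [h] at hJ
    have := pow_pos k3 2
    nlinarith
  have hDa0 : Da = 0 := by
    have : (a0 * b1 - a1 * b0) * Da = 0 := by linear_combination b1 * f0 - b0 * f1
    exact (mul_eq_zero.1 this).resolve_left hJ0
  have hDb0 : Db = 0 := by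
    have : (a0 * b1 - a1 * b0) * Db = 0 := by linear_combination a0 * f1 - a1 * f0
    exact (mul_eq_zero.1 this).resolve_left hJ0
  -- the logarithm
  set L : (Fin 3 → ℝ) → ℝ := fun q => a q * a q + b q * b q with hL
  set G : (Fin 3 → ℝ) → ℝ := fun q => Real.log (L q) with hG
  have sL : ContDiffOn ℝ ∞ L S := (ha.mul ha).add (hb.mul hb)
  have sG : ContDiffOn ℝ ∞ G S := sL.log fun p hp => (h4 p hp).ne'
  have hLi : ∀ i, ∀ p ∈ S, pd i L p = 2 * (a p * pd i a p + b p * pd i b p) := by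
    intro i p hp
    rw [hL, sum2 i ha ha hb hb p hp]; ring
  have hLG : ∀ i, ∀ p ∈ S, L p * pd i G p = 2 * (a p * pd i a p + b p * pd i b p) := by
    intro i p hp
    have hpos := h4 p hp
    have h5 := pd_exp (i := i) (dif sG p hp)
    have h6 : pd i (fun q => Real.exp (G q)) p = pd i L p :=
      pd_congr_on hS (fun q hq => Real.exp_log (h4 q hq)) hp i
    have h7 : Real.exp (G p) = L p := Real.exp_log hpos
    rw [← hLi i p hp, ← h6, h5, h7]
  have second : ∀ i, pd i L q * pd i G q + L q * pd i (pd i G) q =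
      2 * (pd i a q * pd i a q + a q * pd i (pd i a) q
        + (pd i b q * pd i b q + b q * pd i (pd i b) q)) := by
    intro i
    have h5 := pd_congr_on hS (hLG i) hq i
    rw [prod i sL (contDiffOn_pd hS sG i) q hq, pd_const_mul 2
      (dif ((ha.mul (sa i)).add (hb.mul (sb i))) q hq), sum2 i ha (sa i) hb (sb i) q hq] at h5
    exact h5
  have s0 := second 0
  have s1 := second 1
  rw [hLi _ q hq] at s0 s1
  have g0 := hLG 0 q hq
  have g1 := hLG 1 q hq
  have hLq : L q = a q * a q + b q * b q := rfl
  have hL0 : 0 < L q := k4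
  have key : L q * (L q * (pd 0 (pd 0 G) q + pd 1 (pd 1 G) q)) = 0 := by
    have t0 : L q * (L q * pd 0 (pd 0 G) q) = L q * (2 * (a0 * a0 + a q * pd 0 (pd 0 a) q
        + (b0 * b0 + b q * pd 0 (pd 0 b) q))) - (2 * (a q * a0 + b q * b0)) ^ 2 := by
      linear_combination L q * s0 - (2 * (a q * a0 + b q * b0)) * g0
    have t1 : L q * (L q * pd 1 (pd 1 G) q) = L q * (2 * (a1 * a1 + a q * pd 1 (pd 1 a) q
        + (b1 * b1 + b q * pd 1 (pd 1 b) q))) - (2 * (a q * a1 + b q * b1)) ^ 2 := by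
      linear_combination L q * s1 - (2 * (a q * a1 + b q * b1)) * g1
    have hgrad : (a q * a0 + b q * b0) ^ 2 + (a q * a1 + b q * b1) ^ 2 =
        L q * (a0 * a0 + b0 * b0) := by
      -- `(a₀, b₀)` and `(a₁, b₁)` are orthogonal of the same length
      have hl := k3.ne'
      have hX : (a0 * a0 + b0 * b0) * (a q * a1 + b q * b1) =
          (a0 * b1 - a1 * b0) * (b q * a0 - a q * b0) := by
        linear_combination (a q * a0 + b q * b0) * k2
      have hX2 : (a q * a1 + b q * b1) ^ 2 = (b q * a0 - a q * b0) ^ 2 := by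
        apply mul_left_cancel₀ (pow_ne_zero 2 hl)
        rw [← mul_pow, hX, mul_pow, hJ]
      rw [hX2, hLq]; ring
    rw [mul_add, mul_add, t0, t1]
    linear_combination 2 * L q * a q * hDa0 + 2 * L q * b q * hDb0 - 4 * hgrad - 2 * L q * k1
  have := (mul_eq_zero.1 key).resolve_left hL0.ne'
  exact (mul_eq_zero.1 this).resolve_left hL0.ne'

end Conformal

/-! ### Isometries onto a Schwarzschild slice -/

/-- The Killing field `∂_φ` of the rotations about the axis. -/
def killing (x : E3) : E3 := !₂[-x 1, x 0, 0]

/-- The map `F`, with inverse `F'`, is an isometry onto a Schwarzschild slice. -/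
structure IsSliceMap (R μ : ℝ) (g : E3 → E3 → E3 → ℝ) (F F' : E3 → E3) : Prop where
  smooth : ContDiffOn ℝ ∞ F (exterior R)
  smooth' : ContDiffOn ℝ ∞ F' (exterior (μ / 2))
  mapsTo : MapsTo F (exterior R) (exterior (μ / 2))
  mapsTo' : MapsTo F' (exterior (μ / 2)) (exterior R)
  invOn : InvOn F' F (exterior R) (exterior (μ / 2))
  rot_comm : ∀ t : ℝ, ∀ x ∈ exterior R, F (rot t x) = rot t (F x)
  isometry : ∀ x ∈ openExterior R, rho x ≠ 0 → ∀ v w : E3,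
      schwarzschild μ (F x) (fderiv ℝ F x v) (fderiv ℝ F x w) = g x v w

theorem rho_sq (x : E3) : rho x ^ 2 = x 0 ^ 2 + x 1 ^ 2 := Real.sq_sqrt (by positivity)

theorem rho_le_norm (x : E3) : rho x ≤ ‖x‖ := by
  rw [EuclideanSpace.norm_eq]
  refine Real.sqrt_le_sqrt ?_
  simp [Fin.sum_univ_three]
  positivity

theorem norm_sq_eq (x : E3) : ‖x‖ ^ 2 = rho x * rho x + x 2 * x 2 := by
  rw [EuclideanSpace.norm_eq, Real.sq_sqrt (Finset.sum_nonneg fun _ _ => by positivity), ← sq (rho x),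
    rho_sq]
  simp [Fin.sum_univ_three]
  ring

theorem hasDerivAt_rot (x : E3) : HasDerivAt (fun t => rot t x) (killing x) 0 := by
  have key : HasDerivAt (fun t => fun i => rot t x i) (fun i => killing x i) 0 := by
    rw [hasDerivAt_pi]
    have hc := Real.hasDerivAt_cos 0
    have hs := Real.hasDerivAt_sin 0
    rw [Real.sin_zero, neg_zero] at hc
    rw [Real.cos_zero] at hs
    intro i
    fin_cases i
    · exact ((hc.mul_const (x 0)).sub (hs.mul_const (x 1))).congr_deriv (by simp [killing])
    · exact ((hs.mul_const (x 0)).add (hc.mul_const (x 1))).congr_deriv (by simp [killing])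
    · exact hasDerivAt_const _ _
  exact (PiLp.hasFDerivAt_toLp 2 (𝕜 := ℝ) _).comp_hasDerivAt (0 : ℝ) key

/-- The Euclidean metric splits orthogonally into the half-plane `φ = const` and the direction of the
orbits of the rotations. -/
theorem inner_eq_meridian {y : E3} (hy : rho y ≠ 0) (u v : E3) : inner ℝ u v =
    dRho y u * dRho y v + u 2 * v 2 + inner ℝ u (killing y) * inner ℝ v (killing y) / rho y ^ 2 := by
  have h := rho_sq y
  rw [dRho, dRho]
  simp [PiLp.inner_apply, Fin.sum_univ_three, killing]
  field_simp
  rw [h]; ring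

/-- The covector `dρ` as a continuous linear form. -/
def dRhoL (x : E3) : E3 →L[ℝ] ℝ :=
  (rho x)⁻¹ • (x 0 • EuclideanSpace.proj (0 : Fin 3) + x 1 • EuclideanSpace.proj (1 : Fin 3))

theorem dRhoL_apply (x v : E3) : dRhoL x v = dRho x v := by
  simp [dRhoL, dRho]; ring

theorem hasFDerivAt_rho {x : E3} (hx : rho x ≠ 0) : HasFDerivAt rho (dRhoL x) x := by
  have hne : x 0 ^ 2 + x 1 ^ 2 ≠ 0 := by rw [← rho_sq]; exact pow_ne_zero 2 hx
  have hc : ∀ i : Fin 3, HasFDerivAt (fun x : E3 => x i) (EuclideanSpace.proj i : E3 →L[ℝ] ℝ) x :=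
    fun i => (EuclideanSpace.proj i : E3 →L[ℝ] ℝ).hasFDerivAt
  refine (HasFDerivAt.sqrt (((hc 0).pow 2).add ((hc 1).pow 2)) hne).congr_fderiv ?_
  ext v
  have hs : Real.sqrt (x 0 ^ 2 + x 1 ^ 2) = rho x := rfl
  rw [dRhoL_apply, dRho]
  simp [hs]
  field_simp

section
variable {m₁ μ : ℝ} {k : ℕ} {U α B A : E3 → ℝ} {F F' : E3 → E3}

/-- The conformal factor of the Schwarzschild slice at the image point. -/
def psi (μ : ℝ) (F : E3 → E3) (x : E3) : ℝ := 1 + μ / (2 * ‖F x‖)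

section
variable {R : ℝ} {g : E3 → E3 → E3 → ℝ} (hF : IsSliceMap R μ g F F')
include hF

theorem IsSliceMap.differentiableAt {x : E3} (hx : R < ‖x‖) : DifferentiableAt ℝ F x :=
  (hF.smooth.contDiffAt (exterior_mem_nhds hx)).differentiableAt (by simp)

theorem IsSliceMap.norm_pos (hμ : 0 < μ) {x : E3} (hx : x ∈ exterior R) : 0 < ‖F x‖ := by
  have : μ / 2 ≤ ‖F x‖ := hF.mapsTo hx
  linarith

theorem IsSliceMap.psi_bounds (hμ : 0 < μ) {x : E3} (hx : x ∈ exterior R) :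
    1 ≤ psi μ F x ∧ psi μ F x ≤ 2 := by
  have h1 := hF.norm_pos hμ hx
  have h2 : μ / 2 ≤ ‖F x‖ := hF.mapsTo hx
  have h3 : 0 ≤ μ / (2 * ‖F x‖) := by positivity
  have h4 : μ / (2 * ‖F x‖) ≤ 1 := by rw [div_le_one (by positivity)]; linarith
  unfold psi
  constructor <;> linarith

/-- The isometry commutes with the rotations, hence preserves their generator. -/
theorem IsSliceMap.fderiv_killing {x : E3} (hx : R < ‖x‖) :
    fderiv ℝ F x (killing x) = killing (F x) := by
  have h0 : HasFDerivAt F (fderiv ℝ F x) (rot 0 x) := by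
    rw [rot_zero]; exact (hF.differentiableAt hx).hasFDerivAt
  have h1 := h0.comp_hasDerivAt 0 (hasDerivAt_rot x)
  have h2 : F ∘ (fun t => rot t x) = fun t => rot t (F x) := funext fun t => hF.rot_comm t x hx.le
  rw [h2] at h1
  exact h1.unique (hasDerivAt_rot (F x))

/-- The isometry maps the boundary to the boundary: at an interior image point the modulus of the
inverse would be minimal, while its differential is onto. -/
theorem IsSliceMap.norm_boundary (hR : 0 < R) {x : E3} (hx : ‖x‖ = R) : ‖F x‖ = μ / 2 := by
  have hxm : x ∈ exterior R := hx.ge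
  have hle : μ / 2 ≤ ‖F x‖ := hF.mapsTo hxm
  by_contra hne
  have hlt : μ / 2 < ‖F x‖ := lt_of_le_of_ne hle (Ne.symm hne)
  have hd' : HasFDerivAt F' (fderiv ℝ F' (F x)) (F x) :=
    ((hF.smooth'.contDiffAt (exterior_mem_nhds hlt)).differentiableAt (by simp)).hasFDerivAt
  have hinv : F' (F x) = x := hF.invOn.1 hxm
  have hmin : IsLocalMin (fun y => ‖F' y‖ ^ 2) (F x) := by
    filter_upwards [exterior_mem_nhds hlt] with y hy
    have : R ≤ ‖F' y‖ := hF.mapsTo' hy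
    rw [hinv, hx]
    gcongr
  have hgrad := hmin.hasFDerivAt_eq_zero hd'.norm_sq
  -- differentiate `F' (F ((1 + s) x)) = (1 + s) x` at `s = 0`
  have hray : HasDerivWithinAt (fun s : ℝ => s • x) x (Ici 1) 1 := by
    simpa using ((hasDerivAt_id (1 : ℝ)).smul_const x).hasDerivWithinAt
  have hFd : HasFDerivWithinAt F (fderivWithin ℝ F (exterior R) x) (exterior R) ((1 : ℝ) • x) := by
    rw [one_smul]
    exact ((hF.smooth x hxm).differentiableWithinAt (by simp)).hasFDerivWithinAt
  have h1 := hFd.comp_hasDerivWithinAt 1 hray fun s hs => smul_mem_exterior hs hxm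
  have hd'' : HasFDerivAt F' (fderiv ℝ F' (F x)) ((F ∘ fun s : ℝ => s • x) 1) := by
    simpa using hd'
  have h2 := hd''.comp_hasDerivWithinAt 1 h1
  have h3 : HasDerivWithinAt (fun s : ℝ => s • x)
      (fderiv ℝ F' (F x) (fderivWithin ℝ F (exterior R) x x)) (Ici 1) 1 := by
    refine h2.congr (fun s hs => ?_) ?_
    · exact (hF.invOn.1 (smul_mem_exterior hs hxm)).symm
    · exact (hF.invOn.1 (smul_mem_exterior le_rfl hxm)).symm
  have h4 := (uniqueDiffOn_Ici (1 : ℝ) 1 self_mem_Ici).eq_deriv _ h3 hray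
  have h5 := congrArg (fun L => L (fderivWithin ℝ F (exterior R) x x)) hgrad
  simp only [hinv, smul_apply, ContinuousLinearMap.comp_apply, h4, zero_apply] at h5
  simp [hx, hR.ne'] at h5

end

section
variable (hF : IsSliceMap (m₁ / 2) μ (metric U α B A) F F')
include hF

/-- The lengths of the orbits of the rotations agree. -/
theorem IsSliceMap.orbit {x : E3} (hx : m₁ / 2 < ‖x‖) (hρ : rho x ≠ 0) :
    psi μ F x ^ 4 * rho (F x) ^ 2 = rho x ^ 2 * Real.exp (-2 * U x) := by
  have h := hF.isometry x hx hρ (killing x) (killing x)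
  rw [hF.fderiv_killing hx, schwarzschild] at h
  have e1 : inner ℝ (killing (F x)) (killing (F x)) = rho (F x) ^ 2 := by
    rw [rho_sq, real_inner_self_eq_norm_sq, EuclideanSpace.norm_sq_eq]
    simp [Fin.sum_univ_three, killing]; ring
  have e2 : dRho x (killing x) = 0 := by rw [dRho, div_eq_zero_iff]; left; simp [killing]; ring
  have e3 : dPhi x (killing x) = 1 := by
    rw [dPhi, div_eq_one_iff_eq (pow_ne_zero 2 hρ), rho_sq]; simp [killing]; ring
  have e4 : killing x 2 = 0 := rfl
  rw [e1, metric, connForm, e2, e3, e4] at h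
  rw [psi]
  linarith

theorem IsSliceMap.rho_pos {x : E3} (hx : m₁ / 2 < ‖x‖) (hρ : rho x ≠ 0) :
    0 < rho (F x) := by
  have h := hF.orbit hx hρ
  refine lt_of_le_of_ne (Real.sqrt_nonneg _) fun h0 => ?_
  rw [← h0] at h
  have : 0 < rho x ^ 2 * Real.exp (-2 * U x) := by positivity
  simp at h
  exact hρ h

/-- The induced map of the half-planes of orbits is conformal: `F` preserves the Killing field and the
lengths of its orbits, hence also the parts of the metrics orthogonal to them. -/
theorem IsSliceMap.meridian (hμ : 0 < μ) {x : E3} (hx : m₁ / 2 < ‖x‖) (hρ : rho x ≠ 0) (v w : E3) :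
    psi μ F x ^ 4 * (dRho (F x) (fderiv ℝ F x v) * dRho (F x) (fderiv ℝ F x w)
      + fderiv ℝ F x v 2 * fderiv ℝ F x w 2) =
    Real.exp (-2 * U x + 2 * α x) * (dRho x v * dRho x w + v 2 * w 2) := by
  have ho := hF.orbit hx hρ
  have hr := hF.rho_pos hx hρ
  have hp := (hF.psi_bounds hμ hx.le).1
  have hp4 : psi μ F x ^ 4 ≠ 0 := by positivity
  have hk : ∀ v, psi μ F x ^ 4 * inner ℝ (fderiv ℝ F x v) (killing (F x)) =
      rho x ^ 2 * Real.exp (-2 * U x) * connForm B A x v := by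
    intro v
    have h := hF.isometry x hx hρ v (killing x)
    rw [hF.fderiv_killing hx, schwarzschild] at h
    have e2 : dRho x (killing x) = 0 := by rw [dRho, div_eq_zero_iff]; left; simp [killing]; ring
    have e3 : dPhi x (killing x) = 1 := by
      rw [dPhi, div_eq_one_iff_eq (pow_ne_zero 2 hρ), rho_sq]; simp [killing]; ring
    have e4 : killing x 2 = 0 := rfl
    have e5 : connForm B A x (killing x) = 1 := by rw [connForm, e2, e3, e4]; ring
    rw [metric, e2, e4, e5] at h
    rw [psi]
    linarith
  have h := hF.isometry x hx hρ v w
  rw [schwarzschild, inner_eq_meridian hr.ne', metric] at h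
  change psi μ F x ^ 4 * _ = _ at h
  have hkk : psi μ F x ^ 4 * (inner ℝ (fderiv ℝ F x v) (killing (F x)) *
      inner ℝ (fderiv ℝ F x w) (killing (F x)) / rho (F x) ^ 2) =
      rho x ^ 2 * Real.exp (-2 * U x) * (connForm B A x v * connForm B A x w) := by
    have hN : rho x ^ 2 * Real.exp (-2 * U x) ≠ 0 := by positivity
    rw [← mul_div_assoc, div_eq_iff (pow_ne_zero 2 hr.ne')]
    apply mul_left_cancel₀ hp4
    calc _ = (psi μ F x ^ 4 * inner ℝ (fderiv ℝ F x v) (killing (F x))) *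
          (psi μ F x ^ 4 * inner ℝ (fderiv ℝ F x w) (killing (F x))) := by ring
      _ = (rho x ^ 2 * Real.exp (-2 * U x)) * (rho x ^ 2 * Real.exp (-2 * U x)) *
          (connForm B A x v * connForm B A x w) := by rw [hk, hk]; ring
      _ = _ := by rw [← ho]; ring
  linarith

end

end

/-! ### The harmonic function of the isometry -/

section
variable {m₁ μ : ℝ} {k : ℕ} {U α B A : E3 → ℝ} {F F' : E3 → E3}

/-- The interior points of the cylindrical chart, off the axis. -/
def offAxis (R : ℝ) : Set (Fin 3 → ℝ) := {q | 0 < q 0 ∧ R < cylRadius q}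

theorem isOpen_offAxis (R : ℝ) : IsOpen (offAxis R) :=
  (isOpen_lt continuous_const (continuous_apply 0)).inter (isOpen_openChart R)

/-- The factor of the conformal map of the half-planes of orbits. -/
def conformalFactor (μ : ℝ) (F : E3 → E3) (U α : E3 → ℝ) (x : E3) : ℝ :=
  Real.exp (-2 * U x + 2 * α x) / psi μ F x ^ 4

theorem dRho_cylFrame {q : Fin 3 → ℝ} (hq : 0 < q 0) (i : Fin 3) :
    dRho (cyl q) (cylFrame q i) = ![1, 0, 0] i := by
  have h1 := Real.sin_sq_add_cos_sq (q 2)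
  rw [dRho, rho_cyl hq, div_eq_iff hq.ne']
  fin_cases i <;> simp [cylFrame, cyl] <;> first | ring1 | linear_combination q 0 * h1

section
variable (hF : IsSliceMap (m₁ / 2) μ (metric U α B A) F F')
include hF

theorem IsSliceMap.contDiffOn_rho :
    ContDiffOn ℝ ∞ (fun q => rho (F (cyl q))) (offAxis (m₁ / 2)) := by
  have hc : ContDiffOn ℝ ∞ (fun q => F (cyl q)) (offAxis (m₁ / 2)) :=
    hF.smooth.comp contDiff_cyl.contDiffOn fun q hq => by
      change _ ≤ ‖cyl q‖; rw [norm_cyl]; exact hq.2.le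
  have hi : ∀ i : Fin 3, ContDiffOn ℝ ∞ (fun q => F (cyl q) i) (offAxis (m₁ / 2)) := fun i =>
    (EuclideanSpace.proj i : E3 →L[ℝ] ℝ).contDiff.comp_contDiffOn hc
  refine (((hi 0).pow 2).add ((hi 1).pow 2)).sqrt fun q hq => ?_
  have h := hF.rho_pos (x := cyl q) (by rw [norm_cyl]; exact hq.2) (by rw [rho_cyl hq.1]; exact hq.1.ne')
  have := rho_sq (F (cyl q))
  have h2 : 0 < rho (F (cyl q)) ^ 2 := by positivity
  rw [this] at h2
  exact h2.ne'

theorem IsSliceMap.contDiffOn_height :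
    ContDiffOn ℝ ∞ (fun q => F (cyl q) 2) (offAxis (m₁ / 2)) := by
  have hc : ContDiffOn ℝ ∞ (fun q => F (cyl q)) (offAxis (m₁ / 2)) :=
    hF.smooth.comp contDiff_cyl.contDiffOn fun q hq => by
      change _ ≤ ‖cyl q‖; rw [norm_cyl]; exact hq.2.le
  exact (EuclideanSpace.proj (2 : Fin 3) : E3 →L[ℝ] ℝ).contDiff.comp_contDiffOn hc

theorem IsSliceMap.pd_rho {q : Fin 3 → ℝ} (hq : q ∈ offAxis (m₁ / 2)) (i : Fin 3) :
    pd i (fun q => rho (F (cyl q))) q = dRho (F (cyl q)) (fderiv ℝ F (cyl q) (cylFrame q i)) := by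
  have hx : m₁ / 2 < ‖cyl q‖ := by rw [norm_cyl]; exact hq.2
  have hr := hF.rho_pos hx (by rw [rho_cyl hq.1]; exact hq.1.ne')
  have h1 := (hasFDerivAt_rho hr.ne').comp (cyl q) (hF.differentiableAt hx).hasFDerivAt
  have h2 := pd_comp_cyl (f := fun x => rho (F x)) (q := q) h1.differentiableAt i
  rw [h2]
  have h3 : fderiv ℝ (fun x => rho (F x)) (cyl q) = _ := h1.fderiv
  rw [h3, ← dRhoL_apply]; rfl

theorem IsSliceMap.pd_height {q : Fin 3 → ℝ} (hq : q ∈ offAxis (m₁ / 2)) (i : Fin 3) :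
    pd i (fun q => F (cyl q) 2) q = fderiv ℝ F (cyl q) (cylFrame q i) 2 := by
  have hx : m₁ / 2 < ‖cyl q‖ := by rw [norm_cyl]; exact hq.2
  have h1 := ((EuclideanSpace.proj (2 : Fin 3) : E3 →L[ℝ] ℝ).hasFDerivAt (x := F (cyl q))).comp (cyl q)
    (hF.differentiableAt hx).hasFDerivAt
  have h2 := pd_comp_cyl (f := fun x => F x 2) (q := q) h1.differentiableAt i
  rw [h2]
  have h3 : fderiv ℝ (fun x => F x 2) (cyl q) = _ := h1.fderiv
  rw [h3]; rfl

/-- Conformality of the map `(ρ, z) ↦ (ρ ∘ F, z ∘ F)`, in components. -/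
theorem IsSliceMap.conformal (hμ : 0 < μ) {q : Fin 3 → ℝ} (hq : q ∈ offAxis (m₁ / 2)) (i j : Fin 3) :
    pd i (fun q => rho (F (cyl q))) q * pd j (fun q => rho (F (cyl q))) q
      + pd i (fun q => F (cyl q) 2) q * pd j (fun q => F (cyl q) 2) q =
    conformalFactor μ F U α (cyl q) *
      (![1, 0, 0] i * ![1, 0, 0] j + ![0, 1, 0] i * ![0, 1, 0] j : ℝ) := by
  have hx : m₁ / 2 < ‖cyl q‖ := by rw [norm_cyl]; exact hq.2
  have h := hF.meridian hμ hx (by rw [rho_cyl hq.1]; exact hq.1.ne') (cylFrame q i) (cylFrame q j)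
  have hp := (hF.psi_bounds hμ hx.le).1
  have dz : ∀ i, cylFrame q i 2 = ![0, 1, 0] i := by
    intro i; fin_cases i <;> simp [cylFrame]
  rw [dRho_cylFrame hq.1, dRho_cylFrame hq.1, dz, dz] at h
  rw [hF.pd_rho hq, hF.pd_rho hq, hF.pd_height hq, hF.pd_height hq, conformalFactor, div_mul_eq_mul_div,
    eq_div_iff (by positivity), mul_comm]
  exact h

theorem IsSliceMap.conformal_relations (hμ : 0 < μ) {q : Fin 3 → ℝ} (hq : q ∈ offAxis (m₁ / 2)) :
    0 < conformalFactor μ F U α (cyl q) ∧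
    pd 0 (fun q => rho (F (cyl q))) q * pd 0 (fun q => rho (F (cyl q))) q
      + pd 0 (fun q => F (cyl q) 2) q * pd 0 (fun q => F (cyl q) 2) q =
        conformalFactor μ F U α (cyl q) ∧
    pd 1 (fun q => rho (F (cyl q))) q * pd 1 (fun q => rho (F (cyl q))) q
      + pd 1 (fun q => F (cyl q) 2) q * pd 1 (fun q => F (cyl q) 2) q =
        conformalFactor μ F U α (cyl q) ∧
    pd 0 (fun q => rho (F (cyl q))) q * pd 1 (fun q => rho (F (cyl q))) q
      + pd 0 (fun q => F (cyl q) 2) q * pd 1 (fun q => F (cyl q) 2) q = 0 := by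
  have hx : m₁ / 2 < ‖cyl q‖ := by rw [norm_cyl]; exact hq.2
  have hp := (hF.psi_bounds hμ hx.le).1
  refine ⟨by unfold conformalFactor; positivity, ?_, ?_, ?_⟩
  · rw [hF.conformal hμ hq]; simp
  · rw [hF.conformal hμ hq]; simp
  · rw [hF.conformal hμ hq]; simp

theorem IsSliceMap.laplacian_log (hμ : 0 < μ) {q : Fin 3 → ℝ} (hq : q ∈ offAxis (m₁ / 2)) :
    pd 0 (pd 0 fun q => Real.log (‖F (cyl q)‖ ^ 2)) q
      + pd 1 (pd 1 fun q => Real.log (‖F (cyl q)‖ ^ 2)) q = 0 := by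
  simp only [norm_sq_eq]
  refine laplacian_log_of_conformal (isOpen_offAxis _) hF.contDiffOn_rho hF.contDiffOn_height
    (fun p hp => ?_) (fun p hp => (hF.conformal_relations hμ hp).2.2.2) (fun p hp => ?_) (fun p hp => ?_) hq
  · obtain ⟨_, h1, h2, _⟩ := hF.conformal_relations hμ hp
    rw [h1, h2]
  · obtain ⟨h0, h1, _⟩ := hF.conformal_relations hμ hp
    rw [h1]; exact h0
  · rw [← norm_sq_eq]
    have := hF.norm_pos hμ (x := cyl p) (by change _ ≤ ‖cyl p‖; rw [norm_cyl]; exact hp.2.le)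
    positivity

end

/-- The logarithm of `(|x| / R) / (|F x| / (μ / 2))` in the strip. The norm of `F x` is squared so that
smoothness is that of `‖·‖²`. -/
def logRatio (R μ : ℝ) (F : E3 → E3) (p : ℝ × ℝ) : ℝ :=
  p.1 - 1 / 2 * Real.log (‖F (cyl (sphPt R p))‖ ^ 2) + Real.log (μ / 2)

theorem logRatio_eq {R μ : ℝ} {F : E3 → E3} {p : ℝ × ℝ} :
    logRatio R μ F p = p.1 - Real.log ‖F (cyl (sphPt R p))‖ + Real.log (μ / 2) := by
  rw [logRatio, Real.log_pow]; push_cast; ring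

section
variable (hF : IsSliceMap (m₁ / 2) μ (metric U α B A) F F') (hm : 0 < m₁) (hμ : 0 < μ)
include hF hm hμ

omit hm in
theorem IsSliceMap.contDiffOn_logNorm :
    ContDiffOn ℝ ∞ (fun x => Real.log (‖F x‖ ^ 2)) (exterior (m₁ / 2)) := by
  refine (hF.smooth.norm_sq ℝ).log fun x hx => ?_
  have := hF.norm_pos hμ hx
  positivity

theorem IsSliceMap.contDiffOn_logRatio : ContDiffOn ℝ ∞ (logRatio (m₁ / 2) μ F) halfStrip := by
  have h := contDiffOn_strip (R := m₁ / 2) (by positivity) (hF.contDiffOn_logNorm hμ)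
  exact (contDiff_fst.contDiffOn.sub (contDiffOn_const.mul h)).add contDiffOn_const

/-- Both `t` and `log |F|` are harmonic in `(t, θ)`, the latter because the induced map of half-planes
is conformal. -/
theorem IsSliceMap.harmonic_logRatio {t θ : ℝ} (ht : 0 < t) (hθ : θ ∈ Ioo 0 Real.pi) :
    dT (dT (logRatio (m₁ / 2) μ F)) (t, θ) + dTh (dTh (logRatio (m₁ / 2) μ F)) (t, θ) = 0 := by
  have hR : 0 < m₁ / 2 := by positivity
  have hs := hF.contDiffOn_logRatio hm hμ
  set G : (Fin 3 → ℝ) → ℝ := fun q => Real.log (‖F (cyl q)‖ ^ 2) with hG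
  have hn := hF.contDiffOn_logNorm hμ
  have hg : ContDiffOn ℝ ∞ G (openChart (m₁ / 2)) :=
    (contDiffOn_comp_cyl hn).mono fun q (hq : m₁ / 2 < cylRadius q) => hq.le
  have hgs : ContDiffOn ℝ ∞ (fun p => G (sphPt (m₁ / 2) p)) halfStrip := contDiffOn_strip hR hn
  have hlap := laplacian_comp_sphPt hR hgs hg (θ := θ) ht
  rw [hF.laplacian_log hμ (sphPt_mem hR ht hθ), mul_zero] at hlap
  have eT : ∀ s > 0, dT (logRatio (m₁ / 2) μ F) (s, θ) =
      1 - 1 / 2 * dT (fun p => G (sphPt (m₁ / 2) p)) (s, θ) := by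
    intro s hs0
    apply dT_eq_of_hasDerivAt hs hs0
    exact ((hasDerivAt_id s).sub ((hasDerivAt_dT hgs hs0).const_mul (1 / 2))).add_const
      (Real.log (μ / 2))
  have eTh : ∀ φ, dTh (logRatio (m₁ / 2) μ F) (t, φ) =
      -(1 / 2 * dTh (fun p => G (sphPt (m₁ / 2) p)) (t, φ)) := by
    intro φ
    apply dTh_eq_of_hasDerivAt hs ht.le
    exact (((hasDerivAt_dTh hgs ht.le).const_mul (1 / 2)).const_sub t).add_const (Real.log (μ / 2))
  have eTT : dT (dT (logRatio (m₁ / 2) μ F)) (t, θ) =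
      -(1 / 2 * dT (dT (fun p => G (sphPt (m₁ / 2) p))) (t, θ)) := by
    apply dT_eq_of_hasDerivAt (contDiffOn_dT hs) ht
    refine (((hasDerivAt_dT (contDiffOn_dT hgs) ht).const_mul (1 / 2)).const_sub 1).congr_of_eventuallyEq ?_
    filter_upwards [eventually_gt_nhds ht] with s hs0 using eT s hs0
  have eThTh : dTh (dTh (logRatio (m₁ / 2) μ F)) (t, θ) =
      -(1 / 2 * dTh (dTh (fun p => G (sphPt (m₁ / 2) p))) (t, θ)) := by
    apply dTh_eq_of_hasDerivAt (contDiffOn_dTh hs) ht.le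
    refine ((hasDerivAt_dTh (contDiffOn_dTh hgs) ht.le).const_mul (1 / 2)).neg.congr_of_eventuallyEq ?_
    exact Eventually.of_forall eTh
  rw [eTT, eThTh]
  linarith

omit hm hμ in
/-- The reflection `θ ↦ -θ` is the rotation by `π` about the axis, with which `F` commutes. -/
theorem IsSliceMap.norm_reflect (hm : 0 < m₁) {t : ℝ} (ht : 0 ≤ t) (θ : ℝ) :
    ‖F (cyl (sphPt (m₁ / 2) (t, -θ)))‖ = ‖F (cyl (sphPt (m₁ / 2) (t, θ)))‖ := by
  have e : cyl (sphPt (m₁ / 2) (t, -θ)) = rot Real.pi (cyl (sphPt (m₁ / 2) (t, θ))) := by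
    ext i
    fin_cases i <;> simp [cyl, sphPt, rot]
  rw [e, hF.rot_comm _ _ (cyl_sphPt_mem (by positivity) (p := (t, θ)) ht), norm_rot]

omit hF hm hμ in
theorem eq_zero_of_hasDerivAt_of_even {f : ℝ → ℝ} {d c : ℝ} (h : HasDerivAt f d c)
    (he : ∀ s, f (c - s) = f (c + s)) : d = 0 := by
  have h0 : HasDerivAt f d (c + 0) := by simpa using h
  have h0' : HasDerivAt f d (c - 0) := by simpa using h
  have h1 : HasDerivAt (fun s => f (c + s)) d 0 := by
    exact (HasDerivAt.comp (0 : ℝ) h0 ((hasDerivAt_id (0 : ℝ)).const_add c)).congr_deriv (by simp)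
  have h2 : HasDerivAt (fun s => f (c - s)) (-d) 0 := by
    exact (HasDerivAt.comp (0 : ℝ) h0' ((hasDerivAt_id (0 : ℝ)).const_sub c)).congr_deriv (by simp)
  have h3 : (fun s => f (c - s)) = fun s => f (c + s) := funext he
  rw [h3] at h2
  have := h1.unique h2
  linarith

/-- The function is even in `θ` across both halves of the axis, which gives the Neumann condition at
the sides of the strip. -/
theorem IsSliceMap.dTh_logRatio_axis {t : ℝ} (ht : 0 ≤ t) :
    dTh (logRatio (m₁ / 2) μ F) (t, 0) = 0 ∧ dTh (logRatio (m₁ / 2) μ F) (t, Real.pi) = 0 := by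
  have hs := hF.contDiffOn_logRatio hm hμ
  constructor
  · refine eq_zero_of_hasDerivAt_of_even (hasDerivAt_dTh hs ht) fun s => ?_
    rw [logRatio_eq, logRatio_eq, zero_sub, zero_add, hF.norm_reflect hm ht]
  · refine eq_zero_of_hasDerivAt_of_even (hasDerivAt_dTh hs ht) fun s => ?_
    have e : sphPt (m₁ / 2) (t, Real.pi - s) = sphPt (m₁ / 2) (t, -(Real.pi + s)) := by
      ext i
      fin_cases i
      · simp [sphPt, Real.sin_add, Real.sin_pi_sub]
      · simp [sphPt, Real.cos_add, Real.cos_pi_sub]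
      · rfl
    rw [logRatio_eq, logRatio_eq, e, hF.norm_reflect hm ht]

end

end

/-! ### The modulus of the isometry -/

theorem log_sq_le {s a : ℝ} (ha : 0 < a) (hs : a / 2 ≤ s) (h1 : s ≤ 1) :
    Real.log s ^ 2 ≤ 16 * ((2 : ℝ) ^ (1 / 2 : ℝ) * a ^ (-1 / 2 : ℝ)) := by
  have s0 : 0 < s := by linarith
  have hlog : Real.log s⁻¹ ≤ s⁻¹ ^ (1 / 4 : ℝ) / (1 / 4) :=
    Real.log_le_rpow_div (by positivity) (by norm_num)
  have hpos : 0 ≤ Real.log s⁻¹ := Real.log_nonneg ((one_le_inv₀ s0).2 h1)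
  have e1 : Real.log s ^ 2 = Real.log s⁻¹ ^ 2 := by rw [Real.log_inv]; ring
  have e2 : (s⁻¹ ^ (1 / 4 : ℝ)) ^ 2 = s⁻¹ ^ (1 / 2 : ℝ) := by
    rw [← Real.rpow_mul_natCast (by positivity)]; norm_num
  have e3 : (2 : ℝ) ^ (1 / 2 : ℝ) * a ^ (-1 / 2 : ℝ) = (2 / a) ^ (1 / 2 : ℝ) := by
    rw [Real.div_rpow (by norm_num) ha.le, neg_div, Real.rpow_neg ha.le]; rfl
  have e4 : s⁻¹ ≤ 2 / a := by
    rw [inv_le_comm₀ s0 (by positivity), inv_div]; exact hs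
  calc Real.log s ^ 2 ≤ (s⁻¹ ^ (1 / 4 : ℝ) / (1 / 4)) ^ 2 := by rw [e1]; gcongr
    _ = 16 * s⁻¹ ^ (1 / 2 : ℝ) := by rw [div_pow, e2]; ring
    _ ≤ _ := by rw [e3]; gcongr

/-- An integrable majorant of `log (sin θ) ^ 2` on `(0, π)`. -/
def logSinBound (θ : ℝ) : ℝ :=
  16 * ((2 : ℝ) ^ (1 / 2 : ℝ) * (θ ^ (-1 / 2 : ℝ) + (Real.pi - θ) ^ (-1 / 2 : ℝ)))

theorem log_sin_sq_le {θ : ℝ} (hθ : θ ∈ Ioo 0 Real.pi) :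
    Real.log (Real.sin θ) ^ 2 ≤ logSinBound θ := by
  have hpi : (1 / 2 : ℝ) ≤ 2 / Real.pi := by
    rw [div_le_div_iff₀ (by norm_num) Real.pi_pos]; linarith [Real.pi_le_four]
  have h0 := hθ.1
  have h1 : 0 < Real.pi - θ := by linarith [hθ.2]
  have k0 : 0 ≤ θ ^ (-1 / 2 : ℝ) := by positivity
  have k1 : 0 ≤ (Real.pi - θ) ^ (-1 / 2 : ℝ) := by positivity
  rcases le_total θ (Real.pi / 2) with h | h
  · have hs := Real.mul_le_sin h0.le h
    refine (log_sq_le h0 (by nlinarith) (Real.sin_le_one _)).trans ?_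
    unfold logSinBound
    gcongr
    linarith
  · have hs := Real.mul_le_sin h1.le (by linarith)
    rw [Real.sin_pi_sub] at hs
    refine (log_sq_le h1 (by nlinarith) (Real.sin_le_one _)).trans ?_
    unfold logSinBound
    gcongr
    linarith

theorem intervalIntegrable_logSinBound :
    IntervalIntegrable logSinBound MeasureTheory.volume 0 Real.pi := by
  have h1 : IntervalIntegrable (fun θ : ℝ => θ ^ (-1 / 2 : ℝ)) MeasureTheory.volume 0 Real.pi :=
    intervalIntegral.intervalIntegrable_rpow' (by norm_num)
  have h2 := h1.symm.comp_sub_left Real.pi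
  simp only [sub_zero, sub_self] at h2
  exact ((h1.add h2).const_mul _).const_mul _

theorem inner_eq_rho_mul {y : E3} (hy : rho y ≠ 0) (w : E3) :
    inner ℝ y w = rho y * dRho y w + y 2 * w 2 := by
  rw [dRho, mul_div_cancel₀ _ hy]
  simp [PiLp.inner_apply, Fin.sum_univ_three]
  ring

theorem dRho_self {x : E3} (hx : rho x ≠ 0) : dRho x x = rho x := by
  rw [dRho, div_eq_iff hx, ← sq (rho x), rho_sq]; ring

section
variable {m₁ μ : ℝ} {k : ℕ} {U α B A : E3 → ℝ} {F F' : E3 → E3}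

theorem IsAxisymmetricData.exists_bound (h : IsAxisymmetricData m₁ k U α B A) (hm : 0 < m₁) :
    ∃ C, ∀ x ∈ exterior (m₁ / 2), |U x| ≤ C ∧ |α x| ≤ C := by
  have hR : 0 < m₁ / 2 := by positivity
  obtain ⟨C, hC0, hC⟩ := h.decay_U.exists_bound_exterior hR h.smooth_U.smooth.continuousOn
  obtain ⟨D, hD0, hD⟩ := h.decay_α.exists_bound_exterior hR h.smooth_α.smooth.continuousOn
  refine ⟨max (C * (m₁ / 2) ^ (-1 / 2 : ℝ)) (D * (m₁ / 2) ^ (-1 / 2 : ℝ)), fun x hx => ?_⟩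
  have : ‖x‖ ^ (-1 / 2 : ℝ) ≤ (m₁ / 2) ^ (-1 / 2 : ℝ) :=
    Real.rpow_le_rpow_of_nonpos hR hx (by norm_num)
  constructor
  · refine (hC x hx).trans (le_trans ?_ (le_max_left _ _)); gcongr
  · refine (hD x hx).trans (le_trans ?_ (le_max_right _ _)); gcongr

theorem rho_cyl_sphPt_pos {R : ℝ} (hR : 0 < R) {t θ : ℝ} (hθ : θ ∈ Ioo 0 Real.pi) :
    rho (cyl (sphPt R (t, θ))) = R * Real.exp t * Real.sin θ := by
  have hs := Real.sin_pos_of_mem_Ioo hθ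
  rw [rho_cyl (by simp only [sphPt, Matrix.cons_val_zero]; positivity)]
  rfl

section
variable (hF : IsSliceMap (m₁ / 2) μ (metric U α B A) F F') (hm : 0 < m₁) (hμ : 0 < μ) {C : ℝ}
  (hC : ∀ x ∈ exterior (m₁ / 2), |U x| ≤ C ∧ |α x| ≤ C)
include hF hμ hC

/-- The conformal factors are bounded, so the lengths of the orbits bound `ρ ∘ F` below. -/
theorem IsSliceMap.rho_ge {x : E3} (hx : m₁ / 2 < ‖x‖) (hρ : rho x ≠ 0) :
    Real.exp (-C) / 4 * rho x ≤ rho (F x) := by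
  have ho := hF.orbit hx hρ
  obtain ⟨p1, p2⟩ := hF.psi_bounds hμ hx.le
  have hU := (abs_le.1 (hC x hx.le).1).2
  have hr := hF.rho_pos hx hρ
  have hp : psi μ F x ^ 4 ≤ 2 ^ 4 := by gcongr
  have he : Real.exp (-C) ^ 2 ≤ Real.exp (-2 * U x) := by
    rw [← Real.exp_nat_mul]; apply Real.exp_le_exp.2; push_cast; linarith
  refine le_of_sq_le_sq ?_ hr.le
  have h1 : psi μ F x ^ 4 * rho (F x) ^ 2 ≤ 2 ^ 4 * rho (F x) ^ 2 := by gcongr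
  have h2 : rho x ^ 2 * Real.exp (-C) ^ 2 ≤ rho x ^ 2 * Real.exp (-2 * U x) := by gcongr
  rw [mul_pow, div_pow]
  linarith

/-- The radial derivative of `|F|` is bounded, because the induced map of half-planes is conformal with
bounded factor. -/
theorem IsSliceMap.inner_le {x : E3} (hx : m₁ / 2 < ‖x‖) (hρ : rho x ≠ 0) :
    inner ℝ (F x) (fderiv ℝ F x x) ≤ ‖F x‖ * (Real.exp (2 * C) * ‖x‖) := by
  have h := hF.meridian hμ hx hρ x x
  rw [dRho_self hρ, ← norm_sq_eq] at h
  rw [inner_eq_rho_mul (hF.rho_pos hx hρ).ne']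
  set s := dRho (F x) (fderiv ℝ F x x)
  set w := fderiv ℝ F x x 2
  obtain ⟨p1, -⟩ := hF.psi_bounds hμ hx.le
  have hb := abs_le.1 (hC x hx.le).1
  have hb' := abs_le.1 (hC x hx.le).2
  have hsw : s * s + w * w ≤ (Real.exp (2 * C) * ‖x‖) ^ 2 := by
    have h1 : 1 * (s * s + w * w) ≤ psi μ F x ^ 4 * (s * s + w * w) := by
      gcongr
      · nlinarith [mul_self_nonneg s, mul_self_nonneg w]
      · exact one_le_pow₀ p1
    have h2 : Real.exp (-2 * U x + 2 * α x) * ‖x‖ ^ 2 ≤ Real.exp (2 * C) ^ 2 * ‖x‖ ^ 2 := by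
      gcongr
      rw [← Real.exp_nat_mul]; apply Real.exp_le_exp.2; push_cast; linarith
    rw [mul_pow]; linarith
  refine le_of_sq_le_sq ?_ (by positivity)
  have h3 : (rho (F x) * s + F x 2 * w) ^ 2 ≤ ‖F x‖ ^ 2 * (s * s + w * w) := by
    rw [norm_sq_eq]; nlinarith [sq_nonneg (rho (F x) * w - F x 2 * s)]
  refine h3.trans ?_
  rw [mul_pow]
  gcongr

include hm

/-- The modulus of the image grows at most like the modulus. -/
theorem IsSliceMap.norm_le {t θ : ℝ} (ht : 0 ≤ t) (hθ : θ ∈ Ioo 0 Real.pi) :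
    ‖F (cyl (sphPt (m₁ / 2) (t, θ)))‖ ≤ (μ / 2 + Real.exp (2 * C) * (m₁ / 2)) * Real.exp t := by
  have hR : 0 < m₁ / 2 := by positivity
  set γ : ℝ → E3 := fun t => cyl (sphPt (m₁ / 2) (t, θ)) with hγ
  set K := Real.exp (2 * C) * (m₁ / 2) with hK
  have hγn : ∀ t, ‖γ t‖ = m₁ / 2 * Real.exp t := fun t => norm_cyl_sphPt hR (t, θ)
  have hmem : ∀ s ∈ Ici (0 : ℝ), γ s ∈ exterior (m₁ / 2) := fun s hs =>
    cyl_sphPt_mem hR (p := (s, θ)) hs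
  have hcont : ContinuousOn (fun s => ‖F (γ s)‖ - K * Real.exp s) (Ici 0) := by
    refine ContinuousOn.sub ((hF.smooth.continuousOn.comp ?_ hmem).norm) (by fun_prop)
    exact fun s _ => (hasDerivAt_cyl_sphPt (m₁ / 2) s θ).continuousAt.continuousWithinAt
  have hder : ∀ s ∈ interior (Ici (0 : ℝ)), HasDerivAt (fun s => ‖F (γ s)‖ - K * Real.exp s)
      (2 * inner ℝ (F (γ s)) (fderiv ℝ F (γ s) (γ s)) / (2 * ‖F (γ s)‖) - K * Real.exp s) s := by
    intro s hs
    rw [interior_Ici] at hs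
    have hx : m₁ / 2 < ‖γ s‖ := by
      rw [hγn]; exact lt_mul_of_one_lt_right hR (Real.one_lt_exp_iff.2 hs)
    have h1 := (hF.differentiableAt hx).hasFDerivAt.comp_hasDerivAt s
      (hasDerivAt_cyl_sphPt (m₁ / 2) s θ)
    have h2 := h1.norm_sq.sqrt (pow_ne_zero 2 (hF.norm_pos hμ hx.le).ne')
    simp only [Function.comp_apply, Real.sqrt_sq (norm_nonneg _)] at h2
    exact h2.sub ((Real.hasDerivAt_exp s).const_mul K)
  have hanti : AntitoneOn (fun s => ‖F (γ s)‖ - K * Real.exp s) (Ici 0) := by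
    refine antitoneOn_of_deriv_nonpos (convex_Ici 0) hcont
      (fun s hs => (hder s hs).differentiableAt.differentiableWithinAt) fun s hs => ?_
    rw [(hder s hs).deriv]
    rw [interior_Ici] at hs
    have hx : m₁ / 2 < ‖γ s‖ := by
      rw [hγn]; exact lt_mul_of_one_lt_right hR (Real.one_lt_exp_iff.2 hs)
    have hρ : rho (γ s) ≠ 0 := by
      have := Real.sin_pos_of_mem_Ioo hθ
      rw [hγ, rho_cyl_sphPt_pos hR hθ]; positivity
    have h3 := hF.inner_le hμ hC hx hρ
    have h4 := hF.norm_pos hμ hx.le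
    rw [hγn] at h3
    rw [sub_nonpos, div_le_iff₀ (by positivity), hK]
    linarith
  have h5 := hanti self_mem_Ici ht ht
  have h6 : ‖F (γ 0)‖ = μ / 2 := hF.norm_boundary hR (by rw [hγn]; simp)
  have h7 := Real.one_le_exp ht
  simp only [h6, Real.exp_zero, mul_one] at h5
  have hK0 : 0 < K := by positivity
  nlinarith

/-- The lower bound for `|F|` is that for `ρ ∘ F` and degenerates at the axis; the logarithm of `sin θ`
that it costs is square integrable. -/
theorem IsSliceMap.abs_logRatio_le {t θ : ℝ} (ht : 0 < t) (hθ : θ ∈ Ioo 0 Real.pi) :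
    |logRatio (m₁ / 2) μ F (t, θ)| ≤ |Real.log (μ / 2) - Real.log (Real.exp (-C) / 4 * (m₁ / 2))|
      + |Real.log (μ / 2) - Real.log (μ / 2 + Real.exp (2 * C) * (m₁ / 2))|
      + |Real.log (Real.sin θ)| := by
  have hR : 0 < m₁ / 2 := by positivity
  have hs := Real.sin_pos_of_mem_Ioo hθ
  have hx : m₁ / 2 < ‖cyl (sphPt (m₁ / 2) (t, θ))‖ := by
    rw [norm_cyl]; exact cylRadius_sphPt_gt hR (p := (t, θ)) ht
  have hρ : rho (cyl (sphPt (m₁ / 2) (t, θ))) ≠ 0 := by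
    rw [rho_cyl_sphPt_pos hR hθ]; positivity
  have h1 := (hF.rho_ge hμ hC hx hρ).trans (rho_le_norm _)
  rw [rho_cyl_sphPt_pos hR hθ] at h1
  have h2 := hF.norm_le hm hμ hC ht.le hθ
  have hN := hF.norm_pos hμ hx.le
  have l1 := Real.log_le_log (by positivity) h1
  have l2 := Real.log_le_log hN h2
  rw [Real.log_mul (by positivity) (by positivity), Real.log_exp] at l2
  have e : Real.exp (-C) / 4 * (m₁ / 2 * Real.exp t * Real.sin θ) =
      Real.exp (-C) / 4 * (m₁ / 2) * (Real.exp t * Real.sin θ) := by ring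
  rw [e, Real.log_mul (by positivity) (by positivity), Real.log_mul (Real.exp_pos t).ne' hs.ne',
    Real.log_exp] at l1
  rw [logRatio_eq, abs_le]
  have a1 := neg_abs_le (Real.log (μ / 2) - Real.log (Real.exp (-C) / 4 * (m₁ / 2)))
  have a1' := le_abs_self (Real.log (μ / 2) - Real.log (Real.exp (-C) / 4 * (m₁ / 2)))
  have a2 := neg_abs_le (Real.log (μ / 2) - Real.log (μ / 2 + Real.exp (2 * C) * (m₁ / 2)))
  have a2' := le_abs_self (Real.log (μ / 2) - Real.log (μ / 2 + Real.exp (2 * C) * (m₁ / 2)))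
  have a3 := neg_abs_le (Real.log (Real.sin θ))
  have a3' := le_abs_self (Real.log (Real.sin θ))
  constructor
  · simp only
    linarith
  · simp only
    linarith

end

/-- The isometry stretches the modulus by a constant factor: the logarithm of the ratio is harmonic in
the half-strip, vanishes on the boundary, satisfies the Neumann condition at the sides, and is bounded
in `L²(0, π)`. -/
theorem IsSliceMap.norm_eq (hF : IsSliceMap (m₁ / 2) μ (metric U α B A) F F')
    (h : IsAxisymmetricData m₁ k U α B A) (hm : 0 < m₁) (hμ : 0 < μ) {t θ : ℝ} (ht : 0 ≤ t)
    (hθ : θ ∈ Icc 0 Real.pi) : ‖F (cyl (sphPt (m₁ / 2) (t, θ)))‖ = μ / 2 * Real.exp t := by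
  have hR : 0 < m₁ / 2 := by positivity
  obtain ⟨C, hC⟩ := h.exists_bound hm
  have hs := hF.contDiffOn_logRatio hm hμ
  set D := |Real.log (μ / 2) - Real.log (Real.exp (-C) / 4 * (m₁ / 2))|
      + |Real.log (μ / 2) - Real.log (μ / 2 + Real.exp (2 * C) * (m₁ / 2))| with hD
  have hD0 : 0 ≤ D := by positivity
  have key : logRatio (m₁ / 2) μ F (t, θ) = 0 := by
    refine harmonic_eq_zero hs (fun t ht θ hθ => hF.harmonic_logRatio hm hμ ht hθ)
      (fun t ht => by rw [(hF.dTh_logRatio_axis hm hμ (le_of_lt ht)).1, mul_zero])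
      (fun t ht => by rw [(hF.dTh_logRatio_axis hm hμ (le_of_lt ht)).2, mul_zero])
      (fun θ _ => ?_) (M := ∫ θ in (0 : ℝ)..Real.pi, (2 * D ^ 2 + 2 * logSinBound θ))
      (fun t ht => ?_) ht hθ
    · rw [logRatio_eq, hF.norm_boundary hR (by rw [norm_cyl_sphPt hR]; simp)]
      simp
    · have hc : Continuous fun θ => logRatio (m₁ / 2) μ F (t, θ) ^ 2 :=
        (continuous_iff_continuousAt.2 fun θ => (hasDerivAt_dTh hs (le_of_lt ht)).continuousAt).pow 2
      refine intervalIntegral.integral_mono_on_of_le_Ioo Real.pi_pos.le (hc.intervalIntegrable _ _)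
        (intervalIntegrable_const.add (intervalIntegrable_logSinBound.const_mul 2)) fun θ hθ => ?_
      have h1 := hF.abs_logRatio_le hm hμ hC ht hθ
      have h2 := log_sin_sq_le hθ
      rw [← hD] at h1
      calc logRatio (m₁ / 2) μ F (t, θ) ^ 2 ≤ (D + |Real.log (Real.sin θ)|) ^ 2 := by
            rw [← sq_abs]; gcongr
        _ ≤ 2 * D ^ 2 + 2 * Real.log (Real.sin θ) ^ 2 := by
            rw [← sq_abs (Real.log _)]; nlinarith [sq_nonneg (D - |Real.log (Real.sin θ)|)]
        _ ≤ _ := by linarith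
  have hN := hF.norm_pos hμ (cyl_sphPt_mem hR (p := (t, θ)) ht)
  rw [logRatio_eq] at key
  have : Real.log ‖F (cyl (sphPt (m₁ / 2) (t, θ)))‖ = Real.log (μ / 2 * Real.exp t) := by
    rw [Real.log_mul (by positivity) (by positivity), Real.log_exp]
    simp only at key
    linarith
  exact Real.log_injOn_pos hN (by positivity : 0 < μ / 2 * Real.exp t) this

end

/-! ### The data of a Schwarzschild slice -/

/-- A conformal matrix `!![a₀, a₁; b₀, b₁]` stretches all vectors by the same factor, and so does its
transpose. -/
theorem sq_add_sq_of_conformal {a₀ a₁ b₀ b₁ c a b : ℝ} (hc : 0 < c) (h0 : a₀ * a₀ + b₀ * b₀ = c)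
    (h1 : a₁ * a₁ + b₁ * b₁ = c) (h01 : a₀ * a₁ + b₀ * b₁ = 0) :
    (a * a₀ + b * b₀) ^ 2 + (a * a₁ + b * b₁) ^ 2 = c * (a * a + b * b) := by
  have e1 : a₁ * a₁ = b₀ * b₀ := by
    apply mul_left_cancel₀ hc.ne'
    linear_combination (-a₁ * a₁) * h0 + b₀ * b₀ * h1 + (a₀ * a₁ - b₀ * b₁) * h01
  have e2 : b₁ * b₁ = a₀ * a₀ := by linarith
  have e3 : a₀ * b₀ + a₁ * b₁ = 0 := by
    apply mul_left_cancel₀ hc.ne'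
    linear_combination (-a₁ * b₁) * h0 - a₀ * b₀ * h1 + (a₀ * b₁ + a₁ * b₀) * h01
  linear_combination a * a * (h0 + e1) + b * b * (h0 + e2) + 2 * a * b * e3

section
variable {m₁ μ : ℝ} {k : ℕ} {U α B A : E3 → ℝ} {F F' : E3 → E3}

section
variable (hF : IsSliceMap (m₁ / 2) μ (metric U α B A) F F')
  (h : IsAxisymmetricData m₁ k U α B A) (hm : 0 < m₁) (hμ : 0 < μ)
include hF h hm hμ

theorem IsSliceMap.norm_eq_mul {q : Fin 3 → ℝ} (hq : q ∈ offAxis (m₁ / 2)) :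
    ‖F (cyl q)‖ = μ / m₁ * cylRadius q := by
  have hR : 0 < m₁ / 2 := by positivity
  obtain ⟨t, ht, θ, hθ, e⟩ := exists_sphPt hR hq.1 hq.2
  have h1 : cylRadius q = m₁ / 2 * Real.exp t := by
    rw [e, cylRadius_add_single, cylRadius_sphPt hR]
  rw [h1, e, ← rot_cyl, hF.rot_comm _ _ (cyl_sphPt_mem hR (p := (t, θ)) ht.le), norm_rot,
    hF.norm_eq h hm hμ ht.le (Ioo_subset_Icc_self hθ)]
  field_simp

theorem IsSliceMap.normSq_eq_mul {q : Fin 3 → ℝ} (hq : q ∈ offAxis (m₁ / 2)) :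
    rho (F (cyl q)) * rho (F (cyl q)) + F (cyl q) 2 * F (cyl q) 2 =
      (μ / m₁) ^ 2 * (q 0 * q 0 + q 1 * q 1) := by
  rw [← norm_sq_eq, hF.norm_eq_mul h hm hμ hq, mul_pow, cylRadius, Real.sq_sqrt (by positivity)]
  ring

/-- The equation `(ρ ∘ F)² + (z ∘ F)² = (μ / m₁)² (ρ² + z²)`, differentiated. -/
theorem IsSliceMap.pd_normSq {q : Fin 3 → ℝ} (hq : q ∈ offAxis (m₁ / 2)) (i : Fin 3) :
    rho (F (cyl q)) * pd i (fun q => rho (F (cyl q))) q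
      + F (cyl q) 2 * pd i (fun q => F (cyl q) 2) q =
    (μ / m₁) ^ 2 * (q 0 * ![1, 0, 0] i + q 1 * ![0, 1, 0] i) := by
  have hn := (isOpen_offAxis (m₁ / 2)).mem_nhds hq
  have ha := ((hF.contDiffOn_rho.contDiffAt hn).differentiableAt (by simp)).hasFDerivAt
  have hb := ((hF.contDiffOn_height.contDiffAt hn).differentiableAt (by simp)).hasFDerivAt
  have p : ∀ i : Fin 3, HasFDerivAt (fun q : Fin 3 → ℝ => q i)
      (ContinuousLinearMap.proj (R := ℝ) (φ := fun _ => ℝ) i) q := fun i =>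
    (ContinuousLinearMap.proj (R := ℝ) (φ := fun _ : Fin 3 => ℝ) i).hasFDerivAt
  have h1 := (ha.mul ha).add (hb.mul hb)
  have h2 := (((p 0).mul (p 0)).add ((p 1).mul (p 1))).const_mul ((μ / m₁) ^ 2)
  have h3 := h1.congr_of_eventuallyEq (f₁ := fun q => (μ / m₁) ^ 2 * (q 0 * q 0 + q 1 * q 1)) (by
    filter_upwards [hn] with y hy using (hF.normSq_eq_mul h hm hμ hy).symm)
  have h4 := congrArg (fun L => L (Pi.single i 1)) (h3.unique h2)
  have e0 : (Pi.single i 1 : Fin 3 → ℝ) 0 = ![1, 0, 0] i := by fin_cases i <;> rfl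
  have e1 : (Pi.single i 1 : Fin 3 → ℝ) 1 = ![0, 1, 0] i := by fin_cases i <;> rfl
  simp [e0, e1] at h4
  unfold pd
  linarith

/-- The conformal factor is constant, and `ρ ∘ F` satisfies Euler's equation for functions homogeneous
of degree one. The factor is found from the gradient of `|F|²`, computed in two ways. -/
theorem IsSliceMap.euler {q : Fin 3 → ℝ} (hq : q ∈ offAxis (m₁ / 2)) :
    conformalFactor μ F U α (cyl q) = (μ / m₁) ^ 2 ∧
      q 0 * pd 0 (fun q => rho (F (cyl q))) q + q 1 * pd 1 (fun q => rho (F (cyl q))) q =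
        rho (F (cyl q)) := by
  obtain ⟨hc, h0, h1, h01⟩ := hF.conformal_relations hμ hq
  have d0 := hF.pd_normSq h hm hμ hq 0
  have d1 := hF.pd_normSq h hm hμ hq 1
  have hL := hF.normSq_eq_mul h hm hμ hq
  have hq0 : 0 < q 0 * q 0 + q 1 * q 1 := by nlinarith [mul_pos hq.1 hq.1, mul_self_nonneg (q 1)]
  simp only [Matrix.cons_val_zero, Matrix.cons_val_one] at d0 d1
  set a := rho (F (cyl q))
  set b := F (cyl q) 2
  set a₀ := pd 0 (fun q => rho (F (cyl q))) q
  set a₁ := pd 1 (fun q => rho (F (cyl q))) q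
  set b₀ := pd 0 (fun q => F (cyl q) 2) q
  set b₁ := pd 1 (fun q => F (cyl q) 2) q
  set c := conformalFactor μ F U α (cyl q)
  have hκ : 0 < (μ / m₁) ^ 2 := by positivity
  have hs := sq_add_sq_of_conformal (a := a) (b := b) hc h0 h1 h01
  rw [d0, d1, hL] at hs
  have hcκ : c = (μ / m₁) ^ 2 := by
    apply mul_right_cancel₀ (mul_pos hκ hq0).ne'
    linear_combination -hs
  refine ⟨hcκ, ?_⟩
  have hsum : (q 0 * a₀ + q 1 * a₁ - a) ^ 2 + (q 0 * b₀ + q 1 * b₁ - b) ^ 2 = 0 := by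
    linear_combination q 0 ^ 2 * h0 + q 1 ^ 2 * h1 + 2 * q 0 * q 1 * h01
      - 2 * q 0 * d0 - 2 * q 1 * d1 + hL + (q 0 ^ 2 + q 1 ^ 2) * hcκ
  nlinarith [sq_nonneg (q 0 * a₀ + q 1 * a₁ - a), sq_nonneg (q 0 * b₀ + q 1 * b₁ - b)]

theorem IsSliceMap.psi_eq {t θ : ℝ} (ht : 0 ≤ t) (hθ : θ ∈ Ioo 0 Real.pi) :
    psi μ F (cyl (sphPt (m₁ / 2) (t, θ))) = 1 + Real.exp (-t) := by
  rw [psi, hF.norm_eq h hm hμ ht (Ioo_subset_Icc_self hθ), Real.exp_neg]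
  field_simp

/-- The lengths of the orbits, expressed through the deviation from the Schwarzschild potential. -/
theorem IsSliceMap.rho_strip {t θ : ℝ} (ht : 0 < t) (hθ : θ ∈ Ioo 0 Real.pi) :
    rho (F (cyl (sphPt (m₁ / 2) (t, θ)))) * Real.exp (-t) =
      m₁ / 2 * Real.sin θ * Real.exp (-deviation (m₁ / 2) U (t, θ)) := by
  have hR : 0 < m₁ / 2 := by positivity
  have hs := Real.sin_pos_of_mem_Ioo hθ
  have hx : m₁ / 2 < ‖cyl (sphPt (m₁ / 2) (t, θ))‖ := by
    rw [norm_cyl]; exact cylRadius_sphPt_gt hR (p := (t, θ)) ht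
  have e := rho_cyl_sphPt_pos hR (t := t) hθ
  have ho := hF.orbit hx (by rw [e]; positivity)
  have hp : 0 < 1 + Real.exp (-t) := by positivity
  rw [hF.psi_eq h hm hμ ht.le hθ, e] at ho
  have hv : Real.exp (-deviation (m₁ / 2) U (t, θ)) ^ 2 * (1 + Real.exp (-t)) ^ 4 =
      Real.exp (-2 * U (cyl (sphPt (m₁ / 2) (t, θ)))) := by
    have h4 : (1 + Real.exp (-t)) ^ 4 = Real.exp (4 * Real.log (1 + Real.exp (-t))) := by
      rw [mul_comm, Real.exp_mul, Real.exp_log hp]; norm_cast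
    rw [h4, ← Real.exp_nat_mul, ← Real.exp_add, deviation, strip]
    congr 1
    push_cast
    ring
  have he : Real.exp t * Real.exp (-t) = 1 := by rw [← Real.exp_add]; simp
  have hr : 0 ≤ rho (F (cyl (sphPt (m₁ / 2) (t, θ)))) := Real.sqrt_nonneg _
  refine (sq_eq_sq₀ (by positivity) (by positivity)).1 ?_
  apply mul_left_cancel₀ (pow_pos hp 4).ne'
  rw [← hv] at ho
  calc (1 + Real.exp (-t)) ^ 4 * (rho (F (cyl (sphPt (m₁ / 2) (t, θ)))) * Real.exp (-t)) ^ 2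
      = (1 + Real.exp (-t)) ^ 4 * rho (F (cyl (sphPt (m₁ / 2) (t, θ)))) ^ 2 * Real.exp (-t) ^ 2 := by
        ring
    _ = (1 + Real.exp (-t)) ^ 4 * (m₁ / 2 * Real.sin θ *
          Real.exp (-deviation (m₁ / 2) U (t, θ))) ^ 2 * (Real.exp t * Real.exp (-t)) ^ 2 := by
        rw [ho]; ring
    _ = _ := by rw [he]; ring

/-- The potential is that of the Schwarzschild slice: `ρ ∘ F` is homogeneous, so that the deviation
is constant along the rays, and it tends to zero. -/
theorem IsSliceMap.deviation_eq_zero {t θ : ℝ} (ht : 0 < t) (hθ : θ ∈ Ioo 0 Real.pi) :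
    deviation (m₁ / 2) U (t, θ) = 0 := by
  have hR : 0 < m₁ / 2 := by positivity
  have hs := Real.sin_pos_of_mem_Ioo hθ
  have hd : ∀ s ∈ Ioi (0 : ℝ), HasDerivAt
      (fun s => rho (F (cyl (sphPt (m₁ / 2) (s, θ)))) * Real.exp (-s)) 0 s := by
    intro s hs0
    have hq : sphPt (m₁ / 2) (s, θ) ∈ offAxis (m₁ / 2) := sphPt_mem hR hs0 hθ
    have ha := (hF.contDiffOn_rho.contDiffAt ((isOpen_offAxis (m₁ / 2)).mem_nhds hq)).differentiableAt
      (by simp)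
    have h1 := hasDerivAt_comp_sphPt_t ha
    rw [(hF.euler h hm hμ hq).2] at h1
    exact (h1.mul (hasDerivAt_neg s).exp).congr_deriv (by ring)
  have hconst : ∀ s > 0, Real.exp (-deviation (m₁ / 2) U (s, θ)) =
      Real.exp (-deviation (m₁ / 2) U (t, θ)) := by
    intro s hs0
    have h1 := isOpen_Ioi.is_const_of_deriv_eq_zero isPreconnected_Ioi
      (fun s hs => (hd s hs).differentiableAt.differentiableWithinAt)
      (fun s hs => (hd s hs).deriv) (mem_Ioi.2 hs0) (mem_Ioi.2 ht)
    simp only [hF.rho_strip h hm hμ hs0 hθ, hF.rho_strip h hm hμ ht hθ] at h1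
    exact mul_left_cancel₀ (by positivity) h1
  have h2 := (tendsto_of_expDecay (expDecay_deviation hR h.decay_U) θ).neg.rexp
  have h3 : Tendsto (fun s => Real.exp (-deviation (m₁ / 2) U (s, θ))) atTop
      (𝓝 (Real.exp (-deviation (m₁ / 2) U (t, θ)))) := by
    refine tendsto_const_nhds.congr' ?_
    filter_upwards [eventually_gt_atTop 0] with s hs0 using (hconst s hs0).symm
  have h4 := tendsto_nhds_unique h3 h2
  rw [Real.exp_eq_exp] at h4
  linarith

/-- The constancy of the conformal factor makes `e^(2α)` constant, and `α` tends to zero. -/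
theorem IsSliceMap.strip_eq_zero {t θ : ℝ} (ht : 0 < t) (hθ : θ ∈ Ioo 0 Real.pi) :
    strip (m₁ / 2) α (t, θ) = 0 := by
  have hR : 0 < m₁ / 2 := by positivity
  have key : ∀ s > 0, Real.exp (2 * strip (m₁ / 2) α (s, θ)) = (μ / m₁) ^ 2 := by
    intro s hs
    have hq : sphPt (m₁ / 2) (s, θ) ∈ offAxis (m₁ / 2) := sphPt_mem hR hs hθ
    have h1 := (hF.euler h hm hμ hq).1
    have hp : 0 < 1 + Real.exp (-s) := by positivity
    rw [conformalFactor, hF.psi_eq h hm hμ hs.le hθ, div_eq_iff (pow_pos hp 4).ne'] at h1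
    have h2 := hF.deviation_eq_zero h hm hμ hs hθ
    rw [deviation, strip] at h2
    have h3 : (1 + Real.exp (-s)) ^ 4 = Real.exp (-2 * U (cyl (sphPt (m₁ / 2) (s, θ)))) := by
      nth_rewrite 1 [← Real.exp_log hp]
      rw [← Real.exp_nat_mul]
      congr 1
      simp only at h2
      push_cast
      linarith
    rw [h3, Real.exp_add, mul_comm] at h1
    exact mul_right_cancel₀ (Real.exp_pos _).ne' h1
  have h2 := ((tendsto_of_expDecay (h.decay_α.expDecay hR) θ).const_mul 2).rexp
  have h3 : Tendsto (fun s => Real.exp (2 * strip (m₁ / 2) α (s, θ))) atTop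
      (𝓝 (Real.exp (2 * strip (m₁ / 2) α (t, θ)))) := by
    refine tendsto_const_nhds.congr' ?_
    filter_upwards [eventually_gt_atTop 0] with s hs0
    rw [key s hs0, key t ht]
  have h4 := tendsto_nhds_unique h3 h2
  rw [Real.exp_eq_exp] at h4
  linarith

theorem IsSliceMap.excess_eq_zero {x : E3} (hx : m₁ / 2 < ‖x‖) (hρ : rho x ≠ 0) :
    excess (m₁ / 2) U x = 0 := by
  have hR : 0 < m₁ / 2 := by positivity
  obtain ⟨q, hq, rfl⟩ := exists_cyl_eq hρ
  rw [norm_cyl] at hx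
  obtain ⟨t, ht, θ, hθ, e⟩ := exists_sphPt hR hq hx
  rw [e, (smoothAxisymmetric_excess hR h.smooth_U).comp_cyl_add
    (cylRadius_sphPt_gt hR (p := (t, θ)) ht).le]
  have := congrFun (strip_excess hR (U := U)) (t, θ)
  rw [strip, hF.deviation_eq_zero h hm hμ ht hθ] at this
  exact this

theorem IsSliceMap.integral_energyDensity :
    ∫ x in openExterior (m₁ / 2), energyDensity (m₁ / 2) (excess (m₁ / 2) U) x = 0 := by
  refine MeasureTheory.integral_eq_zero_of_ae ?_
  have hax : ∀ᵐ x : E3, rho x ≠ 0 := MeasureTheory.measure_eq_zero_iff_ae_notMem.1 volume_axis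
  filter_upwards [MeasureTheory.ae_restrict_of_ae hax,
    MeasureTheory.ae_restrict_mem (isOpen_openExterior (m₁ / 2)).measurableSet] with x hρ hx
  have hcont : Continuous rho := by unfold rho; fun_prop
  have hz : HasGradientAt (excess (m₁ / 2) U) 0 x := by
    refine (hasGradientAt_const x (0 : ℝ)).congr_of_eventuallyEq ?_
    filter_upwards [hcont.continuousAt.eventually_ne hρ, (isOpen_openExterior (m₁ / 2)).mem_nhds hx]
      with y hy1 hy2 using hF.excess_eq_zero h hm hμ hy2 hy1
  simp [energyDensity, hz.gradient]

/-- The functional vanishes on the data of a Schwarzschild slice. -/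
theorem IsSliceMap.J_eq_zero {C_H : ℝ}
    (hconst : ∀ x : E3, ‖x‖ = m₁ / 2 → U x - 1 / 2 * α x = C_H) :
    J m₁ (PhiStar m₁) (PsiStar m₁) U α = 0 := by
  have hR : 0 < m₁ / 2 := by positivity
  have hθ : Real.pi / 2 ∈ Ioo 0 Real.pi := ⟨by positivity, by linarith [Real.pi_pos]⟩
  have e1 := eq_zero_of_forall_pos (contDiffOn_deviation hR h.smooth_U.smooth)
    fun t ht => hF.deviation_eq_zero h hm hμ ht hθ
  have e2 := eq_zero_of_forall_pos (contDiffOn_strip hR h.smooth_α.smooth)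
    fun t ht => hF.strip_eq_zero h hm hμ ht hθ
  have e3 := hconst (cyl (sphPt (m₁ / 2) (0, Real.pi / 2))) (by rw [norm_cyl_sphPt hR]; simp)
  have e4 : C_H + 2 * Real.log 2 = 0 := by
    simp only [deviation, strip, neg_zero, Real.exp_zero] at e1
    norm_num at e1
    rw [e2] at e3
    linarith
  rw [h.J_eq hm hconst, e4, hF.integral_energyDensity h hm hμ]
  simp

end

end

end Axisym

end

theorem mainTheorem8 (m₁ : ℝ) (hm₁ : 0 < m₁) (k : ℕ) (hk : 5 ≤ k)
    (U α B A : Axisym.E3 → ℝ)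
    (hdata : Axisym.IsAxisymmetricData m₁ k U α B A)
    (hscal : Axisym.NonnegScalarCurvature (m₁ / 2) (Axisym.metric U α B A))
    (hmin : Axisym.MinimalBoundary (m₁ / 2) (Axisym.metric U α B A))
    (C_H : ℝ) (hC_H : -2 * Real.log 2 ≤ C_H)
    (hconst : ∀ x : Axisym.E3, ‖x‖ = m₁ / 2 → U x - 1 / 2 * α x = C_H) :
    0 ≤ Axisym.J m₁ (Axisym.PhiStar m₁) (Axisym.PsiStar m₁) U α ∧
      (Axisym.J m₁ (Axisym.PhiStar m₁) (Axisym.PsiStar m₁) U α = 0 ↔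
        Axisym.IsSchwarzschildSlice (m₁ / 2) (Axisym.metric U α B A)) := by
  refine ⟨hdata.J_nonneg hm₁ hk hscal hmin hC_H hconst, fun hJ => ?_, ?_⟩
  · obtain ⟨hc, hV⟩ := hdata.eq_of_J_eq_zero hm₁ hk hscal hmin hC_H hconst hJ
    obtain ⟨htw, hα⟩ := hdata.rigid hm₁ hk hscal hmin hconst hc hV
    exact hdata.isSchwarzschildSlice hm₁ hk hV htw hα
  · rintro ⟨μ, hμ, F, F', h1, h2, h3, h4, h5, h6, h7⟩
    have hF : Axisym.IsSliceMap (m₁ / 2) μ (Axisym.metric U α B A) F F' :=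
      ⟨h1, h2, h3, h4, h5, h6, h7⟩
    exact hF.J_eq_zero hdata hm₁ hμ hconst
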